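/- **Setting.** A data point is $\mathbf d=(\mathbf x,a,y)$ with covariates $\mathbf x$, treatment $a\in\{0,1\}$ and further information $y$ (e.g. an outcome); $\mathcal Z$ is the set of feasible data points. A dataset is $\mathcal D=(\mathbf d_1,\dots,\mathbf d_n)\in\mathcal Z^n$, $n\ge 1$; $\mathcal D\sim\mathcal D'$ means that $\mathcal D,\mathcal D'$ differ in at most one data point. $\mathcal D_a$ is the set of indices $i$ with $a_i=a$, and $n_a=|\mathcal D_a|$. For a weighting scheme $\mathcal D\mapsto \mathbf w(\mathcal D)$ defined on a class $\mathfrak D$ of size-$n$ datasets, write $\mathbf w=\mathbf w(\mathcal D)$, $\mathbf w'=\mathbf w(\mathcal D')$ and $$W_1=\|\mathbf w-\mathbf w'\|_1+\max_i (w_i\wedge w_i'),\qquad W_2=\sqrt{\|\mathbf w-\mathbf w'\|_2^2+2\max_i w_iw_i'}\,\sqrt{1+\|\mathbf w-\mathbf w'\|_0},$$ $\overline W_i=\sup W_i$ over all $\mathcal D\sim\mathcal D'$ in $\mathfrak D$. **Mechanism (DP-2ERM).** Let $\boldsymbol\Theta\subseteq\mathbb R^p$ ($p\ge1$) be nonempty,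 closed and convex, $R(\cdot):\mathbb R^p\to\mathbb R$ convex, and, for every $\mathbf d\in\mathcal Z$, $\ell(\cdot;\mathbf d):\mathbb R^p\to\mathbb R$ convex and $C^2$ with $\|\nabla\ell(\boldsymbol\theta;\mathbf d)\|_2\le\zeta$ and $\operatorname{tr}\nabla^2\ell(\boldsymbol\theta;\mathbf d)\le\lambda$ for all $\boldsymbol\theta\in\boldsymbol\Theta$. For $\gamma>0$ the output is $$\boldsymbol\theta^{\rm priv}=\operatorname*{arg\,min}_{\boldsymbol\theta\in\boldsymbol\Theta}\ \frac1n\sum_i w_i(\mathcal D)\,\ell(\boldsymbol\theta;\mathbf d_i)+R(\boldsymbol\theta)+\frac\gamma2\|\boldsymbol\theta\|_2^2+\frac{\langle\mathbf b,\boldsymbol\theta\rangle}{n},$$ where $\mathbf b$ is Gamma noise (density $\propto e^{-\beta\|\mathbf b\|_2}$, $\beta>0$) or Gaussian noise $\mathcal N(\mathbf 0,\sigma^2\mathbf I_p)$, $\sigma>0$. The mechanism is $(\epsilon,\delta)$-DP on $\mathfrak D$ if $\mathbb P_{\mathcal D}(\boldsymbol\theta^{\rm priv}\in S)\le e^\epsilon\,\mathbb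 P_{\mathcal D'}(\boldsymbol\theta^{\rm priv}\in S)+\delta$ for all $\mathcal D\sim\mathcal D'$ in $\mathfrak D$ and all Borel $S$; $\epsilon$-DP means $(\epsilon,0)$-DP. **Statement.** Fix $\epsilon_0$. For each scheme below there is a constant $c>0$, depending only on $\epsilon_0$ and the parameters listed with the scheme, such that with $B_1=c\,r_1$ and $B_2=c\,r_2$, where $r_1,r_2$ are the rates given with the scheme, for all $n\ge 1$: * $\overline W_1\le B_1$ and $\overline W_2\le B_2$; * with Gamma noise, DP-2ERM is $\epsilon$-DP on $\mathfrak D$ for every $\epsilon>0$ whenever $\frac1\beta\ge\frac{2\zeta}{\epsilon}B_1$ and $\gamma\ge\frac{2\lambda}{\epsilon n}B_2$; * with Gaussian noise, DP-2ERM is $(\epsilon,\delta)$-DP on $\mathfrak D$ for all $0<\epsilon\le\epsilon_0$ and $0<\delta<1$ whenever $\sigma\ge\frac\zeta\epsilon\bigl(\tilde L+\sqrt{\tilde L^2+\tfrac{\epsilon}{3n}}\bigr)B_1$ and $\gamma\ge\frac{2\lambda}{\epsilon n}B_2$, where $\tilde L=\sqrt{(\sqrt p+\sqrt{\log\delta^{-1}})^2+\log\delta^{-1}}$.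 The schemes are as follows; in each of them $c$ is uniform in the regularization parameter. 1. *IPW, randomized trial* ($c$ depends on $p_1=1-p_0\in(0,1)$): $w_i=n\,p_{a_i}^{-1}/\sum_j p_{a_j}^{-1}$ and $\mathfrak D=\mathcal Z^n$. *IPW, known regression parameter $\boldsymbol\lambda^*$* ($c$ depends on $M,R$ with $\|\mathbf x\|_2\le M$ on $\mathcal Z$ and $\|\boldsymbol\lambda^*\|_2\le R$): $w_i=n(1+e^{-\langle\mathbf x_i,\boldsymbol\lambda^*\rangle})/\sum_j(1+e^{-\langle\mathbf x_j,\boldsymbol\lambda^*\rangle})$ and $\mathfrak D=\mathcal Z^n$. In both cases $r_1=1$ and $r_2=\sqrt n$. 2. *IPW, estimated regression parameter* ($c$ depends on $M,R$ with $\|\mathbf x\|_2\le M$ on $\mathcal Z$): the same formula with $\boldsymbol\lambda^*$ replaced by a minimizer $\hat{\boldsymbol\lambda}$, over $\|\boldsymbol\lambda\|_2\le R$, of $\frac1n\sum_i[\log(1+e^{\langle\mathbf x_i,\boldsymbol\lambda\rangle})-a_i\langle\mathbf x_i,\boldsymbol\lambda\rangle]+\frac{\lambda_{\rm IPW}}2\|\boldsymbol\lambda\|_2^2$,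 $\lambda_{\rm IPW}\ge0$; $\mathfrak D=\mathcal Z^n$; $r_1=\frac{\sqrt n}{1+\lambda_{\rm IPW}}+\sqrt n$ and $r_2=\sqrt n$. 3. *MMD weights* ($c$ depends on $C,R$): let $\mathcal H$ be an RKHS with kernel $K$, $K(\mathbf x,\mathbf x')\le C$ for covariates of feasible points, and $\alpha\in[0,1]$, $\lambda_{\rm MMD}>0$. Then $\mathbf w=\frac12\mathbf u$, where $\mathbf u$ minimizes $\alpha\,\mathrm{MMD}^2_{\mathcal H}(\mathbb P^{\mathbf u}_{\mathcal D_0},\mathbb P_{\mathcal D})+\alpha\,\mathrm{MMD}^2_{\mathcal H}(\mathbb P^{\mathbf u}_{\mathcal D_1},\mathbb P_{\mathcal D})+(1-\alpha)\,\mathrm{MMD}^2_{\mathcal H}(\mathbb P^{\mathbf u}_{\mathcal D_0},\mathbb P^{\mathbf u}_{\mathcal D_1})+\kappa\|\mathbf u\|_2^2$ over $0\le u_i\le R$, $\sum_{i\in\mathcal D_0}u_i=\sum_{i\in\mathcal D_1}u_i=n$. Here $\mathbb P^{\mathbf u}_{\mathcal D_a}=\sum_{i\in\mathcal D_a}\frac{u_i}n\delta_{\mathbf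 x_i}$ and $\mathbb P_{\mathcal D}=\frac1n\sum_i\delta_{\mathbf x_i}$, and the claim holds for both normalizations $\kappa=\lambda_{\rm MMD}/n^2$ and $\kappa=\lambda_{\rm MMD}/2$. $\mathfrak D$ is the set of $\mathcal D\in\mathcal Z^n$ for which this problem is feasible; $r_1=r_2=\frac{n^{3/2}}{\lambda_{\rm MMD}}+\sqrt n$. 4. *Entropy balancing weights* ($c$ depends on $K,B,R,r$): let $\mathbf g$ be a moment map into $\mathbb R^{K+1}$, $\overline{\mathbf g}=\frac1n\sum_i\mathbf g(\mathbf x_i)$, $\mathbf q$ a positive probability vector with $\max_i q_i\le r\min_i q_i$, and $\lambda_{\rm EBW}\ge0$. Put $t_i(\boldsymbol\lambda)=q_i\exp\bigl(\frac n{n_{a_i}}\langle\boldsymbol\lambda_{a_i},\mathbf g(\mathbf x_i)\rangle\bigr)$ for $\boldsymbol\lambda=(\boldsymbol\lambda_0,\boldsymbol\lambda_1)$. Then $w_i=n\,t_i(\boldsymbol\lambda^*)/\sum_jt_j(\boldsymbol\lambda^*)$, where $\boldsymbol\lambda^*$ minimizes $\log\sum_it_i(\boldsymbol\lambda)-\langle\boldsymbol\lambda_0+\boldsymbol\lambda_1,\overline{\mathbf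 g}\rangle+\frac{\lambda_{\rm EBW}}2\|\boldsymbol\lambda\|_2^2$ over $\|\boldsymbol\lambda\|_\infty\le R$. $\mathfrak D$ is the set of $\mathcal D\in\mathcal Z^n$ with $n_0,n_1\ge1$ and $\frac n{n_{a_i}}\|\mathbf g(\mathbf x_i)\|_2\le B$ for all $i$; $r_1=\frac1{1+\lambda_{\rm EBW}}+\sqrt n$ and $r_2=\sqrt n$. -/

import Mathlib

open MeasureTheory ProbabilityTheory
open scoped ENNReal

noncomputable section

namespace DP2ERM

/-- The ambient Euclidean space `ℝ^p`. -/
abbrev Euc (p : ℕ) : Type := EuclideanSpace ℝ (Fin p)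

/-! ### Datasets, neighbours, differential privacy -/

/-- Two datasets of the same size are neighbours if they differ in at most one data point. -/
def Neighbors {n : ℕ} {Z : Type*} (D D' : Fin n → Z) : Prop :=
  ∃ j, ∀ i, i ≠ j → D i = D' i

/-- `(ε, δ)`-differential privacy, over the collection `𝔇` of datasets, of the randomized mechanism
whose output on the dataset `D` has the law `Mech D`. -/
def IsDP {n : ℕ} {Z E : Type*} [MeasurableSpace E] (𝔇 : Set (Fin n → Z))
    (Mech : (Fin n → Z) → Measure E) (ε δ : ℝ) : Prop :=
  (∀ D ∈ 𝔇, IsProbabilityMeasure (Mech D)) ∧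
  ∀ D ∈ 𝔇, ∀ D' ∈ 𝔇, Neighbors D D' → ∀ S : Set E, MeasurableSet S →
    Mech D S ≤ ENNReal.ofReal (Real.exp ε) * Mech D' S + ENNReal.ofReal δ

/-! ### Weight sensitivity -/

/-- `W₁ = ‖w - w'‖₁ + max_i (w_i ∧ w'_i)`. -/
def W1 {n : ℕ} (w w' : Fin n → ℝ) : ℝ :=
  ∑ i, |w i - w' i| + ⨆ i, min (w i) (w' i)

/-- `W₂ = √(‖w - w'‖₂² + 2 max_i w_i w'_i) · √(1 + ‖w - w'‖₀)`. -/
def W2 {n : ℕ} (w w' : Fin n → ℝ) : ℝ :=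
  √(∑ i, (w i - w' i) ^ 2 + 2 * ⨆ i, w i * w' i) *
    √(1 + ((Finset.univ.filter fun i => w i ≠ w' i).card : ℝ))

/-- Worst-case value `sup_{D ∼ D'} W₁(w(D), w(D'))` over neighbouring datasets in `𝔇`. -/
def W1bar {n : ℕ} {Z : Type*} (𝔇 : Set (Fin n → Z)) (w : (Fin n → Z) → Fin n → ℝ) : EReal :=
  ⨆ D ∈ 𝔇, ⨆ D' ∈ 𝔇, ⨆ _ : Neighbors D D', ((W1 (w D) (w D') : ℝ) : EReal)

/-- Worst-case value `sup_{D ∼ D'} W₂(w(D), w(D'))` over neighbouring datasets in `𝔇`. -/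
def W2bar {n : ℕ} {Z : Type*} (𝔇 : Set (Fin n → Z)) (w : (Fin n → Z) → Fin n → ℝ) : EReal :=
  ⨆ D ∈ 𝔇, ⨆ D' ∈ 𝔇, ⨆ _ : Neighbors D D', ((W2 (w D) (w D') : ℝ) : EReal)

/-! ### The algorithm -/

/-- The perturbed second-stage objective
`(1/n) ∑ w_i ℓ(θ; d_i) + R(θ) + (γ/2) ‖θ‖² + ⟨b, θ⟩ / n`. -/
def privObjective {n p : ℕ} {Z : Type*} (ℓ : Z → Euc p → ℝ) (Rg : Euc p → ℝ) (γ : ℝ)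
    (w : Fin n → ℝ) (D : Fin n → Z) (b θ : Euc p) : ℝ :=
  (1 / n) * ∑ i, w i * ℓ (D i) θ + Rg θ + γ / 2 * ‖θ‖ ^ 2 + inner ℝ b θ / n

/-- The private estimator: the minimizer over `Θ` of the perturbed objective. -/
def privEstimator {n p : ℕ} {Z : Type*} (Θ : Set (Euc p)) (ℓ : Z → Euc p → ℝ) (Rg : Euc p → ℝ)
    (γ : ℝ) (w : (Fin n → Z) → Fin n → ℝ) (D : Fin n → Z) (b : Euc p) : Euc p :=
  Classical.epsilon fun θ => θ ∈ Θ ∧ IsMinOn (privObjective ℓ Rg γ (w D) D b) Θ θ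

/-- The law of the output of DP-2ERM on the dataset `D` when the noise `b` has law `ν`. -/
def dp2erm {n p : ℕ} {Z : Type*} (ν : Measure (Euc p)) (Θ : Set (Euc p)) (ℓ : Z → Euc p → ℝ)
    (Rg : Euc p → ℝ) (γ : ℝ) (w : (Fin n → Z) → Fin n → ℝ) (D : Fin n → Z) : Measure (Euc p) :=
  ν.map (privEstimator Θ ℓ Rg γ w D)

/-- Gamma noise: the probability measure on `ℝ^p` with density proportional to `exp (-β ‖b‖)`. -/
def gammaNoise (p : ℕ) (β : ℝ) : Measure (Euc p) :=
  (∫⁻ b : Euc p, ENNReal.ofReal (Real.exp (-β * ‖b‖)))⁻¹ •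
    (volume : Measure (Euc p)).withDensity fun b => ENNReal.ofReal (Real.exp (-β * ‖b‖))

/-- Gaussian noise `N(0, σ² I_p)`. -/
def gaussianNoise (p : ℕ) (σ : ℝ) : Measure (Euc p) :=
  multivariateGaussian 0 (σ ^ 2 • (1 : Matrix (Fin p) (Fin p) ℝ))

/-- The trace of the Hessian of `f` at `θ`. -/
def hessianTrace {p : ℕ} (f : Euc p → ℝ) (θ : Euc p) : ℝ :=
  ∑ i, iteratedFDeriv ℝ 2 f θ ![EuclideanSpace.single i 1, EuclideanSpace.single i 1]

/-- The requirements on the inputs of the second stage: a nonempty closed convex constraint set, a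
convex regularizer, and a convex loss with continuous Hessian whose gradient has norm at most `ζ`
and whose Hessian has trace at most `lam` on `Θ`, for all feasible data points `d ∈ 𝒵`. -/
structure SecondStage {p : ℕ} {Z : Type*} (𝒵 : Set Z) (Θ : Set (Euc p)) (ℓ : Z → Euc p → ℝ)
    (Rg : Euc p → ℝ) (ζ lam : ℝ) : Prop where
  nonempty : Θ.Nonempty
  isClosed : IsClosed Θ
  convex : Convex ℝ Θ
  convex_reg : ConvexOn ℝ Set.univ Rg
  convex_loss : ∀ d ∈ 𝒵, ConvexOn ℝ Set.univ (ℓ d)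
  contDiff_loss : ∀ d ∈ 𝒵, ContDiff ℝ 2 (ℓ d)
  gradient_le : ∀ d ∈ 𝒵, ∀ θ ∈ Θ, ‖gradient (ℓ d) θ‖ ≤ ζ
  hessianTrace_le : ∀ d ∈ 𝒵, ∀ θ ∈ Θ, hessianTrace (ℓ d) θ ≤ lam

/-- `L̃ = √((√p + √(log δ⁻¹))² + log δ⁻¹)`. -/
def Ltilde (p : ℕ) (δ : ℝ) : ℝ :=
  √((√(p : ℝ) + √(Real.log δ⁻¹)) ^ 2 + Real.log δ⁻¹)

/-- With Gamma noise, DP-2ERM with the weights `w` is `ε`-DP as soon as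
`1/β ≥ (2ζ/ε) B₁` and `γ ≥ (2 lam/(ε n)) B₂`. -/
def GammaGuarantee {n : ℕ} {Z : Type*} (𝒵 : Set Z) (𝔇 : Set (Fin n → Z))
    (w : (Fin n → Z) → Fin n → ℝ) (B₁ B₂ : ℝ) : Prop :=
  ∀ (p : ℕ), 1 ≤ p → ∀ (Θ : Set (Euc p)) (ℓ : Z → Euc p → ℝ) (Rg : Euc p → ℝ) (ζ lam : ℝ),
    SecondStage 𝒵 Θ ℓ Rg ζ lam →
    ∀ ε β γ : ℝ, 0 < ε → 0 < β → 0 < γ →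
      1 / β ≥ 2 * ζ / ε * B₁ → γ ≥ 2 * lam / (ε * n) * B₂ →
      IsDP 𝔇 (dp2erm (gammaNoise p β) Θ ℓ Rg γ w) ε 0

/-- With Gaussian noise, DP-2ERM with the weights `w` is `(ε, δ)`-DP, for `ε ≤ ε₀`, as soon as
`σ ≥ (ζ/ε) (L̃ + √(L̃² + ε/(3n))) B₁` and `γ ≥ (2 lam/(ε n)) B₂`. -/
def GaussianGuarantee (ε₀ : ℝ) {n : ℕ} {Z : Type*} (𝒵 : Set Z) (𝔇 : Set (Fin n → Z))
    (w : (Fin n → Z) → Fin n → ℝ) (B₁ B₂ : ℝ) : Prop :=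
  ∀ (p : ℕ), 1 ≤ p → ∀ (Θ : Set (Euc p)) (ℓ : Z → Euc p → ℝ) (Rg : Euc p → ℝ) (ζ lam : ℝ),
    SecondStage 𝒵 Θ ℓ Rg ζ lam →
    ∀ ε δ σ γ : ℝ, 0 < ε → ε ≤ ε₀ → 0 < δ → δ < 1 → 0 < σ → 0 < γ →
      σ ≥ ζ / ε * (Ltilde p δ + √(Ltilde p δ ^ 2 + ε / (3 * n))) * B₁ →
      γ ≥ 2 * lam / (ε * n) * B₂ →
      IsDP 𝔇 (dp2erm (gaussianNoise p σ) Θ ℓ Rg γ w) ε δ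

/-- The differential privacy guarantee of DP-2ERM holds with the sensitivity bounds
`W̄₁ ≤ B₁` and `W̄₂ ≤ B₂`. -/
structure PrivacyGuarantee (ε₀ : ℝ) {n : ℕ} {Z : Type*} (𝒵 : Set Z) (𝔇 : Set (Fin n → Z))
    (w : (Fin n → Z) → Fin n → ℝ) (B₁ B₂ : ℝ) : Prop where
  W1bar_le : W1bar 𝔇 w ≤ (B₁ : EReal)
  W2bar_le : W2bar 𝔇 w ≤ (B₂ : EReal)
  gamma : GammaGuarantee 𝒵 𝔇 w B₁ B₂
  gaussian : GaussianGuarantee ε₀ 𝒵 𝔇 w B₁ B₂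

/-! ### Covariate balancing weights -/

/-- A data point: covariates `x`, treatment `a ∈ {0, 1}`, and any further information `y` (such as
an outcome) that only the second stage uses. -/
structure Record (X Y : Type*) where
  x : X
  a : Fin 2
  y : Y

/-- The datasets of size `n` all of whose data points are feasible. -/
def feasibleDatasets (n : ℕ) {Z : Type*} (𝒵 : Set Z) : Set (Fin n → Z) :=
  {D | ∀ i, D i ∈ 𝒵}

/-- The normalization `n v / ∑ v` of a vector of positive scores to total sum `n`. -/
def normalized {n : ℕ} (v : Fin n → ℝ) (i : Fin n) : ℝ :=
  n * v i / ∑ j, v j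

/-- IPW in a randomized trial with treatment probabilities `p_1 = π`, `p_0 = 1 - π`. -/
def ipwRandomized {n : ℕ} {X Y : Type*} (π : ℝ) (D : Fin n → Record X Y) : Fin n → ℝ :=
  normalized fun i => 1 / (if (D i).a = 1 then π else 1 - π)

/-- IPW under the logistic propensity model with regression parameter `μ`: the unnormalized weight
is `1 / P(A = 1 ∣ x) = 1 + exp (-⟨x, μ⟩)`. -/
def ipwLogistic {n d : ℕ} {Y : Type*} (μ : Euc d) (D : Fin n → Record (Euc d) Y) : Fin n → ℝ :=
  normalized fun i => 1 + Real.exp (-inner ℝ (D i).x μ)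

/-- Regularized logistic negative log-likelihood
`(1/n) ∑ [log (1 + exp ⟨x_i, μ⟩) - a_i ⟨x_i, μ⟩] + (lam/2) ‖μ‖²`. -/
def logisticLoss {n d : ℕ} {Y : Type*} (lam : ℝ) (D : Fin n → Record (Euc d) Y) (μ : Euc d) : ℝ :=
  (1 / n) * ∑ i, (Real.log (1 + Real.exp (inner ℝ (D i).x μ)) -
    (((D i).a : ℕ) : ℝ) * inner ℝ (D i).x μ) + lam / 2 * ‖μ‖ ^ 2

/-- `w` is the IPW vector of `D` whose regression parameter is estimated by regularized logistic
regression over the ball of radius `R`. -/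
def IsEstimatedIPW {n d : ℕ} {Y : Type*} (R lam : ℝ) (D : Fin n → Record (Euc d) Y)
    (w : Fin n → ℝ) : Prop :=
  ∃ μ : Euc d, ‖μ‖ ≤ R ∧ IsMinOn (logisticLoss lam D) {ν | ‖ν‖ ≤ R} μ ∧ w = ipwLogistic μ D

/-- Maximum mean discrepancy, over the unit ball of the RKHS `H`, between the distributions
`∑ u_i δ_{x_i}` and `∑ v_i δ_{x_i}`. -/
def mmd {X : Type*} (H : Type*) [NormedAddCommGroup H] [InnerProductSpace ℝ H] [RKHS ℝ H X ℝ]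
    {n : ℕ} (x : Fin n → X) (u v : Fin n → ℝ) : ℝ :=
  ⨆ f : {f : H // ‖f‖ ≤ 1}, |∑ i, u i * (f : H) (x i) - ∑ i, v i * (f : H) (x i)|

/-- The masses of the weighted empirical distribution `∑_{i ∈ D_a} (u_i/n) δ_{x_i}`. -/
def groupMass {n : ℕ} {X Y : Type*} (D : Fin n → Record X Y) (u : Fin n → ℝ) (a : Fin 2)
    (i : Fin n) : ℝ :=
  if (D i).a = a then u i / n else 0

/-- The three-way balancing objective
`α MMD²(P_{D₀}, P_D) + α MMD²(P_{D₁}, P_D) + (1-α) MMD²(P_{D₀}, P_{D₁}) + κ ‖u‖²`. -/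
def mmdObjective {X Y : Type*} (H : Type*) [NormedAddCommGroup H] [InnerProductSpace ℝ H]
    [RKHS ℝ H X ℝ] {n : ℕ} (α κ : ℝ) (D : Fin n → Record X Y) (u : Fin n → ℝ) : ℝ :=
  α * mmd H (fun i => (D i).x) (groupMass D u 0) (fun _ => 1 / (n : ℝ)) ^ 2 +
  α * mmd H (fun i => (D i).x) (groupMass D u 1) (fun _ => 1 / (n : ℝ)) ^ 2 +
  (1 - α) * mmd H (fun i => (D i).x) (groupMass D u 0) (groupMass D u 1) ^ 2 +
  κ * ∑ i, u i ^ 2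

/-- Admissible arguments of the MMD problem: nonnegative, bounded by `R`, with sum `n` over each of
the two treatment groups. -/
def mmdFeasible {n : ℕ} {X Y : Type*} (R : ℝ) (D : Fin n → Record X Y) : Set (Fin n → ℝ) :=
  {u | (∀ i, 0 ≤ u i ∧ u i ≤ R) ∧ ∀ a : Fin 2, ∑ i, (if (D i).a = a then u i else 0) = n}

/-- `w` is the vector of MMD weights of `D`: half of the minimizer of the balancing objective. -/
def IsMMDWeight {X Y : Type*} (H : Type*) [NormedAddCommGroup H] [InnerProductSpace ℝ H]
    [RKHS ℝ H X ℝ] {n : ℕ} (R α κ : ℝ) (D : Fin n → Record X Y) (w : Fin n → ℝ) : Prop :=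
  ∃ u ∈ mmdFeasible R D, IsMinOn (mmdObjective H α κ D) (mmdFeasible R D) u ∧
    w = fun i => u i / 2

/-- The datasets with feasible data points for which the MMD problem is feasible. -/
def mmdDatasets (n : ℕ) {X Y : Type*} (𝒵 : Set (Record X Y)) (R : ℝ) :
    Set (Fin n → Record X Y) :=
  {D | (∀ i, D i ∈ 𝒵) ∧ (mmdFeasible R D).Nonempty}

/-- The number `n_a` of data points in the treatment group `a`. -/
def groupSize {n : ℕ} {X Y : Type*} (D : Fin n → Record X Y) (a : Fin 2) : ℕ :=
  (Finset.univ.filter fun i => (D i).a = a).card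

/-- The exponential tilts `q_i exp ((n/n_{a_i}) ⟨λ_{a_i}, g(x_i)⟩)` of entropy balancing. -/
def ebwTilt {n K : ℕ} {X Y : Type*} (g : X → Euc (K + 1)) (q : Fin n → ℝ)
    (D : Fin n → Record X Y) (lam : Fin 2 → Euc (K + 1)) (i : Fin n) : ℝ :=
  q i * Real.exp ((n : ℝ) / groupSize D (D i).a * inner ℝ (lam (D i).a) (g (D i).x))

/-- The (convex) dual objective of entropy balancing,
`log C(λ) - ⟨λ₀ + λ₁, ḡ⟩ + (ρ/2) ‖λ‖²` with `C(λ)` the sum of the tilts and `ḡ` the mean of the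
moment vectors `g(x_i)`. -/
def ebwDual {n K : ℕ} {X Y : Type*} (g : X → Euc (K + 1)) (q : Fin n → ℝ) (ρ : ℝ)
    (D : Fin n → Record X Y) (lam : Fin 2 → Euc (K + 1)) : ℝ :=
  Real.log (∑ i, ebwTilt g q D lam i) -
    inner ℝ (lam 0 + lam 1) ((1 / (n : ℝ)) • ∑ i, g (D i).x) +
    ρ / 2 * (‖lam 0‖ ^ 2 + ‖lam 1‖ ^ 2)

/-- The dual variables of sup-norm at most `R`. -/
def ebwBox (K : ℕ) (R : ℝ) : Set (Fin 2 → Euc (K + 1)) :=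
  {lam | ∀ a r, |lam a r| ≤ R}

/-- `w` is the vector of entropy balancing weights of `D`. -/
def IsEBW {n K : ℕ} {X Y : Type*} (g : X → Euc (K + 1)) (q : Fin n → ℝ) (R ρ : ℝ)
    (D : Fin n → Record X Y) (w : Fin n → ℝ) : Prop :=
  ∃ lam ∈ ebwBox K R, IsMinOn (ebwDual g q ρ D) (ebwBox K R) lam ∧
    w = normalized (ebwTilt g q D lam)

/-- The datasets with feasible data points and nonempty treatment groups whose scaled moment vectors
`(n/n_{a_i}) g(x_i)` have norm at most `B`. -/
def ebwDatasets (n : ℕ) {K : ℕ} {X Y : Type*} (𝒵 : Set (Record X Y)) (g : X → Euc (K + 1))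
    (B : ℝ) : Set (Fin n → Record X Y) :=
  {D | (∀ i, D i ∈ 𝒵) ∧ (∀ a, 0 < groupSize D a) ∧
    ∀ i, (n : ℝ) / groupSize D (D i).a * ‖g (D i).x‖ ≤ B}

end DP2ERM

end

/-! Privacy is a change of variables in the noise. For neighbours `D`, `D'` let G(θ) = ∑ w'_i ∇ℓ(θ;
d'_i) − ∑ w_i ∇ℓ(θ; d_i), and let θ'(b) be the output on `D'` with noise b. The loss gradients and
the noise enter the optimality condition only through their sum, so `D` with noise b + G(θ'(b)) also
returns θ'(b). This map, `noiseMap`, is a bijection: exchanging `D` and `D'` inverts it.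

It moves b by at most 2 W₁ ζ, because |w − w'| + 2 min(w, w') = w + w' at the altered index. Its
derivative is 1 + H M, where H is the difference of the weighted Hessians and M the derivative of
θ'. In every orthonormal basis the diagonal of H has absolute sum at most 2 W₁ λ, while ‖M‖ ≤ 1/(nγ)
by strong convexity, so Hadamard's inequality bounds the determinant by exp(2 W₁ λ/(nγ))
(`abs_det_one_add_comp_le`). The constraint set makes θ' merely Lipschitz; Rademacher's theorem
gives the derivative almost everywhere. Half of ε pays for the Jacobian and half for the change of
the noise density, in the Gaussian case on a ball that misses mass at most δ
(`SecondStage.isDP_of_density`).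

Everything is charged to W₁. In every scheme r₁ ≤ 2 r₂, so after enlarging c the curvature condition
with B₂ covers 2 W₁; W₂ itself only has to be bounded. Hence it suffices to bound the weights and
their ℓ¹ and ℓ² sensitivities (`privacyGuarantee_of_rates`).

For fixed scores these bounds are direct. For weights defined by optimization, compare the
minimizers u on `D` and v on `D'` through the midpoint gap F(u) + F(v) − 2F((u+v)/2) of the
objective F of `D`: optimality on both sides bounds it by twice the change of the objective between
the datasets. The gap controls the weights directly, without passing through the parameters. For
logistic regression it dominates squared differences of exp(−⟨x, μ⟩); for entropy balancing it
dominates a squared Hellinger distance; both give ℓ² bounds free of n that need no regularization.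
For MMD it is at least κ/2 ‖u − v‖², where v must first be moved into the feasible set of `D`. -/

noncomputable section

namespace DP2ERM

/-! ### Hadamard's inequality and the Jacobian determinant. -/

section Determinant

variable {E : Type*} [NormedAddCommGroup E] [InnerProductSpace ℝ E]

/-- Hadamard's inequality for the images of an orthonormal basis. -/
lemma abs_det_le_prod_norm {m : ℕ} (hm : Module.finrank ℝ E = m)
    (b : OrthonormalBasis (Fin m) ℝ E) (T : E →ₗ[ℝ] E) :
    |LinearMap.det T| ≤ ∏ i, ‖T (b i)‖ := by
  have : Fact (Module.finrank ℝ E = m) := ⟨hm⟩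
  have h := b.toBasis.orientation.abs_volumeForm_apply_le (fun i => T (b i))
  rw [Orientation.volumeForm_robust' _ b] at h
  have h2 := Module.Basis.det_comp b.toBasis T (fun i => b i)
  have h3 : b.toBasis.det (fun i => b i) = 1 := by
    rw [← OrthonormalBasis.coe_toBasis]; exact b.toBasis.det_self
  rw [h3, mul_one] at h2
  rwa [← h2]

variable [FiniteDimensional ℝ E]

/-- If the symmetric operator `H` has absolute diagonal sum at most `N` in every orthonormal basis
and `‖M‖ ≤ c`, then `|det (1 + H M)| ≤ exp (N c)`. -/
lemma abs_det_one_add_comp_le (H M : E →L[ℝ] E) (hH : (H : E →ₗ[ℝ] E).IsSymmetric) {N c : ℝ}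
    (hN : ∀ b : OrthonormalBasis (Fin (Module.finrank ℝ E)) ℝ E,
      ∑ k, |inner ℝ (b k) (H (b k))| ≤ N) (hM : ‖M‖ ≤ c) :
    |(ContinuousLinearMap.id ℝ E + H ∘L M).det| ≤ Real.exp (N * c) := by
  set T : E →L[ℝ] E := ContinuousLinearMap.id ℝ E + H ∘L M with hT
  set b := hH.eigenvectorBasis rfl with hb
  set μ := hH.eigenvalues rfl
  have hc : 0 ≤ c := (norm_nonneg _).trans hM
  have hev : ∀ k, H (b k) = μ k • b k := fun k => by
    exact hH.apply_eigenvectorBasis rfl k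
  have hμ : ∀ k, inner ℝ (b k) (H (b k)) = μ k := fun k => by
    rw [hev, real_inner_smul_right, real_inner_self_eq_norm_sq, b.orthonormal.1 k]; simp
  have hsum := hN b
  simp_rw [hμ] at hsum
  -- The determinant is read off the adjoint 1 + M* H, which sends an eigenvector e_k of H to e_k +
  -- μ_k M* e_k. Hadamard's inequality then needs only 1 + |μ_k| c ≤ exp(|μ_k| c).
  have hadj : ContinuousLinearMap.det T = LinearMap.det
      (LinearMap.adjoint (T : E →ₗ[ℝ] E)) := by
    rw [← LinearMap.det_toMatrix b.toBasis (LinearMap.adjoint _), LinearMap.toMatrix_adjoint b b,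
      Matrix.det_conjTranspose, LinearMap.det_toMatrix]
    simp [ContinuousLinearMap.det]
  rw [hadj]
  refine (abs_det_le_prod_norm rfl b _).trans ?_
  have hcol : ∀ k, ‖LinearMap.adjoint (T : E →ₗ[ℝ] E) (b k)‖ ≤ Real.exp (|μ k| * c) := by
    intro k
    have h1 : LinearMap.adjoint (T : E →ₗ[ℝ] E) (b k) =
        b k + μ k • ContinuousLinearMap.adjoint M (b k) := by
      refine ext_inner_right ℝ fun v => ?_
      rw [LinearMap.adjoint_inner_left]
      simp only [hT, ContinuousLinearMap.coe_coe, add_apply,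
        ContinuousLinearMap.id_apply, ContinuousLinearMap.comp_apply, inner_add_left,
        inner_add_right, real_inner_smul_left, ContinuousLinearMap.adjoint_inner_left]
      congr 1
      have := hH (b k) (M v)
      simp only [ContinuousLinearMap.coe_coe] at this
      rw [← this, hev, real_inner_smul_left]
    rw [h1]
    calc _ ≤ ‖b k‖ + ‖μ k • ContinuousLinearMap.adjoint M (b k)‖ := norm_add_le _ _
      _ ≤ 1 + |μ k| * c := by
        rw [norm_smul, b.orthonormal.1 k, Real.norm_eq_abs]
        have h2 : ‖ContinuousLinearMap.adjoint M (b k)‖ ≤ c := by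
          refine (ContinuousLinearMap.le_opNorm _ _).trans ?_
          rw [LinearIsometryEquiv.norm_map, b.orthonormal.1 k, mul_one]; exact hM
        gcongr
      _ ≤ _ := by rw [add_comm]; exact Real.add_one_le_exp _
  calc _ ≤ ∏ k, Real.exp (|μ k| * c) :=
        Finset.prod_le_prod (fun _ _ => norm_nonneg _) fun k _ => hcol k
    _ = Real.exp ((∑ k, |μ k|) * c) := by rw [← Real.exp_sum, Finset.sum_mul]
    _ ≤ _ := by gcongr

end Determinant

/-! ### Change of variables for Lipschitz bijections. -/

section ChangeOfVariables

variable {E : Type*} [NormedAddCommGroup E] [InnerProductSpace ℝ E] [FiniteDimensional ℝ E]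
  [MeasurableSpace E] [BorelSpace E]

/-- A Lipschitz map preserves null sets of the Hausdorff measure of the full dimension, and these
are the Lebesgue null sets. It disposes of the image of the points of non-differentiability. -/
lemma volume_image_eq_zero_of_lipschitzWith {K : NNReal} {T : E → E} (hT : LipschitzWith K T)
    {s : Set E} (hs : volume s = 0) : volume (T '' s) = 0 := by
  set μ : Measure E := Measure.hausdorffMeasure (Module.finrank ℝ E : ℝ)
  have hμs : μ s = 0 := Measure.absolutelyContinuous_isAddHaarMeasure μ volume hs
  refine Measure.absolutelyContinuous_isAddHaarMeasure volume μ ?_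
  refine le_antisymm ?_ zero_le
  refine (hT.hausdorffMeasure_image_le (by positivity) s).trans ?_
  change _ * μ s ≤ 0
  rw [hμs, mul_zero]

/-- Change of variables for a Lipschitz bijection whose Jacobian is bounded by `J`. -/
lemma setLIntegral_le_of_lipschitz_bijective {K : NNReal} {T : E → E} (hT : LipschitzWith K T)
    (hbij : Function.Bijective T) {J : ℝ} (hJ : ∀ᵐ x, |(fderiv ℝ T x).det| ≤ J)
    {f : E → ℝ≥0∞} {A : Set E} (hA : MeasurableSet A) {c : ℝ≥0∞} (hc : c ≠ ⊤)
    (hf : ∀ x, T x ∈ A → f (T x) ≤ c * f x) :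
    ∫⁻ x in A, f x ≤ ENNReal.ofReal J * c * ∫⁻ x in T ⁻¹' A, f x := by
  set G := {x | DifferentiableAt ℝ T x} with hG
  have hGm : MeasurableSet G := measurableSet_of_differentiableAt ℝ T
  have hGc : volume Gᶜ = 0 := hT.ae_differentiableAt
  have hAm : MeasurableSet (T ⁻¹' A) := hT.continuous.measurable hA
  -- The second piece is negligible: Rademacher's theorem makes `Gᶜ` null, and its image is null as
  -- well.
  have hsub : A ⊆ T '' (T ⁻¹' A ∩ G) ∪ T '' Gᶜ := by
    intro y hy
    obtain ⟨x, rfl⟩ := hbij.2 y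
    by_cases hx : x ∈ G
    · exact Or.inl ⟨x, ⟨hy, hx⟩, rfl⟩
    · exact Or.inr ⟨x, hx, rfl⟩
  calc ∫⁻ x in A, f x ≤ ∫⁻ x in T '' (T ⁻¹' A ∩ G) ∪ T '' Gᶜ, f x := lintegral_mono_set hsub
    _ ≤ (∫⁻ x in T '' (T ⁻¹' A ∩ G), f x) + ∫⁻ x in T '' Gᶜ, f x := lintegral_union_le _ _ _
    _ = ∫⁻ x in T '' (T ⁻¹' A ∩ G), f x := by
      rw [setLIntegral_measure_zero _ _ (volume_image_eq_zero_of_lipschitzWith hT hGc), add_zero]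
    _ = ∫⁻ x in T ⁻¹' A ∩ G, ENNReal.ofReal |(fderiv ℝ T x).det| * f (T x) :=
      lintegral_image_eq_lintegral_abs_det_fderiv_mul volume (hAm.inter hGm)
        (fun x hx => hx.2.hasFDerivAt.hasFDerivWithinAt) hbij.1.injOn f
    _ ≤ ∫⁻ x in T ⁻¹' A ∩ G, ENNReal.ofReal J * c * f x := by
      refine lintegral_mono_ae ?_
      filter_upwards [ae_restrict_of_ae hJ, ae_restrict_mem (hAm.inter hGm)] with x hx hx2
      rw [mul_assoc]
      exact mul_le_mul' (ENNReal.ofReal_le_ofReal hx) (hf x hx2.1)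
    _ ≤ ∫⁻ x in T ⁻¹' A, ENNReal.ofReal J * c * f x := lintegral_mono_set Set.inter_subset_left
    _ = _ := lintegral_const_mul' _ _ (ENNReal.mul_ne_top ENNReal.ofReal_ne_top hc)

end ChangeOfVariables

/-! ### Convex minimization: optimality conditions and existence. -/

section FirstOrder

variable {E : Type*} [NormedAddCommGroup E] [InnerProductSpace ℝ E]

lemma inner_le_sub_of_convexOn [CompleteSpace E] {f : E → ℝ} (hf : ConvexOn ℝ Set.univ f)
    {x g : E} (hg : HasGradientAt f g x) (y : E) : inner ℝ g (y - x) ≤ f y - f x := by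
  have h1 : HasDerivAt (fun t : ℝ => f (x + t • (y - x))) (inner ℝ g (y - x)) 0 := by
    have hline : HasDerivAt (fun t : ℝ => x + t • (y - x)) (y - x) 0 := by
      simpa using ((hasDerivAt_id (0 : ℝ)).smul_const (y - x)).const_add x
    have hg' := hg.hasFDerivAt
    rw [show x = x + (0 : ℝ) • (y - x) by simp] at hg'
    simpa using! hg'.comp_hasDerivAt (0 : ℝ) hline
  have h2 : ConvexOn ℝ Set.univ (fun t : ℝ => f (x + t • (y - x))) := by
    have := hf.comp_affineMap (AffineMap.lineMap x y : ℝ →ᵃ[ℝ] E)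
    refine this.congr fun t _ => ?_
    simp [AffineMap.lineMap_apply, add_comm]
  have h3 := h2.le_slope_of_hasDerivAt (Set.mem_univ 0) (Set.mem_univ 1) one_pos h1
  simpa [slope_def_field] using h3

lemma gradient_monotone_of_convexOn [CompleteSpace E] {f : E → ℝ} (hf : ConvexOn ℝ Set.univ f)
    {x y gx gy : E} (hx : HasGradientAt f gx x) (hy : HasGradientAt f gy y) :
    0 ≤ inner ℝ (gx - gy) (x - y) := by
  have h1 := inner_le_sub_of_convexOn hf hx y
  have h2 := inner_le_sub_of_convexOn hf hy x
  have h3 : inner ℝ gx (y - x) = - inner ℝ gx (x - y) := by rw [← inner_neg_right, neg_sub]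
  rw [inner_sub_left]; linarith

/-- The first-order optimality condition for minimizing a differentiable convex function plus a
convex function over a convex set. -/
lemma isMinOn_add_iff [CompleteSpace E] {Θ : Set E} (hΘ : Convex ℝ Θ) {f h : E → ℝ}
    (hf : ConvexOn ℝ Set.univ f) (hh : ConvexOn ℝ Set.univ h) {θ g : E} (hθ : θ ∈ Θ)
    (hg : HasGradientAt f g θ) :
    IsMinOn (fun x => f x + h x) Θ θ ↔ ∀ x ∈ Θ, 0 ≤ inner ℝ g (x - θ) + h x - h θ := by
  constructor
  · intro hmin x hx
    -- Only f is differentiable, so h is replaced along the segment by its chord, which lies above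
    -- it. The resulting function of t is at least f θ on [0, 1], with equality at 0, so its
    -- derivative at 0 is nonnegative.
    have hd : HasDerivAt (fun t : ℝ => f (θ + t • (x - θ)) + t * (h x - h θ))
        (inner ℝ g (x - θ) + (h x - h θ)) 0 := by
      have hline : HasDerivAt (fun t : ℝ => θ + t • (x - θ)) (x - θ) 0 := by
        simpa using ((hasDerivAt_id (0 : ℝ)).smul_const (x - θ)).const_add θ
      have hg' := hg.hasFDerivAt
      rw [show θ = θ + (0 : ℝ) • (x - θ) by simp] at hg'
      have h1 := hg'.comp_hasDerivAt (0 : ℝ) hline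
      have h2 := (hasDerivAt_id (0 : ℝ)).mul_const (h x - h θ)
      simpa using! h1.add h2
    have hge : ∀ t ∈ Set.Icc (0 : ℝ) 1, f θ ≤ f (θ + t • (x - θ)) + t * (h x - h θ) := by
      intro t ht
      have hmem : θ + t • (x - θ) ∈ Θ := hΘ.add_smul_sub_mem hθ hx ht
      have h1 : f θ + h θ ≤ f (θ + t • (x - θ)) + h (θ + t • (x - θ)) := hmin hmem
      have h2 := hh.2 (Set.mem_univ θ) (Set.mem_univ x) (sub_nonneg.2 ht.2) ht.1
        (sub_add_cancel _ _)
      have h3 : (1 - t) • θ + t • x = θ + t • (x - θ) := by module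
      rw [h3] at h2
      simp only [smul_eq_mul] at h2
      linarith
    by_contra! hneg
    have hd' := hd.hasDerivWithinAt (s := Set.Ioi 0)
    rw [hasDerivWithinAt_iff_tendsto_slope' (by simp)] at hd'
    have h5 := ge_of_tendsto hd' (b := 0) ?_
    · linarith
    · have : Set.Ioc (0 : ℝ) 1 ∈ nhdsWithin (0 : ℝ) (Set.Ioi 0) := Ioc_mem_nhdsGT one_pos
      filter_upwards [this] with t ht
      rw [slope_def_field]
      refine div_nonneg ?_ (by simpa using ht.1.le)
      simpa using hge t ⟨ht.1.le, ht.2⟩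
  · intro hvi x hx
    have h1 := hvi x hx
    have h2 := inner_le_sub_of_convexOn hf hg x
    change f θ + h θ ≤ f x + h x
    linarith

/-- A continuous convex function grows at most linearly towards `-∞`. -/
lemma exists_linear_lower_bound [FiniteDimensional ℝ E] {φ : E → ℝ}
    (hφ : ConvexOn ℝ Set.univ φ) : ∃ a c : ℝ, 0 ≤ c ∧ ∀ x, a - c * ‖x‖ ≤ φ x := by
  have hcont : Continuous φ := hφ.locallyLipschitz.continuous
  obtain ⟨x₀, -, hx₀⟩ := (isCompact_closedBall (0 : E) 1).exists_isMinOn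
    ⟨0, by simp⟩ hcont.continuousOn
  have hmin : ∀ x, ‖x‖ ≤ 1 → φ x₀ ≤ φ x := fun x hx => hx₀ (by simpa using hx)
  refine ⟨φ x₀ - |φ 0|, |φ 0 - φ x₀|, abs_nonneg _, fun x => ?_⟩
  have ha := abs_nonneg (φ 0 - φ x₀)
  have ha' := le_abs_self (φ 0 - φ x₀)
  have hb := abs_nonneg (φ 0)
  have hb' := neg_abs_le (φ 0)
  rcases le_or_gt ‖x‖ 1 with hx | hx
  · have := hmin x hx
    have := mul_nonneg ha (norm_nonneg x)
    linarith
  · have hpos : 0 < ‖x‖ := by linarith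
    -- Convexity on the segment from 0 to x, evaluated at the unit vector x/‖x‖, where φ is at least
    -- its minimum over the ball.
    have h1 := hφ.2 (Set.mem_univ (0 : E)) (Set.mem_univ x)
      (sub_nonneg.2 (inv_le_one_of_one_le₀ hx.le)) (inv_nonneg.2 hpos.le) (sub_add_cancel _ _)
    have h2 := hmin (‖x‖⁻¹ • x) (by rw [norm_smul, norm_inv, norm_norm, inv_mul_cancel₀ hpos.ne'])
    rw [smul_zero, zero_add] at h1
    simp only [smul_eq_mul] at h1
    have h3 : ‖x‖ * φ x₀ ≤ (‖x‖ - 1) * φ 0 + φ x := by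
      have h4 := mul_le_mul_of_nonneg_left (h2.trans h1) hpos.le
      rw [mul_add, ← mul_assoc, ← mul_assoc, mul_sub, mul_inv_cancel₀ hpos.ne'] at h4
      linarith
    have h5 := mul_le_mul_of_nonneg_right ha' hpos.le
    have h6 := hmin 0 (by simp)
    nlinarith [le_abs_self (φ 0)]

/-- The quadratic term beats the linear lower bound on φ, so the objective is coercive and attains
its minimum on a closed set. -/
lemma exists_isMinOn_of_strongly_convex [FiniteDimensional ℝ E] {Θ : Set E} (hne : Θ.Nonempty)
    (hcl : IsClosed Θ) {φ : E → ℝ} (hφ : ConvexOn ℝ Set.univ φ) {γ : ℝ} (hγ : 0 < γ) :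
    ∃ θ ∈ Θ, IsMinOn (fun x => φ x + γ / 2 * ‖x‖ ^ 2) Θ θ := by
  have hcont : Continuous φ := hφ.locallyLipschitz.continuous
  obtain ⟨a, c, hc, hlow⟩ := exists_linear_lower_bound hφ
  obtain ⟨x₀, hx₀⟩ := hne
  refine ContinuousOn.exists_isMinOn' (by fun_prop) hcl hx₀ ?_
  have h1 : Filter.Tendsto (fun r : ℝ => r * (γ / 2 * r - c)) Filter.atTop Filter.atTop := by
    refine Filter.Tendsto.atTop_mul_atTop₀ Filter.tendsto_id ?_
    exact Filter.tendsto_atTop_add_const_right _ _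
      (Filter.tendsto_id.const_mul_atTop (by positivity))
  have h2 := h1.comp (tendsto_norm_cocompact_atTop (E := E))
  have h3 := (Filter.tendsto_atTop.1 h2 (φ x₀ + γ / 2 * ‖x₀‖ ^ 2 - a)).filter_mono
    (inf_le_left (b := Filter.principal Θ))
  filter_upwards [h3] with x hx
  have := hlow x
  simp only [Function.comp] at hx
  nlinarith

end FirstOrder

/-! ### The Hessian as the derivative of the gradient. -/

section Hessian

variable {E : Type*} [NormedAddCommGroup E] [InnerProductSpace ℝ E] [CompleteSpace E]

lemma contDiff_gradient {f : E → ℝ} (hf : ContDiff ℝ 2 f) : ContDiff ℝ 1 (gradient f) := by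
  have h : gradient f = fun x => (InnerProductSpace.toDual ℝ E).symm (fderiv ℝ f x) := rfl
  rw [h]
  exact (InnerProductSpace.toDual ℝ E).symm.contDiff.comp
    (hf.fderiv_right (m := 1) (by norm_num))

lemma inner_fderiv_gradient {f : E → ℝ} (hf : ContDiff ℝ 2 f) (x v u : E) :
    inner ℝ (fderiv ℝ (gradient f) x v) u = fderiv ℝ (fderiv ℝ f) x v u := by
  have h0 : DifferentiableAt ℝ (fderiv ℝ f) x :=
    (hf.fderiv_right (m := 1) (by norm_num)).differentiable (by norm_num) x
  have h1 := h0.hasFDerivAt.clm_apply (hasFDerivAt_const u x)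
  have h2 := ((contDiff_gradient hf).differentiable (by norm_num) x).hasFDerivAt.inner ℝ
    (hasFDerivAt_const u x)
  have h3 : (fun y => inner ℝ (gradient f y) u) = fun y => fderiv ℝ f y u := by
    funext y; rw [inner_gradient_left]
  rw [h3] at h2
  have h4 := congrArg (fun L => L v) (h1.unique h2)
  simpa using h4.symm

lemma inner_fderiv_gradient_symm {f : E → ℝ} (hf : ContDiff ℝ 2 f) (x v u : E) :
    inner ℝ (fderiv ℝ (gradient f) x v) u = inner ℝ v (fderiv ℝ (gradient f) x u) := by
  rw [inner_fderiv_gradient hf, real_inner_comm, inner_fderiv_gradient hf]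
  exact (hf.contDiffAt.isSymmSndFDerivAt (by simp)).eq v u

lemma inner_fderiv_gradient_nonneg {f : E → ℝ} (hf : ContDiff ℝ 2 f)
    (hc : ConvexOn ℝ Set.univ f) (x v : E) : 0 ≤ inner ℝ v (fderiv ℝ (gradient f) x v) := by
  have hg : ∀ y, HasGradientAt f (gradient f y) y := fun y =>
    (hf.differentiable (by norm_num) y).hasGradientAt
  have hline : HasDerivAt (fun t : ℝ => x + t • v) v 0 := by
    simpa using ((hasDerivAt_id (0 : ℝ)).smul_const v).const_add x
  have hd := ((contDiff_gradient hf).differentiable (by norm_num) x).hasFDerivAt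
  rw [show x = x + (0 : ℝ) • v by simp] at hd
  have h1 := hd.comp_hasDerivAt (0 : ℝ) hline
  have h2 := (innerSL ℝ v).hasFDerivAt.comp_hasDerivAt (0 : ℝ) h1
  simp only [zero_smul, add_zero] at h2
  have h3 := h2.hasDerivWithinAt (s := Set.Ioi 0)
  rw [hasDerivWithinAt_iff_tendsto_slope' (by simp)] at h3
  have h4 := ge_of_tendsto h3 (b := 0) ?_
  · simpa using h4
  · filter_upwards [self_mem_nhdsWithin] with t ht
    have ht : 0 < t := ht
    have h5 := gradient_monotone_of_convexOn hc (hg (x + t • v)) (hg x)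
    rw [add_sub_cancel_left, real_inner_smul_right, real_inner_comm] at h5
    rw [slope_def_field]
    refine div_nonneg ?_ (by simpa using ht.le)
    have h6 := nonneg_of_mul_nonneg_right h5 ht
    rw [inner_sub_right] at h6
    simpa using h6

end Hessian

/-- `hessianTrace` is written in the standard basis, but the determinant bound uses the eigenbasis
of a difference of weighted Hessians; the trace does not depend on the basis. -/
lemma sum_inner_fderiv_gradient {p : ℕ} {f : Euc p → ℝ} (hf : ContDiff ℝ 2 f) (θ : Euc p)
    {ι : Type*} [Fintype ι] (b : OrthonormalBasis ι ℝ (Euc p)) :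
    ∑ k, inner ℝ (b k) (fderiv ℝ (gradient f) θ (b k)) = hessianTrace f θ := by
  have h1 := LinearMap.trace_eq_sum_inner (fderiv ℝ (gradient f) θ : Euc p →ₗ[ℝ] Euc p) b
  have h2 := LinearMap.trace_eq_sum_inner (fderiv ℝ (gradient f) θ : Euc p →ₗ[ℝ] Euc p)
    (EuclideanSpace.basisFun (Fin p) ℝ)
  simp only [ContinuousLinearMap.coe_coe] at h1 h2
  rw [← h1, h2, hessianTrace]
  refine Finset.sum_congr rfl fun i _ => ?_
  rw [iteratedFDeriv_two_apply, real_inner_comm, inner_fderiv_gradient hf]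
  simp

/-- By convexity the eigenvalues of the Hessian are nonnegative, so each is at most their sum. The
trace bound thus also makes the gradients Lipschitz on `Θ`. -/
lemma norm_fderiv_gradient_le {p : ℕ} {f : Euc p → ℝ} (hf : ContDiff ℝ 2 f)
    (hc : ConvexOn ℝ Set.univ f) (θ : Euc p) :
    ‖fderiv ℝ (gradient f) θ‖ ≤ hessianTrace f θ := by
  have hsymm : (fderiv ℝ (gradient f) θ : Euc p →ₗ[ℝ] Euc p).IsSymmetric :=
    fun v u => inner_fderiv_gradient_symm hf θ v u
  set A := fderiv ℝ (gradient f) θ with hA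
  set b := hsymm.eigenvectorBasis rfl with hb
  set μ := hsymm.eigenvalues rfl
  have hev : ∀ k, A (b k) = μ k • b k := fun k => hsymm.apply_eigenvectorBasis rfl k
  have hμ : ∀ k, inner ℝ (b k) (A (b k)) = μ k := fun k => by
    rw [hev, real_inner_smul_right, real_inner_self_eq_norm_sq, b.orthonormal.1 k]; simp
  have hμ0 : ∀ k, 0 ≤ μ k := fun k => hμ k ▸ inner_fderiv_gradient_nonneg hf hc θ (b k)
  have hsum : ∑ k, μ k = hessianTrace f θ := by
    rw [← sum_inner_fderiv_gradient hf θ b]; exact Finset.sum_congr rfl fun k _ => (hμ k).symm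
  have hle : ∀ k, μ k ≤ hessianTrace f θ := fun k =>
    hsum ▸ Finset.single_le_sum (fun i _ => hμ0 i) (Finset.mem_univ k)
  have htr : 0 ≤ hessianTrace f θ := hsum ▸ Finset.sum_nonneg fun i _ => hμ0 i
  refine ContinuousLinearMap.opNorm_le_bound _ htr fun v => ?_
  refine le_of_sq_le_sq ?_ (by positivity)
  rw [mul_pow, ← b.sum_sq_norm_inner_right (A v), ← b.sum_sq_norm_inner_right v, Finset.mul_sum]
  refine Finset.sum_le_sum fun k _ => ?_
  have h1 : inner ℝ (b k) (A v) = μ k * inner ℝ (b k) v := by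
    rw [← real_inner_smul_left, ← hev]; exact (hsymm (b k) v).symm
  rw [h1, norm_mul, mul_pow, Real.norm_of_nonneg (hμ0 k)]
  have := hle k
  have := hμ0 k
  gcongr

/-! ### The private estimator as a function of the noise, and the noise map. -/

section Estimator

variable {n p : ℕ} {Z : Type*} {𝒵 : Set Z} {Θ : Set (Euc p)} {ℓ : Z → Euc p → ℝ}
  {Rg : Euc p → ℝ} {ζ lam γ : ℝ}

/-- The weighted sum `∑ w_i ∇ℓ(θ; d_i)` of the gradients. -/
def gradSum (ℓ : Z → Euc p → ℝ) (w : Fin n → ℝ) (D : Fin n → Z) (θ : Euc p) : Euc p :=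
  ∑ i, w i • gradient (ℓ (D i)) θ

/-- The differentiable part of the perturbed objective. -/
def smoothPart (ℓ : Z → Euc p → ℝ) (γ : ℝ) (w : Fin n → ℝ) (D : Fin n → Z) (b θ : Euc p) : ℝ :=
  ((1 / n) * ∑ i, w i * ℓ (D i) θ + inner ℝ b θ / n) + γ / 2 * ‖θ‖ ^ 2

/-- First-order optimality of `θ` for the perturbed objective. -/
def IsStationary (Θ : Set (Euc p)) (ℓ : Z → Euc p → ℝ) (Rg : Euc p → ℝ) (γ : ℝ)
    (w : Fin n → ℝ) (D : Fin n → Z) (b θ : Euc p) : Prop :=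
  θ ∈ Θ ∧ ∀ x ∈ Θ, 0 ≤ inner ℝ ((1 / n : ℝ) • (gradSum ℓ w D θ + b) + γ • θ) (x - θ) +
    Rg x - Rg θ

lemma SecondStage.hasGradientAt (hS : SecondStage 𝒵 Θ ℓ Rg ζ lam) {d : Z} (hd : d ∈ 𝒵)
    (θ : Euc p) : HasGradientAt (ℓ d) (gradient (ℓ d) θ) θ :=
  ((hS.contDiff_loss d hd).differentiable (by norm_num) θ).hasGradientAt

lemma SecondStage.hasGradientAt_sum (hS : SecondStage 𝒵 Θ ℓ Rg ζ lam) {D : Fin n → Z}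
    (hD : ∀ i, D i ∈ 𝒵) (w : Fin n → ℝ) (θ : Euc p) :
    HasGradientAt (fun θ => ∑ i, w i * ℓ (D i) θ) (gradSum ℓ w D θ) θ := by
  rw [hasGradientAt_iff_hasFDerivAt]
  have h := HasFDerivAt.fun_sum (u := Finset.univ) fun i _ =>
    (hS.hasGradientAt (hD i) θ).hasFDerivAt.const_mul (w i)
  convert! h using 1
  simp [gradSum, map_sum]

lemma SecondStage.hasGradientAt_smoothPart (hS : SecondStage 𝒵 Θ ℓ Rg ζ lam) {D : Fin n → Z}
    (hD : ∀ i, D i ∈ 𝒵) (w : Fin n → ℝ) (b θ : Euc p) :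
    HasGradientAt (smoothPart ℓ γ w D b) ((1 / n : ℝ) • (gradSum ℓ w D θ + b) + γ • θ) θ := by
  rw [hasGradientAt_iff_hasFDerivAt]
  have h1 := (hS.hasGradientAt_sum hD w θ).hasFDerivAt.const_mul (1 / n : ℝ)
  have h2 := ((innerSL ℝ b).hasFDerivAt (x := θ)).mul_const (1 / n : ℝ)
  have h3 := (hasStrictFDerivAt_norm_sq θ).hasFDerivAt.const_mul (γ / 2)
  convert! (h1.add h2).add h3 using 1
  · funext x; simp [smoothPart, div_eq_mul_inv]
  · ext v
    simp
    ring

lemma SecondStage.convexOn_sum (hS : SecondStage 𝒵 Θ ℓ Rg ζ lam) {D : Fin n → Z}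
    (hD : ∀ i, D i ∈ 𝒵) {w : Fin n → ℝ} (hw : ∀ i, 0 ≤ w i) :
    ConvexOn ℝ Set.univ fun θ => ∑ i, w i * ℓ (D i) θ := by
  have h : ∀ s : Finset (Fin n), ConvexOn ℝ Set.univ fun θ => ∑ i ∈ s, w i * ℓ (D i) θ := by
    intro s
    induction s using Finset.induction_on with
    | empty => simpa using convexOn_const (0 : ℝ) convex_univ
    | insert i s hi ih =>
      simp_rw [Finset.sum_insert hi]
      exact ((hS.convex_loss _ (hD i)).smul (hw i)).add ih
  exact h _

lemma SecondStage.convexOn_linear_part (hS : SecondStage 𝒵 Θ ℓ Rg ζ lam) {D : Fin n → Z}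
    (hD : ∀ i, D i ∈ 𝒵) {w : Fin n → ℝ} (hw : ∀ i, 0 ≤ w i) (b : Euc p) :
    ConvexOn ℝ Set.univ fun θ => (1 / n) * ∑ i, w i * ℓ (D i) θ + inner ℝ b θ / n := by
  refine ((hS.convexOn_sum hD hw).smul (c := 1 / (n : ℝ)) (by positivity)).add ?_
  have h := ((innerSL ℝ b : Euc p →ₗ[ℝ] ℝ).convexOn convex_univ).smul (c := 1 / (n : ℝ))
    (by positivity)
  exact h.congr fun x _ => by simp [div_eq_inv_mul]

lemma convexOn_norm_sq_mul {c : ℝ} (hc : 0 ≤ c) :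
    ConvexOn ℝ Set.univ fun θ : Euc p => c * ‖θ‖ ^ 2 :=
  ((convexOn_norm convex_univ).pow (fun _ _ => norm_nonneg _) 2).smul hc

lemma SecondStage.isMinOn_iff_isStationary (hS : SecondStage 𝒵 Θ ℓ Rg ζ lam) (hγ : 0 < γ)
    {D : Fin n → Z} (hD : ∀ i, D i ∈ 𝒵) {w : Fin n → ℝ} (hw : ∀ i, 0 ≤ w i) (b θ : Euc p) :
    (θ ∈ Θ ∧ IsMinOn (privObjective ℓ Rg γ w D b) Θ θ) ↔
      IsStationary Θ ℓ Rg γ w D b θ := by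
  refine and_congr_right fun hθ => ?_
  have hconv : ConvexOn ℝ Set.univ (smoothPart ℓ γ w D b) :=
    (hS.convexOn_linear_part hD hw b).add (convexOn_norm_sq_mul (by positivity))
  rw [← isMinOn_add_iff hS.convex hconv hS.convex_reg hθ (hS.hasGradientAt_smoothPart hD w b θ)]
  have h : privObjective ℓ Rg γ w D b = fun x => smoothPart ℓ γ w D b x + Rg x := by
    funext x; simp only [privObjective, smoothPart]; ring
  rw [h]

lemma SecondStage.isStationary_privEstimator (hS : SecondStage 𝒵 Θ ℓ Rg ζ lam) (hγ : 0 < γ)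
    {w : (Fin n → Z) → Fin n → ℝ} {D : Fin n → Z} (hD : ∀ i, D i ∈ 𝒵) (hw : ∀ i, 0 ≤ w D i)
    (b : Euc p) : IsStationary Θ ℓ Rg γ (w D) D b (privEstimator Θ ℓ Rg γ w D b) := by
  rw [← hS.isMinOn_iff_isStationary hγ hD hw]
  refine Classical.epsilon_spec
    (p := fun θ => θ ∈ Θ ∧ IsMinOn (privObjective ℓ Rg γ (w D) D b) Θ θ) ?_
  obtain ⟨θ, hθ, hmin⟩ := exists_isMinOn_of_strongly_convex hS.nonempty hS.isClosed
    ((hS.convexOn_linear_part hD hw b).add hS.convex_reg) hγ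
  refine ⟨θ, hθ, ?_⟩
  have h : privObjective ℓ Rg γ (w D) D b = fun x =>
      ((fun θ => (1 / n) * ∑ i, w D i * ℓ (D i) θ + inner ℝ b θ / n) + Rg) x
        + γ / 2 * ‖x‖ ^ 2 := by
    funext x; simp only [privObjective, Pi.add_apply]; ring
  rw [h]; exact hmin

lemma SecondStage.gradSum_monotone (hS : SecondStage 𝒵 Θ ℓ Rg ζ lam) {D : Fin n → Z}
    (hD : ∀ i, D i ∈ 𝒵) {w : Fin n → ℝ} (hw : ∀ i, 0 ≤ w i) (x y : Euc p) :
    0 ≤ inner ℝ (gradSum ℓ w D x - gradSum ℓ w D y) (x - y) :=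
  gradient_monotone_of_convexOn (hS.convexOn_sum hD hw) (hS.hasGradientAt_sum hD w x)
    (hS.hasGradientAt_sum hD w y)

/-- Testing each variational inequality at the other solution and adding cancels the regularizer,
and monotonicity of the loss gradient drops the data term. What remains is nγ ‖θ₁ − θ₂‖² ≤ ⟨b₂ − b₁,
θ₁ − θ₂⟩. The case b₁ = b₂ is uniqueness. -/
lemma IsStationary.norm_sub_le (hS : SecondStage 𝒵 Θ ℓ Rg ζ lam) (hn : 1 ≤ n) (hγ : 0 < γ)
    {D : Fin n → Z} (hD : ∀ i, D i ∈ 𝒵) {w : Fin n → ℝ} (hw : ∀ i, 0 ≤ w i) {b₁ b₂ θ₁ θ₂ : Euc p}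
    (h₁ : IsStationary Θ ℓ Rg γ w D b₁ θ₁) (h₂ : IsStationary Θ ℓ Rg γ w D b₂ θ₂) :
    ‖θ₁ - θ₂‖ ≤ (n * γ)⁻¹ * ‖b₁ - b₂‖ := by
  have hn' : (0 : ℝ) < n := by exact_mod_cast hn
  have e₁ := h₁.2 θ₂ h₂.1
  have e₂ := h₂.2 θ₁ h₁.1
  have hm := hS.gradSum_monotone hD hw θ₁ θ₂
  have hcs := real_inner_le_norm (b₂ - b₁) (θ₁ - θ₂)
  rw [norm_sub_rev b₂ b₁] at hcs
  have key : n * γ * ‖θ₁ - θ₂‖ ^ 2 ≤ inner ℝ (b₂ - b₁) (θ₁ - θ₂) := by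
    have e₁' : inner ℝ ((1 / n : ℝ) • (gradSum ℓ w D θ₁ + b₁) + γ • θ₁) (θ₂ - θ₁) =
        - inner ℝ ((1 / n : ℝ) • (gradSum ℓ w D θ₁ + b₁) + γ • θ₁) (θ₁ - θ₂) := by
      rw [← inner_neg_right, neg_sub]
    rw [e₁'] at e₁
    simp only [inner_add_left, inner_sub_left, real_inner_smul_left] at e₁ e₂ hm ⊢
    have hsq : ‖θ₁ - θ₂‖ ^ 2 = inner ℝ θ₁ (θ₁ - θ₂) - inner ℝ θ₂ (θ₁ - θ₂) := by
      rw [← inner_sub_left, real_inner_self_eq_norm_sq]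
    rw [hsq]
    set a₁ := inner ℝ (gradSum ℓ w D θ₁) (θ₁ - θ₂)
    set a₂ := inner ℝ (gradSum ℓ w D θ₂) (θ₁ - θ₂)
    set c₁ := inner ℝ b₁ (θ₁ - θ₂)
    set c₂ := inner ℝ b₂ (θ₁ - θ₂)
    set d₁ := inner ℝ θ₁ (θ₁ - θ₂)
    set d₂ := inner ℝ θ₂ (θ₁ - θ₂)
    have h3 : 0 ≤ (1 / n : ℝ) * (a₂ + c₂ - a₁ - c₁) - γ * (d₁ - d₂) := by linarith
    have h4 := mul_nonneg hn'.le h3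
    rw [mul_sub, ← mul_assoc, mul_one_div_cancel hn'.ne'] at h4
    linarith
  rcases (norm_nonneg (θ₁ - θ₂)).eq_or_lt with h0 | h0
  · rw [← h0]; positivity
  · have h5 : (n * γ * ‖θ₁ - θ₂‖) * ‖θ₁ - θ₂‖ ≤ ‖b₁ - b₂‖ * ‖θ₁ - θ₂‖ := by
      calc _ = n * γ * ‖θ₁ - θ₂‖ ^ 2 := by ring
        _ ≤ _ := key.trans hcs
    rw [inv_mul_eq_div, le_div_iff₀ (by positivity), mul_comm]
    exact le_of_mul_le_mul_right h5 h0

/-- The noise that makes the estimator on `D` return what the estimator on `D'` returns with the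
noise `b`. -/
def noiseMap (Θ : Set (Euc p)) (ℓ : Z → Euc p → ℝ) (Rg : Euc p → ℝ) (γ : ℝ)
    (w : (Fin n → Z) → Fin n → ℝ) (D D' : Fin n → Z) (b : Euc p) : Euc p :=
  b + (gradSum ℓ (w D') D' (privEstimator Θ ℓ Rg γ w D' b) -
    gradSum ℓ (w D) D (privEstimator Θ ℓ Rg γ w D' b))

variable {w : (Fin n → Z) → Fin n → ℝ} {D D' : Fin n → Z}

lemma SecondStage.lipschitz_privEstimator (hS : SecondStage 𝒵 Θ ℓ Rg ζ lam) (hn : 1 ≤ n)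
    (hγ : 0 < γ) (hD : ∀ i, D i ∈ 𝒵) (hw : ∀ i, 0 ≤ w D i) :
    LipschitzWith (n * γ)⁻¹.toNNReal (privEstimator Θ ℓ Rg γ w D) := by
  refine LipschitzWith.of_dist_le_mul fun b₁ b₂ => ?_
  rw [dist_eq_norm, dist_eq_norm, Real.coe_toNNReal _ (by positivity)]
  exact (hS.isStationary_privEstimator hγ hD hw b₁).norm_sub_le hS hn hγ hD hw
    (hS.isStationary_privEstimator hγ hD hw b₂)

/-- The shift is chosen so that gradient sum plus noise takes the same value at θ' for both
datasets. Hence θ' is stationary for `D` too, and stationary points are unique. -/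
lemma SecondStage.privEstimator_noiseMap (hS : SecondStage 𝒵 Θ ℓ Rg ζ lam) (hn : 1 ≤ n)
    (hγ : 0 < γ) (hD : ∀ i, D i ∈ 𝒵) (hD' : ∀ i, D' i ∈ 𝒵) (hw : ∀ i, 0 ≤ w D i)
    (hw' : ∀ i, 0 ≤ w D' i) (b : Euc p) :
    privEstimator Θ ℓ Rg γ w D (noiseMap Θ ℓ Rg γ w D D' b) = privEstimator Θ ℓ Rg γ w D' b := by
  have h' := hS.isStationary_privEstimator hγ hD' hw' b
  have h := hS.isStationary_privEstimator hγ hD hw (noiseMap Θ ℓ Rg γ w D D' b)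
  set θ' := privEstimator Θ ℓ Rg γ w D' b with hθ'
  have h2 : IsStationary Θ ℓ Rg γ (w D) D (noiseMap Θ ℓ Rg γ w D D' b) θ' := by
    refine ⟨h'.1, fun x hx => ?_⟩
    have h3 : gradSum ℓ (w D) D θ' + noiseMap Θ ℓ Rg γ w D D' b = gradSum ℓ (w D') D' θ' + b := by
      rw [noiseMap, ← hθ']; abel
    rw [h3]; exact h'.2 x hx
  have h4 := h.norm_sub_le hS hn hγ hD hw h2
  rw [sub_self, norm_zero, mul_zero] at h4
  exact sub_eq_zero.1 (norm_le_zero_iff.1 h4)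

/-- The shifted noise on `D` reproduces the same output, so the reverse shift is evaluated at the
same point and cancels the first. -/
lemma SecondStage.noiseMap_noiseMap (hS : SecondStage 𝒵 Θ ℓ Rg ζ lam) (hn : 1 ≤ n)
    (hγ : 0 < γ) (hD : ∀ i, D i ∈ 𝒵) (hD' : ∀ i, D' i ∈ 𝒵) (hw : ∀ i, 0 ≤ w D i)
    (hw' : ∀ i, 0 ≤ w D' i) (b : Euc p) :
    noiseMap Θ ℓ Rg γ w D' D (noiseMap Θ ℓ Rg γ w D D' b) = b := by
  rw [noiseMap, hS.privEstimator_noiseMap hn hγ hD hD' hw hw' b, noiseMap]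
  abel

lemma SecondStage.bijective_noiseMap (hS : SecondStage 𝒵 Θ ℓ Rg ζ lam) (hn : 1 ≤ n)
    (hγ : 0 < γ) (hD : ∀ i, D i ∈ 𝒵) (hD' : ∀ i, D' i ∈ 𝒵) (hw : ∀ i, 0 ≤ w D i)
    (hw' : ∀ i, 0 ≤ w D' i) : Function.Bijective (noiseMap Θ ℓ Rg γ w D D') :=
  Function.bijective_iff_has_inverse.2 ⟨noiseMap Θ ℓ Rg γ w D' D,
    hS.noiseMap_noiseMap hn hγ hD hD' hw hw', hS.noiseMap_noiseMap hn hγ hD' hD hw' hw⟩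

lemma SecondStage.lipschitzOn_gradient (hS : SecondStage 𝒵 Θ ℓ Rg ζ lam) {d : Z} (hd : d ∈ 𝒵) :
    LipschitzOnWith lam.toNNReal (gradient (ℓ d)) Θ := by
  refine hS.convex.lipschitzOnWith_of_nnnorm_hasFDerivWithin_le
    (f' := fderiv ℝ (gradient (ℓ d))) (fun θ _ => ?_) fun θ hθ => ?_
  · exact ((contDiff_gradient (hS.contDiff_loss d hd)).differentiable (by norm_num)
      θ).hasFDerivAt.hasFDerivWithinAt
  · rw [← NNReal.coe_le_coe, coe_nnnorm]
    exact ((norm_fderiv_gradient_le (hS.contDiff_loss d hd) (hS.convex_loss d hd) θ).trans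
      (hS.hessianTrace_le d hd θ hθ)).trans (Real.le_coe_toNNReal _)

lemma SecondStage.exists_lipschitzOn_gradSum (hS : SecondStage 𝒵 Θ ℓ Rg ζ lam)
    (hD : ∀ i, D i ∈ 𝒵) (v : Fin n → ℝ) : ∃ K, LipschitzOnWith K (gradSum ℓ v D) Θ := by
  refine ⟨∑ i, ‖v i‖₊ * lam.toNNReal, LipschitzOnWith.of_dist_le_mul fun x hx y hy => ?_⟩
  rw [gradSum, gradSum, dist_eq_norm, ← Finset.sum_sub_distrib, NNReal.coe_sum, Finset.sum_mul]
  refine (norm_sum_le _ _).trans (Finset.sum_le_sum fun i _ => ?_)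
  rw [← smul_sub, norm_smul, NNReal.coe_mul, coe_nnnorm, mul_assoc, ← dist_eq_norm]
  gcongr
  exact (hS.lipschitzOn_gradient (hD i)).dist_le_mul x hx y hy

lemma SecondStage.exists_lipschitz_noiseMap (hS : SecondStage 𝒵 Θ ℓ Rg ζ lam) (hn : 1 ≤ n)
    (hγ : 0 < γ) (hD : ∀ i, D i ∈ 𝒵) (hD' : ∀ i, D' i ∈ 𝒵) (hw' : ∀ i, 0 ≤ w D' i) :
    ∃ K, LipschitzWith K (noiseMap Θ ℓ Rg γ w D D') := by
  obtain ⟨K₁, h₁⟩ := hS.exists_lipschitzOn_gradSum hD (w D)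
  obtain ⟨K₂, h₂⟩ := hS.exists_lipschitzOn_gradSum hD' (w D')
  have hθ := hS.lipschitz_privEstimator hn hγ hD' hw'
  -- The gradients are known to be Lipschitz only on `Θ`, which suffices because the estimator takes
  -- its values there.
  have hmaps : Set.MapsTo (privEstimator Θ ℓ Rg γ w D') Set.univ Θ := fun b _ =>
    (hS.isStationary_privEstimator hγ hD' hw' b).1
  have c₁ := h₁.comp (lipschitzOnWith_univ.2 hθ) hmaps
  have c₂ := h₂.comp (lipschitzOnWith_univ.2 hθ) hmaps
  exact ⟨_, LipschitzWith.id.add ((lipschitzOnWith_univ.1 c₂).sub (lipschitzOnWith_univ.1 c₁))⟩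

end Estimator

/-! ### From the weight sensitivity W₁ to weighted sums. -/

section Sensitivity

variable {n : ℕ}

lemma le_ciSup_fin (f : Fin n → ℝ) (i : Fin n) : f i ≤ ⨆ k, f k :=
  le_ciSup (Set.finite_range f).bddAbove i

/-- At the altered index the two data points are unrelated, so both weights count in full there; w +
w' = |w − w'| + 2 min(w, w') explains the second term of W₁. -/
lemma sum_abs_sub_add_two_min_le (w w' : Fin n → ℝ) (hw : ∀ i, 0 ≤ w i) (hw' : ∀ i, 0 ≤ w' i)
    (j : Fin n) :
    ∑ i, (if i = j then w i + w' i else |w i - w' i|) ≤ 2 * W1 w w' := by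
  have h1 : ∑ i, (if i = j then w i + w' i else |w i - w' i|) =
      ∑ i, |w i - w' i| + 2 * min (w j) (w' j) := by
    have h2 : ∀ i, (if i = j then w i + w' i else |w i - w' i|) =
        |w i - w' i| + if i = j then 2 * min (w j) (w' j) else 0 := by
      intro i
      split_ifs with h
      · subst h
        rcases le_total (w i) (w' i) with h | h
        · rw [min_eq_left h, abs_sub_comm, abs_of_nonneg (sub_nonneg.2 h)]; ring
        · rw [min_eq_right h, abs_of_nonneg (sub_nonneg.2 h)]; ring
      · simp
    simp_rw [h2, Finset.sum_add_distrib]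
    simp
  have h3 := le_ciSup_fin (fun i => min (w i) (w' i)) j
  have h4 : 0 ≤ ∑ i, |w i - w' i| := Finset.sum_nonneg fun _ _ => abs_nonneg _
  have h5 : 0 ≤ min (w j) (w' j) := le_min (hw j) (hw' j)
  rw [h1, W1]
  linarith

/-- Sensitivity of weighted sums of a finite family of vector-valued functions. -/
lemma sum_norm_weighted_sub_le {Z V ι : Type*} [NormedAddCommGroup V] [NormedSpace ℝ V]
    [Fintype ι] {𝒵 : Set Z} {D D' : Fin n → Z} (hD : ∀ i, D i ∈ 𝒵) (hD' : ∀ i, D' i ∈ 𝒵)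
    (hDD' : Neighbors D D') {w w' : Fin n → ℝ} (hw : ∀ i, 0 ≤ w i) (hw' : ∀ i, 0 ≤ w' i)
    (g : ι → Z → V) {L : ℝ} (hL : ∀ d ∈ 𝒵, ∑ k, ‖g k d‖ ≤ L) :
    ∑ k, ‖∑ i, w' i • g k (D' i) - ∑ i, w i • g k (D i)‖ ≤ 2 * W1 w w' * L := by
  obtain ⟨j, hj⟩ := hDD'
  have hL0 : 0 ≤ L := (Finset.sum_nonneg fun _ _ => norm_nonneg _).trans (hL _ (hD j))
  calc ∑ k, ‖∑ i, w' i • g k (D' i) - ∑ i, w i • g k (D i)‖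
      ≤ ∑ k, ∑ i, ‖w' i • g k (D' i) - w i • g k (D i)‖ := by
        refine Finset.sum_le_sum fun k _ => ?_
        rw [← Finset.sum_sub_distrib]; exact norm_sum_le _ _
    _ = ∑ i, ∑ k, ‖w' i • g k (D' i) - w i • g k (D i)‖ := Finset.sum_comm
    _ ≤ ∑ i, (if i = j then w i + w' i else |w i - w' i|) * L := by
        refine Finset.sum_le_sum fun i _ => ?_
        split_ifs with h
        · calc _ ≤ ∑ k, (w' i * ‖g k (D' i)‖ + w i * ‖g k (D i)‖) := by
                refine Finset.sum_le_sum fun k _ => (norm_sub_le _ _).trans ?_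
                rw [norm_smul, norm_smul, Real.norm_of_nonneg (hw i), Real.norm_of_nonneg (hw' i)]
            _ = w' i * ∑ k, ‖g k (D' i)‖ + w i * ∑ k, ‖g k (D i)‖ := by
                rw [Finset.sum_add_distrib, Finset.mul_sum, Finset.mul_sum]
            _ ≤ w' i * L + w i * L := by
                have := hL _ (hD i)
                have := hL _ (hD' i)
                have := hw i
                have := hw' i
                gcongr
            _ = _ := by ring
        · simp_rw [← hj i h, ← sub_smul, norm_smul]
          rw [← Finset.mul_sum, Real.norm_eq_abs, abs_sub_comm]
          exact mul_le_mul_of_nonneg_left (hL _ (hD i)) (abs_nonneg _)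
    _ ≤ _ := by
        rw [← Finset.sum_mul]
        exact mul_le_mul_of_nonneg_right (sum_abs_sub_add_two_min_le w w' hw hw' j) hL0

end Sensitivity

/-! ### Shift and Jacobian of the noise map for a pair of neighbours. -/

section Pair

variable {n p : ℕ} {Z : Type*} {𝒵 : Set Z} {Θ : Set (Euc p)} {ℓ : Z → Euc p → ℝ}
  {Rg : Euc p → ℝ} {ζ lam γ : ℝ} {w : (Fin n → Z) → Fin n → ℝ} {D D' : Fin n → Z}

lemma SecondStage.norm_noiseMap_sub_le (hS : SecondStage 𝒵 Θ ℓ Rg ζ lam)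
    (hγ : 0 < γ) (hD : ∀ i, D i ∈ 𝒵) (hD' : ∀ i, D' i ∈ 𝒵) (hw : ∀ i, 0 ≤ w D i)
    (hw' : ∀ i, 0 ≤ w D' i) (hDD' : Neighbors D D') (b : Euc p) :
    ‖noiseMap Θ ℓ Rg γ w D D' b - b‖ ≤ 2 * W1 (w D) (w D') * ζ := by
  have hθ := (hS.isStationary_privEstimator hγ hD' hw' b).1
  have h := sum_norm_weighted_sub_le (ι := Unit) hD hD' hDD' hw hw'
    (fun _ d => gradient (ℓ d) (privEstimator Θ ℓ Rg γ w D' b)) (L := ζ)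
    (fun d hd => by simpa using hS.gradient_le d hd _ hθ)
  simpa [noiseMap, gradSum] using h

lemma SecondStage.hasFDerivAt_gradSum (hS : SecondStage 𝒵 Θ ℓ Rg ζ lam)
    (hD : ∀ i, D i ∈ 𝒵) (v : Fin n → ℝ) (θ : Euc p) :
    HasFDerivAt (gradSum ℓ v D) (∑ i, v i • fderiv ℝ (gradient (ℓ (D i))) θ) θ :=
  HasFDerivAt.fun_sum fun i _ => (((contDiff_gradient (hS.contDiff_loss _ (hD i))).differentiable
    (by norm_num) θ).hasFDerivAt.const_smul (v i))

lemma SecondStage.isSymmetric_hessianSum (hS : SecondStage 𝒵 Θ ℓ Rg ζ lam)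
    (hD : ∀ i, D i ∈ 𝒵) (v : Fin n → ℝ) (θ x y : Euc p) :
    inner ℝ ((∑ i, v i • fderiv ℝ (gradient (ℓ (D i))) θ) x) y =
      inner ℝ x ((∑ i, v i • fderiv ℝ (gradient (ℓ (D i))) θ) y) := by
  simp only [sum_apply, smul_apply, sum_inner, inner_sum, real_inner_smul_left,
    real_inner_smul_right]
  refine Finset.sum_congr rfl fun i _ => ?_
  rw [inner_fderiv_gradient_symm (hS.contDiff_loss _ (hD i))]

/-- The gradient sums are differentiable everywhere and the estimator almost everywhere, so the
chain rule gives the derivative 1 + H M for almost every b. The Lipschitz constant of the estimator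
bounds M. -/
lemma SecondStage.abs_det_fderiv_noiseMap_le (hS : SecondStage 𝒵 Θ ℓ Rg ζ lam) (hn : 1 ≤ n)
    (hγ : 0 < γ) (hD : ∀ i, D i ∈ 𝒵) (hD' : ∀ i, D' i ∈ 𝒵) (hw : ∀ i, 0 ≤ w D i)
    (hw' : ∀ i, 0 ≤ w D' i) (hDD' : Neighbors D D') :
    ∀ᵐ b, |(fderiv ℝ (noiseMap Θ ℓ Rg γ w D D') b).det| ≤
      Real.exp (2 * W1 (w D) (w D') * lam * (n * γ)⁻¹) := by
  have hlip := hS.lipschitz_privEstimator hn hγ hD' hw'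
  filter_upwards [hlip.ae_differentiableAt] with b hb
  set θ' := privEstimator Θ ℓ Rg γ w D' b with hθ'
  set M := fderiv ℝ (privEstimator Θ ℓ Rg γ w D') b
  set H := (∑ i, w D' i • fderiv ℝ (gradient (ℓ (D' i))) θ') -
    ∑ i, w D i • fderiv ℝ (gradient (ℓ (D i))) θ' with hH
  have hM : ‖M‖ ≤ (n * γ)⁻¹ := by
    have := norm_fderiv_le_of_lipschitz ℝ hlip (x₀ := b)
    rwa [Real.coe_toNNReal _ (by positivity)] at this
  have hfd : HasFDerivAt (noiseMap Θ ℓ Rg γ w D D') (ContinuousLinearMap.id ℝ _ + H ∘L M) b := by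
    have h1 : HasFDerivAt (fun θ => gradSum ℓ (w D') D' θ - gradSum ℓ (w D) D θ) H
        (privEstimator Θ ℓ Rg γ w D' b) :=
      (hS.hasFDerivAt_gradSum hD' (w D') θ').fun_sub (hS.hasFDerivAt_gradSum hD (w D) θ')
    have h2 : HasFDerivAt (fun b => gradSum ℓ (w D') D' (privEstimator Θ ℓ Rg γ w D' b) -
        gradSum ℓ (w D) D (privEstimator Θ ℓ Rg γ w D' b)) (H ∘L M) b :=
      HasFDerivAt.comp b h1 hb.hasFDerivAt
    exact (hasFDerivAt_id b).add h2
  rw [hfd.fderiv]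
  refine abs_det_one_add_comp_le H M ?_ ?_ hM
  · intro x y
    simp only [ContinuousLinearMap.coe_coe, hH, sub_apply, inner_sub_left, inner_sub_right]
    rw [hS.isSymmetric_hessianSum hD', hS.isSymmetric_hessianSum hD]
  · intro e
    -- The family consists of the diagonal Hessian entries in the basis e. They are nonnegative by
    -- convexity, so their absolute sum is the trace, with no factor of the dimension.
    have h := sum_norm_weighted_sub_le hD hD' hDD' hw hw'
      (fun k d => inner ℝ (e k) (fderiv ℝ (gradient (ℓ d)) θ' (e k))) (L := lam) ?_
    · refine le_trans (le_of_eq ?_) h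
      refine Finset.sum_congr rfl fun k _ => ?_
      rw [Real.norm_eq_abs]
      congr 1
      simp [hH, inner_sub_right, inner_sum, real_inner_smul_right]
    · intro d hd
      have hθ := (hS.isStationary_privEstimator hγ hD' hw' b).1
      refine le_trans (le_of_eq ?_) (hS.hessianTrace_le d hd θ' hθ)
      rw [← sum_inner_fderiv_gradient (hS.contDiff_loss d hd) θ' e]
      refine Finset.sum_congr rfl fun k _ => Real.norm_of_nonneg ?_
      exact inner_fderiv_gradient_nonneg (hS.contDiff_loss d hd) (hS.convex_loss d hd) _ _

/-- Comparison of the noise masses of the events that the outputs on neighbouring datasets lie in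
`S`, on a set `A` of noises where the noise density `f` varies by a factor of at most `c`. -/
lemma SecondStage.setLIntegral_le (hS : SecondStage 𝒵 Θ ℓ Rg ζ lam) (hn : 1 ≤ n)
    (hγ : 0 < γ) (hD : ∀ i, D i ∈ 𝒵) (hD' : ∀ i, D' i ∈ 𝒵) (hw : ∀ i, 0 ≤ w D i)
    (hw' : ∀ i, 0 ≤ w D' i) (hDD' : Neighbors D D') {f : Euc p → ℝ≥0∞} {A : Set (Euc p)}
    (hA : MeasurableSet A) {c : ℝ≥0∞} (hc : c ≠ ⊤)
    (hf : ∀ b b', b ∈ A → ‖b - b'‖ ≤ 2 * W1 (w D) (w D') * ζ → f b ≤ c * f b')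
    {S : Set (Euc p)} (hSm : MeasurableSet S) :
    ∫⁻ b in privEstimator Θ ℓ Rg γ w D ⁻¹' S ∩ A, f b ≤
      ENNReal.ofReal (Real.exp (2 * W1 (w D) (w D') * lam * (n * γ)⁻¹)) * c *
        ∫⁻ b in privEstimator Θ ℓ Rg γ w D' ⁻¹' S, f b := by
  obtain ⟨K, hK⟩ := hS.exists_lipschitz_noiseMap hn hγ hD hD' hw'
  have hmeas := (hS.lipschitz_privEstimator hn hγ hD hw).continuous.measurable hSm
  refine (setLIntegral_le_of_lipschitz_bijective hK (hS.bijective_noiseMap hn hγ hD hD' hw hw')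
    (hS.abs_det_fderiv_noiseMap_le hn hγ hD hD' hw hw' hDD') (hmeas.inter hA) hc
    fun b hb => ?_).trans ?_
  · exact hf _ _ hb.2 (hS.norm_noiseMap_sub_le hγ hD hD' hw hw' hDD' b)
  · gcongr
    intro b hb
    have h1 := hb.1
    simp only [Set.mem_preimage] at h1 ⊢
    rwa [hS.privEstimator_noiseMap hn hγ hD hD' hw hw'] at h1

end Pair

/-! ### Gamma and Gaussian noise: densities and tails. -/

section Noise

variable {p : ℕ}

/-- The normalization to a probability measure of the density `f`. -/
def normalizedDensity (f : Euc p → ℝ) : Measure (Euc p) :=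
  (∫⁻ b, ENNReal.ofReal (f b))⁻¹ •
    (volume : Measure (Euc p)).withDensity fun b => ENNReal.ofReal (f b)

lemma lintegral_ofReal_ne_zero {f : Euc p → ℝ} (hf : Continuous f) (hpos : ∀ b, 0 < f b) :
    ∫⁻ b, ENNReal.ofReal (f b) ≠ 0 := by
  refine ((lintegral_pos_iff_support (by fun_prop)).2 ?_).ne'
  have h : (Function.support fun b => ENNReal.ofReal (f b)) = Set.univ :=
    Set.eq_univ_of_forall fun b => (ENNReal.ofReal_pos.2 (hpos b)).ne'
  rw [h]
  exact Measure.measure_univ_pos.2 (NeZero.ne _)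

lemma isProbabilityMeasure_normalizedDensity {f : Euc p → ℝ} (hf : Integrable f)
    (hc : Continuous f) (hpos : ∀ b, 0 < f b) : IsProbabilityMeasure (normalizedDensity f) := by
  refine ⟨?_⟩
  rw [normalizedDensity, Measure.smul_apply, withDensity_apply _ MeasurableSet.univ,
    Measure.restrict_univ, smul_eq_mul]
  exact ENNReal.inv_mul_cancel (lintegral_ofReal_ne_zero hc hpos) hf.lintegral_lt_top.ne

lemma integrable_exp_neg_mul_norm {β : ℝ} (hβ : 0 < β) :
    Integrable fun b : Euc p => Real.exp (-β * ‖b‖) := by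
  have h1 : ((Module.finrank ℝ (Euc p) : ℕ) : ℝ) < ((p + 1 : ℕ) : ℝ) := by simp
  have h2 := integrable_one_add_norm (E := Euc p) (μ := volume) h1
  -- The exponential is dominated by the integrable (1 + ‖b‖)^(−(p+1)), using x^k/k! ≤ exp x at x =
  -- β(1 + ‖b‖) and k = p + 1.
  refine (h2.const_mul (Real.exp β * (p + 1).factorial / β ^ (p + 1))).mono'
    (by fun_prop) (Filter.Eventually.of_forall fun b => ?_)
  rw [Real.norm_of_nonneg (Real.exp_pos _).le, Real.rpow_neg (by positivity), Real.rpow_natCast]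
  have h3 := Real.pow_div_factorial_le_exp (β * (1 + ‖b‖)) (by positivity) (p + 1)
  rw [div_le_iff₀ (by positivity), mul_pow] at h3
  have h4 : Real.exp (-β * ‖b‖) * Real.exp (β * (1 + ‖b‖)) = Real.exp β := by
    rw [← Real.exp_add]; congr 1; ring
  rw [← div_eq_mul_inv, le_div_iff₀ (by positivity), le_div_iff₀ (by positivity)]
  calc Real.exp (-β * ‖b‖) * (1 + ‖b‖) ^ (p + 1) * β ^ (p + 1)
      = Real.exp (-β * ‖b‖) * (β ^ (p + 1) * (1 + ‖b‖) ^ (p + 1)) := by ring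
    _ ≤ Real.exp (-β * ‖b‖) * (Real.exp (β * (1 + ‖b‖)) * (p + 1).factorial) := by gcongr
    _ = _ := by rw [← mul_assoc, h4]

lemma integrable_exp_neg_mul_norm_sq {b : ℝ} (hb : 0 < b) :
    Integrable fun x : Euc p => Real.exp (-b * ‖x‖ ^ 2) := by
  have h := (GaussianFourier.integrable_cexp_neg_mul_sq_norm_add (V := Euc p) (b := (b : ℂ))
    (by simpa using hb) 0 0).norm
  refine h.congr (Filter.Eventually.of_forall fun x => ?_)
  simp only [Complex.norm_exp]
  congr 1
  simp [← Complex.ofReal_pow]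

lemma lintegral_exp_neg_mul_norm_sq {b : ℝ} (hb : 0 < b) :
    ∫⁻ x : Euc p, ENNReal.ofReal (Real.exp (-b * ‖x‖ ^ 2)) =
      ENNReal.ofReal ((Real.pi / b) ^ ((p : ℝ) / 2)) := by
  rw [← ofReal_integral_eq_lintegral_ofReal (integrable_exp_neg_mul_norm_sq hb)
    (Filter.Eventually.of_forall fun _ => (Real.exp_pos _).le),
    GaussianFourier.integral_rexp_neg_mul_sq_norm hb]
  simp

/-- The change of variables needs a density. Both measures have the characteristic function
exp(−σ²‖t‖²/2), which identifies them. -/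
lemma gaussianNoise_eq_normalizedDensity {σ : ℝ} (hσ : 0 < σ) :
    gaussianNoise p σ = normalizedDensity fun x => Real.exp (-(1 / (2 * σ ^ 2)) * ‖x‖ ^ 2) := by
  have hb : 0 < 1 / (2 * σ ^ 2) := by positivity
  have hprob := isProbabilityMeasure_normalizedDensity (p := p)
    (integrable_exp_neg_mul_norm_sq hb) (by fun_prop) fun _ => Real.exp_pos _
  have hps : (σ ^ 2 • (1 : Matrix (Fin p) (Fin p) ℝ)).PosSemidef :=
    Matrix.PosSemidef.one.smul (by positivity)
  unfold gaussianNoise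
  refine Measure.ext_of_charFun (funext fun t => ?_)
  rw [charFun_multivariateGaussian hps, charFun_apply, normalizedDensity, integral_smul_measure,
    integral_withDensity_eq_integral_toReal_smul (by fun_prop) (by simp),
    lintegral_exp_neg_mul_norm_sq hb]
  have h1 : ∀ x : Euc p, (ENNReal.ofReal (Real.exp (-(1 / (2 * σ ^ 2)) * ‖x‖ ^ 2))).toReal •
      Complex.exp (inner ℝ x t * Complex.I) =
      Complex.exp (-((1 / (2 * σ ^ 2) : ℝ) : ℂ) * ‖x‖ ^ 2 + Complex.I * inner ℝ t x) := by
    intro x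
    rw [ENNReal.toReal_ofReal (Real.exp_pos _).le, Complex.real_smul, Complex.ofReal_exp,
      ← Complex.exp_add, real_inner_comm]
    congr 1
    push_cast
    ring
  simp_rw [h1]
  rw [GaussianFourier.integral_cexp_neg_mul_sq_norm_add (by rwa [Complex.ofReal_re])]
  have h2 : ((((Real.pi / (1 / (2 * σ ^ 2))) ^ ((p : ℝ) / 2) : ℝ)) : ℂ) =
      ((Real.pi : ℂ) / ((1 / (2 * σ ^ 2) : ℝ) : ℂ)) ^ ((Module.finrank ℝ (Euc p) : ℂ) / 2) := by
    rw [Complex.ofReal_cpow (by positivity)]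
    simp
  rw [← h2, ENNReal.toReal_inv, ENNReal.toReal_ofReal (by positivity), Complex.real_smul,
    ← mul_assoc, ← Complex.ofReal_mul, inv_mul_cancel₀ (by positivity), Complex.ofReal_one, one_mul]
  congr 1
  have h3 : (t.ofLp ⬝ᵥ Matrix.mulVec (σ ^ 2 • (1 : Matrix (Fin p) (Fin p) ℝ)) t.ofLp) =
      σ ^ 2 * ‖t‖ ^ 2 := by
    rw [Matrix.smul_mulVec, Matrix.one_mulVec, dotProduct_smul, EuclideanSpace.real_norm_sq_eq]
    simp [dotProduct, pow_two]
  rw [h3]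
  have : (σ : ℂ) ≠ 0 := by exact_mod_cast hσ.ne'
  simp
  field_simp
  ring

/-- Gaussian tail bound from the exponential moment of the squared norm. -/
lemma gaussianNoise_norm_gt_le {σ ρ : ℝ} (hσ : 0 < σ) (hρ : 0 ≤ ρ) :
    gaussianNoise p σ {b | ρ * σ < ‖b‖} ≤
      ENNReal.ofReal (Real.exp (-(ρ ^ 2 / 4)) * 2 ^ ((p : ℝ) / 2)) := by
  have hb : 0 < 1 / (2 * σ ^ 2) := by positivity
  have hb' : 0 < 1 / (4 * σ ^ 2) := by positivity
  rw [gaussianNoise_eq_normalizedDensity hσ, normalizedDensity, Measure.smul_apply, smul_eq_mul,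
    withDensity_apply _ (measurableSet_lt (by fun_prop) (by fun_prop)),
    lintegral_exp_neg_mul_norm_sq hb]
  -- Half of the Gaussian exponent is at least ρ²/4 on this set; the other half is again a Gaussian,
  -- of variance 2σ², whose total integral is larger by the factor 2^(p/2).
  have h1 : ∫⁻ b in {b : Euc p | ρ * σ < ‖b‖},
      ENNReal.ofReal (Real.exp (-(1 / (2 * σ ^ 2)) * ‖b‖ ^ 2)) ≤
      ENNReal.ofReal (Real.exp (-(ρ ^ 2 / 4))) *
        ENNReal.ofReal ((Real.pi / (1 / (4 * σ ^ 2))) ^ ((p : ℝ) / 2)) := by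
    rw [← lintegral_exp_neg_mul_norm_sq hb', ← lintegral_const_mul' _ _ ENNReal.ofReal_ne_top]
    refine (setLIntegral_mono' (measurableSet_lt (by fun_prop) (by fun_prop))
      fun b hb => ?_).trans (setLIntegral_le_lintegral _ _)
    rw [← ENNReal.ofReal_mul (Real.exp_pos _).le, ← Real.exp_add]
    refine ENNReal.ofReal_le_ofReal (Real.exp_le_exp.2 ?_)
    have h2 : (ρ * σ) ^ 2 ≤ ‖b‖ ^ 2 := pow_le_pow_left₀ (by positivity) (le_of_lt hb) 2
    have h3 : ρ ^ 2 / 4 ≤ 1 / (4 * σ ^ 2) * ‖b‖ ^ 2 := by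
      rw [one_div_mul_eq_div, le_div_iff₀ (by positivity)]
      linarith
    have h4 : 1 / (2 * σ ^ 2) * ‖b‖ ^ 2 = 2 * (1 / (4 * σ ^ 2) * ‖b‖ ^ 2) := by
      field_simp; ring
    linarith
  refine (mul_le_mul_right h1 _).trans (le_of_eq ?_)
  rw [← ENNReal.ofReal_inv_of_pos (by positivity), ← ENNReal.ofReal_mul (by positivity),
    ← ENNReal.ofReal_mul (by positivity)]
  congr 1
  have h5 : (Real.pi / (1 / (4 * σ ^ 2))) ^ ((p : ℝ) / 2) =
      2 ^ ((p : ℝ) / 2) * (Real.pi / (1 / (2 * σ ^ 2))) ^ ((p : ℝ) / 2) := by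
    rw [← Real.mul_rpow (by positivity) (by positivity)]
    congr 1
    field_simp
    ring
  rw [h5]
  have : 0 < (Real.pi / (1 / (2 * σ ^ 2))) ^ ((p : ℝ) / 2) := by positivity
  field_simp

lemma Ltilde_sq {δ : ℝ} (hδ : 0 < δ) (hδ1 : δ < 1) :
    (p : ℝ) + 2 * Real.log δ⁻¹ ≤ Ltilde p δ ^ 2 := by
  have hlog : 0 < Real.log δ⁻¹ := Real.log_pos (one_lt_inv_iff₀.2 ⟨hδ, hδ1⟩)
  rw [Ltilde, Real.sq_sqrt (by positivity), add_sq, Real.sq_sqrt (by positivity),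
    Real.sq_sqrt hlog.le]
  have : 0 ≤ 2 * √(p : ℝ) * √(Real.log δ⁻¹) := by positivity
  linarith

lemma one_le_Ltilde (hp : 1 ≤ p) {δ : ℝ} (hδ : 0 < δ) (hδ1 : δ < 1) : 1 ≤ Ltilde p δ := by
  have hlog : 0 < Real.log δ⁻¹ := Real.log_pos (one_lt_inv_iff₀.2 ⟨hδ, hδ1⟩)
  have h := Ltilde_sq (p := p) hδ hδ1
  have hp' : (1 : ℝ) ≤ p := by exact_mod_cast hp
  have h0 : 0 ≤ Ltilde p δ := Real.sqrt_nonneg _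
  nlinarith

/-- With radius 2L̃σ the tail exponent is −L̃² + p/2, after 2^(p/2) ≤ exp(p/2). Since L̃² ≥ p + 2
log δ⁻¹, this is below log δ. -/
lemma gaussianNoise_norm_gt_Ltilde_le {σ δ : ℝ} (hσ : 0 < σ) (hδ : 0 < δ) (hδ1 : δ < 1) :
    gaussianNoise p σ {b | 2 * Ltilde p δ * σ < ‖b‖} ≤ ENNReal.ofReal δ := by
  have hlog : 0 < Real.log δ⁻¹ := Real.log_pos (one_lt_inv_iff₀.2 ⟨hδ, hδ1⟩)
  have h0 : 0 ≤ Ltilde p δ := Real.sqrt_nonneg _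
  refine (gaussianNoise_norm_gt_le hσ (by positivity)).trans (ENNReal.ofReal_le_ofReal ?_)
  have h1 : (2 : ℝ) ^ ((p : ℝ) / 2) ≤ Real.exp ((p : ℝ) / 2) := by
    rw [Real.rpow_def_of_pos two_pos]
    refine Real.exp_le_exp.2 (mul_le_of_le_one_left (by positivity) ?_)
    linarith [Real.log_two_lt_d9]
  have h2 := Ltilde_sq (p := p) hδ hδ1
  have hp : (0 : ℝ) ≤ p := by positivity
  calc _ ≤ Real.exp (-((2 * Ltilde p δ) ^ 2 / 4)) * Real.exp ((p : ℝ) / 2) := by gcongr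
    _ = Real.exp (-((2 * Ltilde p δ) ^ 2 / 4) + (p : ℝ) / 2) := (Real.exp_add _ _).symm
    _ ≤ Real.exp (Real.log δ) := by
      refine Real.exp_le_exp.2 ?_
      rw [Real.log_inv] at h2 hlog
      nlinarith
    _ = δ := Real.exp_log hδ

end Noise

/-! ### Differential privacy from bounds on W₁. -/

section Privacy

variable {n p : ℕ} {Z : Type*} {𝒵 : Set Z} {𝔇 : Set (Fin n → Z)} {Θ : Set (Euc p)}
  {ℓ : Z → Euc p → ℝ} {Rg : Euc p → ℝ} {ζ lam γ : ℝ} {w : (Fin n → Z) → Fin n → ℝ} {ω : ℝ}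

lemma SecondStage.zeta_nonneg (hS : SecondStage 𝒵 Θ ℓ Rg ζ lam) {d : Z} (hd : d ∈ 𝒵) :
    0 ≤ ζ := by
  obtain ⟨θ, hθ⟩ := hS.nonempty
  exact (norm_nonneg _).trans (hS.gradient_le d hd θ hθ)

lemma SecondStage.lam_nonneg (hS : SecondStage 𝒵 Θ ℓ Rg ζ lam) {d : Z} (hd : d ∈ 𝒵) :
    0 ≤ lam := by
  obtain ⟨θ, hθ⟩ := hS.nonempty
  exact ((norm_nonneg _).trans (norm_fderiv_gradient_le (hS.contDiff_loss d hd)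
    (hS.convex_loss d hd) θ)).trans (hS.hessianTrace_le d hd θ hθ)

/-- Differential privacy when the noise has a density `f` that, at the points of a set `A` of
probability at least `1 - δ`, changes by a factor of at most `exp (ε/2)` under the shifts that occur
between neighbouring datasets. -/
lemma SecondStage.isDP_of_density (hS : SecondStage 𝒵 Θ ℓ Rg ζ lam) (hn : 1 ≤ n) (hγ : 0 < γ)
    (hD : ∀ D ∈ 𝔇, ∀ i, D i ∈ 𝒵) (hw : ∀ D ∈ 𝔇, ∀ i, 0 ≤ w D i)
    (hω : ∀ D ∈ 𝔇, ∀ D' ∈ 𝔇, Neighbors D D' → W1 (w D) (w D') ≤ ω) {f : Euc p → ℝ}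
    [IsProbabilityMeasure (normalizedDensity f)] {A : Set (Euc p)} (hA : MeasurableSet A)
    {ε δ : ℝ} (hδ : normalizedDensity f Aᶜ ≤ ENNReal.ofReal δ)
    (hf : ∀ b b', b ∈ A → ‖b - b'‖ ≤ 2 * ω * ζ → f b ≤ Real.exp (ε / 2) * f b')
    (hlam : 2 * ω * lam * (n * γ)⁻¹ ≤ ε / 2) :
    IsDP 𝔇 (dp2erm (normalizedDensity f) Θ ℓ Rg γ w) ε δ := by
  have hmeas : ∀ D ∈ 𝔇, Measurable (privEstimator Θ ℓ Rg γ w D) := fun D hDD =>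
    (hS.lipschitz_privEstimator hn hγ (hD D hDD) (hw D hDD)).continuous.measurable
  refine ⟨fun D hDD => Measure.isProbabilityMeasure_map (hmeas D hDD).aemeasurable, ?_⟩
  intro D hDD D' hDD' hnb S hSm
  rw [dp2erm, dp2erm, Measure.map_apply (hmeas D hDD) hSm, Measure.map_apply (hmeas D' hDD') hSm]
  have hm := hmeas D hDD hSm
  have hm' := hmeas D' hDD' hSm
  have hζ := hS.zeta_nonneg (hD D hDD ⟨0, hn⟩)
  have hl := hS.lam_nonneg (hD D hDD ⟨0, hn⟩)
  have hW := hω D hDD D' hDD' hnb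
  calc normalizedDensity f (privEstimator Θ ℓ Rg γ w D ⁻¹' S)
      ≤ normalizedDensity f (privEstimator Θ ℓ Rg γ w D ⁻¹' S ∩ A) + normalizedDensity f Aᶜ := by
        refine (measure_mono fun b hb => ?_).trans (measure_union_le _ _)
        by_cases h : b ∈ A
        · exact Or.inl ⟨hb, h⟩
        · exact Or.inr h
    _ ≤ _ := add_le_add ?_ hδ
  rw [normalizedDensity, Measure.smul_apply, Measure.smul_apply, smul_eq_mul, smul_eq_mul,
    withDensity_apply _ (hm.inter hA), withDensity_apply _ hm', mul_left_comm]
  refine mul_le_mul_right ?_ _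
  refine (hS.setLIntegral_le hn hγ (hD D hDD) (hD D' hDD') (hw D hDD) (hw D' hDD') hnb hA
    (c := ENNReal.ofReal (Real.exp (ε / 2))) ENNReal.ofReal_ne_top ?_ hSm).trans ?_
  · intro b b' hb hbb
    rw [← ENNReal.ofReal_mul (Real.exp_pos _).le]
    exact ENNReal.ofReal_le_ofReal (hf b b' hb (hbb.trans (by gcongr)))
  · refine mul_le_mul_left ?_ _
    rw [← ENNReal.ofReal_mul (Real.exp_pos _).le, ← Real.exp_add]
    refine ENNReal.ofReal_le_ofReal (Real.exp_le_exp.2 ?_)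
    have h1 : 2 * W1 (w D) (w D') * lam * (n * γ)⁻¹ ≤ 2 * ω * lam * (n * γ)⁻¹ := by gcongr
    linarith

lemma isDP_empty {E : Type*} [MeasurableSpace E] (Mech : (Fin n → Z) → Measure E) (ε δ : ℝ) :
    IsDP ∅ Mech ε δ := ⟨fun _ h => h.elim, fun _ h => h.elim⟩

/-- The log-determinant bound is a W₁ quantity, yet the condition on γ involves B₂; the hypothesis
2ω ≤ B₂ bridges the two. -/
lemma curvature_budget (hn : 1 ≤ n) (hγ : 0 < γ) (hlam : 0 ≤ lam) {B₂ ε : ℝ} (hε : 0 < ε)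
    (hB₂ : 2 * ω ≤ B₂) (h : γ ≥ 2 * lam / (ε * n) * B₂) :
    2 * ω * lam * (n * γ)⁻¹ ≤ ε / 2 := by
  have hn' : (0 : ℝ) < n := by exact_mod_cast hn
  rw [← div_eq_mul_inv, div_le_iff₀ (by positivity)]
  rw [ge_iff_le, div_mul_eq_mul_div, div_le_iff₀ (by positivity)] at h
  have := mul_le_mul_of_nonneg_left hB₂ hlam
  nlinarith

lemma gammaGuarantee_of_bounds (hn : 1 ≤ n) (hD : ∀ D ∈ 𝔇, ∀ i, D i ∈ 𝒵)
    (hw : ∀ D ∈ 𝔇, ∀ i, 0 ≤ w D i)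
    (hω : ∀ D ∈ 𝔇, ∀ D' ∈ 𝔇, Neighbors D D' → W1 (w D) (w D') ≤ ω) {B₁ B₂ : ℝ}
    (hB₁ : 2 * ω ≤ B₁) (hB₂ : 2 * ω ≤ B₂) : GammaGuarantee 𝒵 𝔇 w B₁ B₂ := by
  intro p hp Θ ℓ Rg ζ lam hS ε β γ hε hβ hγ h1 h2
  -- A dataset in 𝔇 supplies a feasible data point, without which ζ and `lam` could be negative.
  rcases 𝔇.eq_empty_or_nonempty with rfl | ⟨D₀, hD₀⟩
  · exact isDP_empty _ _ _
  have hζ := hS.zeta_nonneg (hD D₀ hD₀ ⟨0, hn⟩)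
  have hl := hS.lam_nonneg (hD D₀ hD₀ ⟨0, hn⟩)
  have hprob : IsProbabilityMeasure (normalizedDensity fun b : Euc p => Real.exp (-β * ‖b‖)) :=
    isProbabilityMeasure_normalizedDensity (integrable_exp_neg_mul_norm hβ) (by fun_prop)
      fun _ => Real.exp_pos _
  refine hS.isDP_of_density hn hγ hD hw hω
    (f := fun b => Real.exp (-β * ‖b‖)) MeasurableSet.univ (by simp) ?_
    (curvature_budget hn hγ hl hε hB₂ h2)
  intro b b' _ hbb
  rw [← Real.exp_add]
  refine Real.exp_le_exp.2 ?_
  have h3 : ‖b'‖ - ‖b‖ ≤ 2 * ω * ζ := by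
    have := norm_sub_norm_le b' b
    rw [norm_sub_rev] at this
    exact this.trans hbb
  rw [ge_iff_le, le_div_iff₀ hβ, div_mul_eq_mul_div, div_mul_eq_mul_div, div_le_one hε] at h1
  have h4 := mul_le_mul_of_nonneg_left h3 hβ.le
  have h5 := mul_le_mul_of_nonneg_left hB₁ (mul_nonneg hζ hβ.le)
  linarith

lemma gaussianGuarantee_of_bounds {ε₀ : ℝ} (hn : 1 ≤ n) (hD : ∀ D ∈ 𝔇, ∀ i, D i ∈ 𝒵)
    (hw : ∀ D ∈ 𝔇, ∀ i, 0 ≤ w D i) (hω0 : 0 ≤ ω)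
    (hω : ∀ D ∈ 𝔇, ∀ D' ∈ 𝔇, Neighbors D D' → W1 (w D) (w D') ≤ ω) {B₁ B₂ : ℝ}
    (hB₁ : (8 + |ε₀|) * ω ≤ B₁) (hB₂ : 2 * ω ≤ B₂) : GaussianGuarantee ε₀ 𝒵 𝔇 w B₁ B₂ := by
  intro p hp Θ ℓ Rg ζ lam hS ε δ σ γ hε hεε hδ hδ1 hσ hγ h1 h2
  rcases 𝔇.eq_empty_or_nonempty with rfl | ⟨D₀, hD₀⟩
  · exact isDP_empty _ _ _
  have hζ := hS.zeta_nonneg (hD D₀ hD₀ ⟨0, hn⟩)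
  have hl := hS.lam_nonneg (hD D₀ hD₀ ⟨0, hn⟩)
  have hb : 0 < 1 / (2 * σ ^ 2) := by positivity
  have hprob := isProbabilityMeasure_normalizedDensity (p := p)
    (integrable_exp_neg_mul_norm_sq hb) (by fun_prop) fun _ => Real.exp_pos _
  have htail := gaussianNoise_norm_gt_Ltilde_le (p := p) hσ hδ hδ1
  have hL := one_le_Ltilde hp hδ hδ1
  set L := Ltilde p δ with hLdef
  rw [gaussianNoise_eq_normalizedDensity hσ] at htail ⊢
  refine hS.isDP_of_density hn hγ hD hw hω (A := {b | ‖b‖ ≤ 2 * L * σ})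
    (measurableSet_le (by fun_prop) (by fun_prop)) ?_ ?_ (curvature_budget hn hγ hl hε hB₂ h2)
  · refine le_trans (measure_mono fun b hb => ?_) htail
    simpa using hb
  intro b b' hbA hbb
  rw [← Real.exp_add]
  refine Real.exp_le_exp.2 ?_
  have hbA : ‖b‖ ≤ 2 * L * σ := hbA
  set Δ := 2 * ω * ζ with hΔ
  have hΔ0 : 0 ≤ Δ := by positivity
  set e := |ε₀| with he
  have he0 : 0 ≤ e := abs_nonneg _
  have hεe : ε ≤ e := hεε.trans (le_abs_self _)
  have hω1 : 0 ≤ (8 + e) * ω := by positivity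
  -- the noise level dominates the shift
  have hσL : L * (8 + e) * Δ ≤ ε * σ := by
    have h3 : ζ / ε * (2 * L) * ((8 + e) * ω) ≤ σ := by
      refine le_trans ?_ h1
      have hsq : L ≤ √(L ^ 2 + ε / (3 * n)) := by
        refine Real.le_sqrt_of_sq_le ?_
        have : 0 ≤ ε / (3 * n) := by positivity
        linarith
      gcongr
      linarith
    have h4 : ζ / ε * (2 * L) * ((8 + e) * ω) = L * (8 + e) * Δ / ε := by
      rw [hΔ]; ring
    rw [h4, div_le_iff₀ hε] at h3
    linarith
  have hb' : ‖b'‖ ≤ ‖b‖ + Δ := by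
    have := norm_sub_norm_le b' b
    rw [norm_sub_rev] at this
    linarith
  have h5 : ‖b'‖ ^ 2 ≤ (‖b‖ + Δ) ^ 2 := pow_le_pow_left₀ (norm_nonneg _) hb' 2
  -- The increment is 2‖b‖Δ + Δ². In the factor 8 + |ε₀|, the 8 bounds the linear term by εσ²/2 and
  -- gives 8Δ ≤ εσ.
  have h6 : (‖b‖ + Δ) ^ 2 - ‖b‖ ^ 2 ≤ ε * σ ^ 2 := by
    have h7 : 2 * ‖b‖ * Δ ≤ 4 * (L * Δ) * σ := by
      calc 2 * ‖b‖ * Δ ≤ 2 * (2 * L * σ) * Δ := by gcongr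
        _ = _ := by ring
    have h8 : 8 * (L * Δ) ≤ ε * σ := by
      have : 0 ≤ L * e * Δ := by positivity
      linarith
    have h9 : e * Δ ≤ ε * σ := by
      have : e * Δ ≤ L * e * Δ := by
        calc e * Δ = 1 * (e * Δ) := by ring
          _ ≤ L * (e * Δ) := by gcongr
          _ = _ := by ring
      have : 0 ≤ 8 * (L * Δ) := by positivity
      linarith
    have h10 : 8 * Δ ≤ ε * σ := by
      have : Δ ≤ L * Δ := le_mul_of_one_le_left hΔ0 hL
      linarith
    -- The only use of ε ≤ ε₀: the part |ε₀| of the constant yields εΔ ≤ εσ, so the quadratic term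
    -- is at most εσ²/8.
    have h11 : Δ ≤ σ := by
      have h12 : ε * Δ ≤ ε * σ := (mul_le_mul_of_nonneg_right hεe hΔ0).trans h9
      exact le_of_mul_le_mul_left h12 hε
    have h13 : Δ ^ 2 ≤ ε * σ * σ / 8 := by
      have : 8 * Δ * Δ ≤ ε * σ * σ := mul_le_mul h10 h11 hΔ0 (by positivity)
      linarith
    have h14 : 4 * (L * Δ) * σ ≤ ε * σ * σ / 2 := by
      have := mul_le_mul_of_nonneg_right h8 hσ.le
      linarith
    have h15 : 0 ≤ ε * σ * σ := by positivity
    linarith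
  have h7 : 1 / (2 * σ ^ 2) * (‖b'‖ ^ 2 - ‖b‖ ^ 2) ≤ ε / 2 := by
    rw [one_div_mul_eq_div, div_le_iff₀ (by positivity)]
    linarith
  linarith

lemma W1_le {v v' : Fin n → ℝ} (hn : 1 ≤ n) {B S : ℝ} (hB : ∀ i, v i ≤ B)
    (hS : ∑ i, |v i - v' i| ≤ S) : W1 v v' ≤ S + B := by
  have : Nonempty (Fin n) := ⟨⟨0, hn⟩⟩
  exact add_le_add hS (ciSup_le fun i => (min_le_left _ _).trans (hB i))

/-- The number of changed weights is bounded trivially by n, and 1 + n ≤ 2n; this is the source of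
the √n in every r₂. -/
lemma W2_le {v v' : Fin n → ℝ} (hn : 1 ≤ n) {B S : ℝ} (hv : ∀ i, 0 ≤ v i)
    (hB : ∀ i, v i ≤ B) (hB' : ∀ i, v' i ≤ B) (hS : ∑ i, (v i - v' i) ^ 2 ≤ S) :
    W2 v v' ≤ √(S + 2 * B ^ 2) * √(2 * n) := by
  have : Nonempty (Fin n) := ⟨⟨0, hn⟩⟩
  have hn' : (1 : ℝ) ≤ n := by exact_mod_cast hn
  refine mul_le_mul (Real.sqrt_le_sqrt (add_le_add hS ?_)) (Real.sqrt_le_sqrt ?_)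
    (Real.sqrt_nonneg _) (Real.sqrt_nonneg _)
  · refine mul_le_mul_of_nonneg_left (ciSup_le fun i => ?_) two_pos.le
    rw [pow_two]
    calc v i * v' i ≤ v i * B := mul_le_mul_of_nonneg_left (hB' i) (hv i)
      _ ≤ B * B := mul_le_mul_of_nonneg_right (hB i) ((hv i).trans (hB i))
  · have h1 : (Finset.univ.filter fun i => v i ≠ v' i).card ≤ n := by
      simpa using Finset.card_filter_le (Finset.univ : Finset (Fin n)) (fun i => v i ≠ v' i)
    have h2 : ((Finset.univ.filter fun i => v i ≠ v' i).card : ℝ) ≤ n := by exact_mod_cast h1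
    linarith

/-- Bounded nonnegative weights with `‖w - w'‖₁ ≤ S₁` and `‖w - w'‖₂² ≤ S₂` for neighbouring
datasets enjoy the privacy guarantee. -/
theorem privacyGuarantee_of_bounds {ε₀ : ℝ} (hn : 1 ≤ n) (hD : ∀ D ∈ 𝔇, ∀ i, D i ∈ 𝒵)
    {B S₁ S₂ : ℝ} (hw : ∀ D ∈ 𝔇, ∀ i, 0 ≤ w D i) (hB : ∀ D ∈ 𝔇, ∀ i, w D i ≤ B)
    (h₁ : ∀ D ∈ 𝔇, ∀ D' ∈ 𝔇, Neighbors D D' → ∑ i, |w D i - w D' i| ≤ S₁)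
    (h₂ : ∀ D ∈ 𝔇, ∀ D' ∈ 𝔇, Neighbors D D' → ∑ i, (w D i - w D' i) ^ 2 ≤ S₂)
    (hpos : 0 ≤ S₁ + B) {B₁ B₂ : ℝ} (hB₁ : (8 + |ε₀|) * (S₁ + B) ≤ B₁)
    (hB₂ : 2 * (S₁ + B) ≤ B₂) (hB₂' : √(S₂ + 2 * B ^ 2) * √(2 * n) ≤ B₂) :
    PrivacyGuarantee ε₀ 𝒵 𝔇 w B₁ B₂ := by
  have hω : ∀ D ∈ 𝔇, ∀ D' ∈ 𝔇, Neighbors D D' → W1 (w D) (w D') ≤ S₁ + B :=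
    fun D hD D' hD' h => W1_le hn (hB D hD) (h₁ D hD D' hD' h)
  have he := mul_nonneg (abs_nonneg ε₀) hpos
  refine ⟨?_, ?_, gammaGuarantee_of_bounds hn hD hw hω (by linarith) hB₂,
    gaussianGuarantee_of_bounds hn hD hw hpos hω hB₁ hB₂⟩
  · refine iSup₂_le fun D hD => iSup₂_le fun D' hD' => iSup_le fun h => ?_
    rw [EReal.coe_le_coe_iff]
    have := hω D hD D' hD' h
    linarith
  · refine iSup₂_le fun D hD => iSup₂_le fun D' hD' => iSup_le fun h => ?_
    rw [EReal.coe_le_coe_iff]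
    exact (W2_le hn (hw D hD) (hB D hD) (hB D' hD') (h₂ D hD D' hD' h)).trans hB₂'

end Privacy

/-! ### From sensitivity bounds to the stated rates. -/

section Rates

variable {n : ℕ} {Z : Type*} {𝒵 : Set Z} {𝔇 : Set (Fin n → Z)} {w : (Fin n → Z) → Fin n → ℝ}

/-- The condition 1 ≤ r₁ absorbs the weight bound B into the rate, r₁ ≤ 2 r₂ lets B₂ dominate twice
the W₁ bound, and κ takes care of W₂. The summand 1 keeps the constant positive. -/
theorem privacyGuarantee_of_rates {ε₀ : ℝ} (hn : 1 ≤ n) (hD : ∀ D ∈ 𝔇, ∀ i, D i ∈ 𝒵)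
    {B s₁ S₂ κ r₁ r₂ : ℝ} (hw : ∀ D ∈ 𝔇, ∀ i, 0 ≤ w D i) (hB : ∀ D ∈ 𝔇, ∀ i, w D i ≤ B)
    (h₁ : ∀ D ∈ 𝔇, ∀ D' ∈ 𝔇, Neighbors D D' → ∑ i, |w D i - w D' i| ≤ s₁ * r₁)
    (h₂ : ∀ D ∈ 𝔇, ∀ D' ∈ 𝔇, Neighbors D D' → ∑ i, (w D i - w D' i) ^ 2 ≤ S₂)
    (hs₁ : 0 ≤ s₁) (hB0 : 0 ≤ B) (hκ : 0 ≤ κ) (hr₁ : 1 ≤ r₁) (hr : r₁ ≤ 2 * r₂)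
    (h₃ : √(S₂ + 2 * B ^ 2) * √(2 * n) ≤ κ * r₂) :
    PrivacyGuarantee ε₀ 𝒵 𝔇 w ((2 * (8 + |ε₀|) * (s₁ + B) + κ + 1) * r₁)
      ((2 * (8 + |ε₀|) * (s₁ + B) + κ + 1) * r₂) := by
  have he := abs_nonneg ε₀
  have hr₂ : 0 ≤ r₂ := by linarith
  have h4 : s₁ * r₁ + B ≤ (s₁ + B) * r₁ := by
    have := mul_le_mul_of_nonneg_left hr₁ hB0
    linarith
  have hpos : 0 ≤ s₁ * r₁ + B := by positivity
  have hsB : 0 ≤ s₁ + B := by positivity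
  refine privacyGuarantee_of_bounds hn hD hw hB h₁ h₂ hpos ?_ ?_ ?_
  · have h5 := mul_le_mul_of_nonneg_left h4 (by positivity : 0 ≤ 8 + |ε₀|)
    have h6 : 0 ≤ (8 + |ε₀|) * ((s₁ + B) * r₁) := by positivity
    have h7 : 0 ≤ κ * r₁ := by positivity
    linarith
  · have h5 := mul_le_mul_of_nonneg_left hr hsB
    have h6 : 0 ≤ (s₁ + B) * r₂ := by positivity
    have h7 : 0 ≤ κ * r₂ := by positivity
    have h8 : 0 ≤ |ε₀| * ((s₁ + B) * r₂) := by positivity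
    linarith
  · have h6 : 0 ≤ (8 + |ε₀|) * ((s₁ + B) * r₂) := by positivity
    linarith

lemma sum_abs_le_sqrt_mul_sqrt (f : Fin n → ℝ) {S : ℝ} (hS : ∑ i, f i ^ 2 ≤ S) :
    ∑ i, |f i| ≤ √n * √S := by
  rw [← Real.sqrt_mul (by positivity)]
  refine Real.le_sqrt_of_sq_le ?_
  have h := sq_sum_le_card_mul_sum_sq (s := Finset.univ) (f := fun i => |f i|)
  simp only [sq_abs, Finset.card_univ, Fintype.card_fin] at h
  exact h.trans (by gcongr)

/-- A dimension-free bound on `‖w - w'‖₂` suffices for the rates `r₂ = √n` and any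
`√n ≤ r₁ ≤ 2 √n`. -/
theorem privacyGuarantee_of_sum_sq_le {ε₀ : ℝ} (hn : 1 ≤ n) (hD : ∀ D ∈ 𝔇, ∀ i, D i ∈ 𝒵)
    {B S₂ r₁ : ℝ} (hw : ∀ D ∈ 𝔇, ∀ i, 0 ≤ w D i) (hB : ∀ D ∈ 𝔇, ∀ i, w D i ≤ B) (hB0 : 0 ≤ B)
    (h₂ : ∀ D ∈ 𝔇, ∀ D' ∈ 𝔇, Neighbors D D' → ∑ i, (w D i - w D' i) ^ 2 ≤ S₂)
    (hr₁ : √n ≤ r₁) (hr : r₁ ≤ 2 * √n) :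
    PrivacyGuarantee ε₀ 𝒵 𝔇 w
      ((2 * (8 + |ε₀|) * (√S₂ + B) + √(S₂ + 2 * B ^ 2) * √2 + 1) * r₁)
      ((2 * (8 + |ε₀|) * (√S₂ + B) + √(S₂ + 2 * B ^ 2) * √2 + 1) * √n) := by
  have hn1 : 1 ≤ √(n : ℝ) := Real.one_le_sqrt.2 (by exact_mod_cast hn)
  refine privacyGuarantee_of_rates hn hD hw hB (fun D hD D' hD' h => ?_) h₂ (Real.sqrt_nonneg _)
    hB0 (by positivity) (hn1.trans hr₁) hr ?_
  · refine (sum_abs_le_sqrt_mul_sqrt (fun i => w D i - w D' i) (h₂ D hD D' hD' h)).trans ?_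
    rw [mul_comm]
    gcongr
  · rw [Real.sqrt_mul two_pos.le, mul_assoc]

end Rates

/-! ### Perturbation of normalized score vectors. -/

section Normalized

variable {n : ℕ} {v v' : Fin n → ℝ} {a b : ℝ}

lemma le_sum_of_le (hv : ∀ i, a ≤ v i) : n * a ≤ ∑ i, v i := by
  simpa using Finset.card_nsmul_le_sum Finset.univ v a fun i _ => hv i

lemma normalized_nonneg (hv : ∀ i, 0 ≤ v i) (i : Fin n) : 0 ≤ normalized v i :=
  div_nonneg (mul_nonneg (Nat.cast_nonneg n) (hv i)) (Finset.sum_nonneg fun j _ => hv j)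

lemma normalized_le (ha : 0 < a) (hv : ∀ i, a ≤ v i) (hv' : ∀ i, v i ≤ b) (i : Fin n) :
    normalized v i ≤ b / a := by
  have hn : (0 : ℝ) < n := by exact_mod_cast (Fin.pos i)
  have h := le_sum_of_le hv
  rw [normalized, div_le_div_iff₀ (lt_of_lt_of_le (by positivity) h) ha]
  calc n * v i * a = v i * (n * a) := by ring
    _ ≤ b * ∑ j, v j := mul_le_mul (hv' i) h (by positivity) ((ha.le.trans (hv i)).trans (hv' i))

/-- The difference splits into the change of the numerator and a bounded weight times the relative
change of the normalizer. The normalizer is at least n a, so the second part is an average over the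
indices. -/
lemma abs_normalized_sub_le (ha : 0 < a) (hv : ∀ i, a ≤ v i) (hv' : ∀ i, a ≤ v' i)
    (hb' : ∀ i, v' i ≤ b) (i : Fin n) :
    |normalized v i - normalized v' i| ≤
      |v i - v' i| / a + b / a ^ 2 * ((∑ j, |v j - v' j|) / n) := by
  have hn : (0 : ℝ) < n := by exact_mod_cast (Fin.pos i)
  have hs := le_sum_of_le hv
  have hs' := le_sum_of_le hv'
  have hna : 0 < n * a := by positivity
  have hs0 : 0 < ∑ j, v j := by linarith
  have hs0' : 0 < ∑ j, v' j := by linarith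
  have hb0 : 0 ≤ b := (ha.le.trans (hv' i)).trans (hb' i)
  have hsum : |∑ j, v' j - ∑ j, v j| ≤ ∑ j, |v j - v' j| := by
    rw [abs_sub_comm, ← Finset.sum_sub_distrib]; exact Finset.abs_sum_le_sum_abs _ _
  have heq : normalized v i - normalized v' i =
      n * (v i - v' i) / ∑ j, v j +
        (n * v' i) / (∑ j, v' j) * ((∑ j, v' j - ∑ j, v j) / ∑ j, v j) := by
    rw [normalized, normalized]; field_simp; ring
  rw [heq]
  refine (abs_add_le _ _).trans (add_le_add ?_ ?_)
  · rw [abs_div, abs_mul, abs_of_pos hn, abs_of_pos hs0, div_le_div_iff₀ hs0 ha]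
    calc n * |v i - v' i| * a = |v i - v' i| * (n * a) := by ring
      _ ≤ _ := mul_le_mul_of_nonneg_left hs (abs_nonneg _)
  · rw [abs_mul, abs_div (∑ j, v' j - ∑ j, v j), abs_of_pos hs0]
    have h1 : |n * v' i / ∑ j, v' j| ≤ b / a := by
      change |normalized v' i| ≤ b / a
      rw [abs_of_nonneg (normalized_nonneg (fun i => ha.le.trans (hv' i)) i)]
      exact normalized_le ha hv' hb' i
    have h2 : |∑ j, v' j - ∑ j, v j| / ∑ j, v j ≤ (∑ j, |v j - v' j|) / (n * a) := by gcongr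
    calc _ ≤ b / a * ((∑ j, |v j - v' j|) / (n * a)) := by gcongr
      _ = _ := by field_simp

lemma sum_abs_normalized_sub_le (ha : 0 < a) (hv : ∀ i, a ≤ v i) (hv' : ∀ i, a ≤ v' i)
    (hb' : ∀ i, v' i ≤ b) :
    ∑ i, |normalized v i - normalized v' i| ≤ (1 / a + b / a ^ 2) * ∑ j, |v j - v' j| := by
  rcases Nat.eq_zero_or_pos n with rfl | hn
  · simp
  have hn' : (0 : ℝ) < n := by exact_mod_cast hn
  refine (Finset.sum_le_sum fun i _ => abs_normalized_sub_le ha hv hv' hb' i).trans (le_of_eq ?_)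
  rw [Finset.sum_add_distrib, ← Finset.sum_div, Finset.sum_const, Finset.card_univ,
    Fintype.card_fin, nsmul_eq_mul]
  field_simp

lemma sum_sq_normalized_sub_le (ha : 0 < a) (hv : ∀ i, a ≤ v i) (hv' : ∀ i, a ≤ v' i)
    (hb' : ∀ i, v' i ≤ b) :
    ∑ i, (normalized v i - normalized v' i) ^ 2 ≤
      (2 / a ^ 2 + 2 * b ^ 2 / a ^ 4) * ∑ j, (v j - v' j) ^ 2 := by
  rcases Nat.eq_zero_or_pos n with rfl | hn
  · simp
  have hn' : (0 : ℝ) < n := by exact_mod_cast hn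
  set T := ∑ j, |v j - v' j| with hT
  -- Cauchy–Schwarz: the change of the normalizer contributes T²/n to the sum of squares, which is
  -- again at most ∑ (v − v')².
  have hT2 : T ^ 2 ≤ n * ∑ j, (v j - v' j) ^ 2 := by
    have h := sq_sum_le_card_mul_sum_sq (s := Finset.univ) (f := fun i => |v i - v' i|)
    simpa only [sq_abs, Finset.card_univ, Fintype.card_fin] using h
  have h1 : ∀ i, (normalized v i - normalized v' i) ^ 2 ≤
      2 / a ^ 2 * (v i - v' i) ^ 2 + 2 * (b / a ^ 2 * (T / n)) ^ 2 := by
    intro i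
    rw [← sq_abs]
    calc _ ≤ (|v i - v' i| / a + b / a ^ 2 * (T / n)) ^ 2 :=
          pow_le_pow_left₀ (abs_nonneg _) (abs_normalized_sub_le ha hv hv' hb' i) 2
      _ ≤ 2 * ((|v i - v' i| / a) ^ 2 + (b / a ^ 2 * (T / n)) ^ 2) := add_sq_le
      _ = _ := by rw [div_pow, sq_abs]; ring
  refine (Finset.sum_le_sum fun i _ => h1 i).trans ?_
  rw [Finset.sum_add_distrib, ← Finset.mul_sum, Finset.sum_const, Finset.card_univ,
    Fintype.card_fin, nsmul_eq_mul, add_mul]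
  refine add_le_add_right ?_ _
  calc (n : ℝ) * (2 * (b / a ^ 2 * (T / n)) ^ 2) = 2 * b ^ 2 / a ^ 4 * (T ^ 2 / n) := by
        field_simp
    _ ≤ _ := by
      refine mul_le_mul_of_nonneg_left ?_ (by positivity)
      rw [div_le_iff₀ hn', mul_comm]; exact hT2

end Normalized

/-! ### Weights from scores of individual data points. -/

section Scores

variable {n : ℕ} {Z : Type*}

lemma sum_le_of_eq_zero_off (f : Fin n → ℝ) (j : Fin n) (hf : ∀ i, i ≠ j → f i = 0) {c : ℝ}
    (hc : f j ≤ c) : ∑ i, f i ≤ c := by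
  rwa [Finset.sum_eq_single j (fun i _ h => hf i h) (by simp)]

/-- Weights obtained by normalizing bounded scores of the individual data points. -/
theorem exists_privacyGuarantee_of_scores (ε₀ : ℝ) {a b : ℝ} (ha : 0 < a) (hab : a ≤ b) :
    ∃ c : ℝ, 0 < c ∧ ∀ {Z : Type*} (𝒵 : Set Z) (s : Z → ℝ), (∀ d ∈ 𝒵, a ≤ s d ∧ s d ≤ b) →
      ∀ n : ℕ, 1 ≤ n → PrivacyGuarantee ε₀ 𝒵 (feasibleDatasets n 𝒵)
        (fun D => normalized fun i => s (D i)) (c * 1) (c * √(n : ℝ)) := by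
  have hb : 0 < b := ha.trans_le hab
  -- Only one score changes between neighbours, by at most b, so the total change of the scores is
  -- free of n.
  set s₁ := (1 / a + b / a ^ 2) * b
  set S₂ := (2 / a ^ 2 + 2 * b ^ 2 / a ^ 4) * b ^ 2
  refine ⟨2 * (8 + |ε₀|) * (s₁ + b / a) + √(S₂ + 2 * (b / a) ^ 2) * √2 + 1, by positivity, ?_⟩
  intro Z 𝒵 s hs n hn
  have hn1 : 1 ≤ √(n : ℝ) := Real.one_le_sqrt.2 (by exact_mod_cast hn)
  have hdiff : ∀ d ∈ 𝒵, ∀ d' ∈ 𝒵, |s d - s d'| ≤ b := fun d hd d' hd' =>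
    abs_sub_le_iff.2 ⟨by linarith [(hs d hd).2, (hs d' hd').1],
      by linarith [(hs d' hd').2, (hs d hd).1]⟩
  refine privacyGuarantee_of_rates hn (fun D hD => hD)
    (fun D hD => normalized_nonneg fun i => ha.le.trans (hs _ (hD i)).1)
    (fun D hD => normalized_le ha (fun i => (hs _ (hD i)).1) fun i => (hs _ (hD i)).2)
    (fun D hD D' hD' h => ?_) (S₂ := S₂) (fun D hD D' hD' h => ?_) (by positivity) (by positivity)
    (by positivity) le_rfl (by linarith) ?_
  · obtain ⟨j, hj⟩ := h
    refine (sum_abs_normalized_sub_le ha (fun i => (hs _ (hD i)).1) (fun i => (hs _ (hD' i)).1)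
      fun i => (hs _ (hD' i)).2).trans ?_
    rw [mul_one]
    refine mul_le_mul_of_nonneg_left ?_ (by positivity)
    exact sum_le_of_eq_zero_off _ j (fun i hi => by simp [hj i hi])
      (hdiff _ (hD j) _ (hD' j))
  · obtain ⟨j, hj⟩ := h
    refine (sum_sq_normalized_sub_le ha (fun i => (hs _ (hD i)).1) (fun i => (hs _ (hD' i)).1)
      fun i => (hs _ (hD' i)).2).trans ?_
    refine mul_le_mul_of_nonneg_left ?_ (by positivity)
    refine sum_le_of_eq_zero_off _ j (fun i hi => by simp [hj i hi]) ?_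
    rw [← sq_abs]
    exact pow_le_pow_left₀ (abs_nonneg _) (hdiff _ (hD j) _ (hD' j)) 2
  · rw [Real.sqrt_mul two_pos.le, mul_assoc]

lemma sum_le_sum_add_of_ne (f g : Fin n → ℝ) (j : Fin n) (hg : ∀ i, 0 ≤ g i)
    (hfg : ∀ i, i ≠ j → f i ≤ g i) {c : ℝ} (hc : f j ≤ c) : ∑ i, f i ≤ ∑ i, g i + c := by
  have h : ∑ i, (f i - g i) ≤ ∑ i, if i = j then c else 0 := by
    refine Finset.sum_le_sum fun i _ => ?_
    split_ifs with hi
    · subst hi; linarith [hg i]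
    · linarith [hfg i hi]
  rw [Finset.sum_sub_distrib, Finset.sum_ite_eq' Finset.univ j] at h
  simp only [Finset.mem_univ, if_true] at h
  linarith

end Scores

/-! ### Logistic regression: stability through the midpoint gap of softplus. -/

lemma sq_sub_div_le_log_midpoint_gap {x y : ℝ} (hx : 0 < x) (hy : 0 < y) :
    (x - y) ^ 2 / ((1 + x ^ 2) * (1 + y ^ 2)) ≤
      Real.log (1 + x ^ 2) + Real.log (1 + y ^ 2) - 2 * Real.log (1 + x * y) := by
  -- The midpoint gap is log z for this ratio z, and log z ≥ 1 − 1/z is exactly the claim because (1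
  -- + x²)(1 + y²) − (1 + xy)² = (x − y)².
  have h := Real.one_sub_inv_le_log_of_pos
    (x := (1 + x ^ 2) * (1 + y ^ 2) / (1 + x * y) ^ 2) (by positivity)
  rw [Real.log_div (by positivity) (by positivity), Real.log_mul (by positivity) (by positivity),
    Real.log_pow] at h
  refine le_trans (le_of_eq ?_) h
  rw [inv_div]
  field_simp
  ring

/-- Midpoint strong convexity of the softplus function, in a form that controls `exp (-t)`. -/
lemma sq_exp_neg_sub_le {T s t : ℝ} (hs : |s| ≤ T) (ht : |t| ≤ T) :
    (Real.exp (-s) - Real.exp (-t)) ^ 2 ≤ 4 * Real.exp (5 * T) * (1 + Real.exp T) ^ 2 *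
      (Real.log (1 + Real.exp s) + Real.log (1 + Real.exp t) -
        2 * Real.log (1 + Real.exp ((s + t) / 2))) := by
  have hbd : ∀ r : ℝ, |r| ≤ T → Real.exp (r / 2) ≤ Real.exp (T / 2) ∧
      Real.exp (-(r / 2)) ≤ Real.exp (T / 2) := fun r hr => by
    obtain ⟨h1, h2⟩ := abs_le.1 hr
    exact ⟨Real.exp_le_exp.2 (by linarith), Real.exp_le_exp.2 (by linarith)⟩
  have hsq : ∀ r : ℝ, Real.exp (r / 2) ^ 2 = Real.exp r := fun r => by
    rw [← Real.exp_nat_mul]; congr 1; push_cast; ring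
  have hsq' : ∀ r : ℝ, Real.exp (-(r / 2)) ^ 2 = Real.exp (-r) := fun r => by
    rw [← Real.exp_nat_mul]; congr 1; push_cast; ring
  have key := sq_sub_div_le_log_midpoint_gap (Real.exp_pos (s / 2)) (Real.exp_pos (t / 2))
  rw [hsq, hsq, ← Real.exp_add, ← add_div] at key
  have hes : Real.exp s ≤ Real.exp T := Real.exp_le_exp.2 (abs_le.1 hs).2
  have het : Real.exp t ≤ Real.exp T := Real.exp_le_exp.2 (abs_le.1 ht).2
  have h1 : (Real.exp (s / 2) - Real.exp (t / 2)) ^ 2 ≤ (1 + Real.exp T) ^ 2 *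
      (Real.log (1 + Real.exp s) + Real.log (1 + Real.exp t) -
        2 * Real.log (1 + Real.exp ((s + t) / 2))) := by
    rw [div_le_iff₀ (by positivity)] at key
    have hnn : 0 ≤ Real.log (1 + Real.exp s) + Real.log (1 + Real.exp t) -
        2 * Real.log (1 + Real.exp ((s + t) / 2)) := by
      refine nonneg_of_mul_nonneg_left ((sq_nonneg _).trans key) (by positivity)
    refine key.trans ?_
    rw [mul_comm, pow_two]
    gcongr
  -- The gap controls exp(s/2) − exp(t/2). The remaining factor is at most 2 exp(T/2) exp(2T), whose
  -- square is the constant 4 exp(5T).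
  have h2 : Real.exp (-s) - Real.exp (-t) = (Real.exp (t / 2) - Real.exp (s / 2)) *
      ((Real.exp (s / 2) + Real.exp (t / 2)) *
        (Real.exp (-(s / 2)) ^ 2 * Real.exp (-(t / 2)) ^ 2)) := by
    have e1 : Real.exp (s / 2) * Real.exp (-(s / 2)) = 1 := by rw [← Real.exp_add]; simp
    have e2 : Real.exp (t / 2) * Real.exp (-(t / 2)) = 1 := by rw [← Real.exp_add]; simp
    rw [← hsq' s, ← hsq' t]
    calc Real.exp (-(s / 2)) ^ 2 - Real.exp (-(t / 2)) ^ 2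
        = Real.exp (-(s / 2)) ^ 2 * (Real.exp (t / 2) * Real.exp (-(t / 2))) ^ 2 -
          Real.exp (-(t / 2)) ^ 2 * (Real.exp (s / 2) * Real.exp (-(s / 2))) ^ 2 := by
            rw [e1, e2]; ring
      _ = _ := by ring
  have h3 : (Real.exp (s / 2) + Real.exp (t / 2)) *
      (Real.exp (-(s / 2)) ^ 2 * Real.exp (-(t / 2)) ^ 2) ≤
      2 * Real.exp (T / 2) * (Real.exp (T / 2) ^ 2 * Real.exp (T / 2) ^ 2) := by
    have a1 := hbd s hs
    have a2 := hbd t ht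
    have a3 : Real.exp (s / 2) + Real.exp (t / 2) ≤ 2 * Real.exp (T / 2) := by linarith [a1.1, a2.1]
    have a4 := a1.2
    have a5 := a2.2
    gcongr
  have h4 : (2 * Real.exp (T / 2) * (Real.exp (T / 2) ^ 2 * Real.exp (T / 2) ^ 2)) ^ 2 =
      4 * Real.exp (5 * T) := by
    have : Real.exp (5 * T) = Real.exp (T / 2) ^ 10 := by
      rw [← Real.exp_nat_mul]; congr 1; push_cast; ring
    rw [this]; ring
  have h5 := pow_le_pow_left₀ (by positivity) h3 2
  rw [h4] at h5
  rw [h2, mul_pow, mul_comm, mul_assoc]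
  have h6 : (Real.exp (t / 2) - Real.exp (s / 2)) ^ 2 =
      (Real.exp (s / 2) - Real.exp (t / 2)) ^ 2 := by ring
  rw [h6]
  exact mul_le_mul h5 h1 (sq_nonneg _) (by positivity)

section Logistic

variable {n d : ℕ} {Y : Type*}

/-- The logistic negative log-likelihood of a data point. -/
def logisticTerm (z : Record (Euc d) Y) (μ : Euc d) : ℝ :=
  Real.log (1 + Real.exp (inner ℝ z.x μ)) - ((z.a : ℕ) : ℝ) * inner ℝ z.x μ

lemma abs_inner_le_mul_abs {M R : ℝ} {x μ : Euc d} (hx : ‖x‖ ≤ M) (hμ : ‖μ‖ ≤ R) :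
    |inner ℝ x μ| ≤ |M| * |R| :=
  (abs_real_inner_le_norm x μ).trans (mul_le_mul (hx.trans (le_abs_self M))
    (hμ.trans (le_abs_self R)) (norm_nonneg _) (abs_nonneg _))

lemma abs_logisticTerm_le {T : ℝ} (z : Record (Euc d) Y) {μ : Euc d}
    (h : |inner ℝ z.x μ| ≤ T) : |logisticTerm z μ| ≤ Real.log (1 + Real.exp T) + T := by
  have h1 : 0 ≤ Real.log (1 + Real.exp (inner ℝ z.x μ)) :=
    Real.log_nonneg (by linarith [Real.exp_pos (inner ℝ z.x μ)])
  have h2 : Real.log (1 + Real.exp (inner ℝ z.x μ)) ≤ Real.log (1 + Real.exp T) :=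
    Real.log_le_log (by positivity) (by gcongr; exact (abs_le.1 h).2)
  have h3 : ((z.a : ℕ) : ℝ) ≤ 1 := by
    have : (z.a : ℕ) ≤ 1 := Nat.le_of_lt_succ z.a.2
    exact_mod_cast this
  have h4 : |((z.a : ℕ) : ℝ) * inner ℝ z.x μ| ≤ T := by
    rw [abs_mul, Nat.abs_cast]
    calc _ ≤ 1 * |inner ℝ z.x μ| := by gcongr
      _ ≤ T := by rwa [one_mul]
  refine (abs_sub _ _).trans ?_
  rw [abs_of_nonneg h1]
  linarith

lemma norm_midpoint_sq_le {E : Type*} [NormedAddCommGroup E] [InnerProductSpace ℝ E] (x y : E) :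
    2 * ‖(1 / 2 : ℝ) • (x + y)‖ ^ 2 ≤ ‖x‖ ^ 2 + ‖y‖ ^ 2 := by
  have h := parallelogram_law_with_norm ℝ x y
  rw [norm_smul, Real.norm_of_nonneg (by norm_num), mul_pow]
  nlinarith [sq_nonneg ‖x - y‖]

/-- The terms linear in the parameter cancel in the midpoint gap and the ridge term contributes
nonnegatively, so the softplus gaps alone are bounded, uniformly in `lam`. -/
lemma logisticLoss_midpoint {lam : ℝ} (hlam : 0 ≤ lam)
    (D : Fin n → Record (Euc d) Y) (μ ν : Euc d) :
    1 / n * ∑ i, (Real.log (1 + Real.exp (inner ℝ (D i).x μ)) +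
        Real.log (1 + Real.exp (inner ℝ (D i).x ν)) -
        2 * Real.log (1 + Real.exp ((inner ℝ (D i).x μ + inner ℝ (D i).x ν) / 2))) ≤
      logisticLoss lam D μ + logisticLoss lam D ν -
        2 * logisticLoss lam D ((1 / 2 : ℝ) • (μ + ν)) := by
  have h := mul_le_mul_of_nonneg_left (norm_midpoint_sq_le μ ν) (by positivity : 0 ≤ lam / 2)
  have h2 : ∀ i, inner ℝ (D i).x ((1 / 2 : ℝ) • (μ + ν)) =
      (inner ℝ (D i).x μ + inner ℝ (D i).x ν) / 2 := fun i => by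
    rw [real_inner_smul_right, inner_add_right]; ring
  have h3 : ∑ i, (Real.log (1 + Real.exp (inner ℝ (D i).x μ)) +
        Real.log (1 + Real.exp (inner ℝ (D i).x ν)) -
        2 * Real.log (1 + Real.exp ((inner ℝ (D i).x μ + inner ℝ (D i).x ν) / 2))) =
      ∑ i, logisticTerm (D i) μ + ∑ i, logisticTerm (D i) ν -
        2 * ∑ i, logisticTerm (D i) ((1 / 2 : ℝ) • (μ + ν)) := by
    rw [Finset.mul_sum, ← Finset.sum_add_distrib, ← Finset.sum_sub_distrib]
    refine Finset.sum_congr rfl fun i _ => ?_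
    simp only [logisticTerm, h2]
    ring
  rw [h3]
  simp only [logisticLoss]
  simp only [logisticTerm] at h3 ⊢
  linarith

lemma logisticLoss_sub_le {lam T : ℝ} {D D' : Fin n → Record (Euc d) Y}
    {j : Fin n} (hj : ∀ i, i ≠ j → D i = D' i) {μ : Euc d} (h : |inner ℝ (D j).x μ| ≤ T)
    (h' : |inner ℝ (D' j).x μ| ≤ T) :
    |logisticLoss lam D μ - logisticLoss lam D' μ| ≤
      1 / n * (2 * (Real.log (1 + Real.exp T) + T)) := by
  have h1 : logisticLoss lam D μ - logisticLoss lam D' μ =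
      1 / n * (logisticTerm (D j) μ - logisticTerm (D' j) μ) := by
    have : ∑ i, (logisticTerm (D i) μ - logisticTerm (D' i) μ) =
        logisticTerm (D j) μ - logisticTerm (D' j) μ :=
      Finset.sum_eq_single j (fun i _ hi => by rw [hj i hi, sub_self]) (by simp)
    rw [← this, Finset.sum_sub_distrib]
    simp only [logisticLoss, logisticTerm]
    ring
  rw [h1, abs_mul, abs_of_nonneg (by positivity)]
  refine mul_le_mul_of_nonneg_left ((abs_sub _ _).trans ?_) (by positivity)
  linarith [abs_logisticTerm_le (D j) h, abs_logisticTerm_le (D' j) h']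

/-- The two minimizers are compared on the covariates of `D`. Optimality of μ at the midpoint bounds
the gap by L_D(ν) − L_D(μ), and optimality of ν on `D'` bounds this by two changes of dataset, each
of order 1/n. The factor 1/n in front of the softplus gaps cancels this order. -/
lemma sum_sq_exp_neg_sub_le {M R lam : ℝ} (hlam : 0 ≤ lam) {D D' : Fin n → Record (Euc d) Y}
    (hD : ∀ i, ‖(D i).x‖ ≤ M) (hD' : ∀ i, ‖(D' i).x‖ ≤ M) (hDD' : Neighbors D D')
    {μ ν : Euc d} (hμR : ‖μ‖ ≤ R) (hνR : ‖ν‖ ≤ R)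
    (hμ : IsMinOn (logisticLoss lam D) {ν | ‖ν‖ ≤ R} μ)
    (hν : IsMinOn (logisticLoss lam D') {ν | ‖ν‖ ≤ R} ν) :
    ∑ i, (Real.exp (-inner ℝ (D i).x μ) - Real.exp (-inner ℝ (D i).x ν)) ^ 2 ≤
      4 * Real.exp (5 * (|M| * |R|)) * (1 + Real.exp (|M| * |R|)) ^ 2 *
        (4 * (Real.log (1 + Real.exp (|M| * |R|)) + |M| * |R|)) := by
  obtain ⟨j, hj⟩ := hDD'
  have hn : 1 ≤ n := Fin.pos j
  have hn' : (0 : ℝ) < n := by exact_mod_cast hn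
  set T := |M| * |R| with hT
  have hm : ‖(1 / 2 : ℝ) • (μ + ν)‖ ≤ R := by
    rw [norm_smul, Real.norm_of_nonneg (by norm_num)]
    linarith [norm_add_le μ ν]
  have e1 : logisticLoss lam D μ ≤ logisticLoss lam D ((1 / 2 : ℝ) • (μ + ν)) := hμ hm
  have e2 : logisticLoss lam D' ν ≤ logisticLoss lam D' μ := hν hμR
  have e3 := logisticLoss_midpoint hlam D μ ν
  have e4 := abs_le.1 (logisticLoss_sub_le (lam := lam) hj
    (abs_inner_le_mul_abs (hD j) hμR) (abs_inner_le_mul_abs (hD' j) hμR))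
  have e5 := abs_le.1 (logisticLoss_sub_le (lam := lam) hj
    (abs_inner_le_mul_abs (hD j) hνR) (abs_inner_le_mul_abs (hD' j) hνR))
  rw [← hT] at e4 e5
  refine (Finset.sum_le_sum fun i _ => sq_exp_neg_sub_le (abs_inner_le_mul_abs (hD i) hμR)
    (abs_inner_le_mul_abs (hD i) hνR)).trans ?_
  rw [← Finset.mul_sum]
  refine mul_le_mul_of_nonneg_left ?_ (by positivity)
  refine le_of_mul_le_mul_left ?_ (one_div_pos.2 hn')
  refine e3.trans ?_
  linarith [e4.1, e5.2]

end Logistic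

/-- The ℓ² bound does not involve `lamIPW`. The term √n/(1 + `lamIPW`) lies between 0 and √n, so it
only has to be carried along in r₁. -/
theorem exists_privacyGuarantee_estimatedIPW (ε₀ M R : ℝ) : ∃ c : ℝ, 0 < c ∧
    ∀ (d : ℕ) (Y : Type*) (𝒵 : Set (Record (Euc d) Y)), (∀ z ∈ 𝒵, ‖z.x‖ ≤ M) →
    ∀ (n : ℕ), 1 ≤ n → ∀ lamIPW : ℝ, 0 ≤ lamIPW →
    ∀ w : (Fin n → Record (Euc d) Y) → Fin n → ℝ,
      (∀ D ∈ feasibleDatasets n 𝒵, IsEstimatedIPW R lamIPW D (w D)) →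
      PrivacyGuarantee ε₀ 𝒵 (feasibleDatasets n 𝒵) w
        (c * (√(n : ℝ) / (1 + lamIPW) + √(n : ℝ))) (c * √(n : ℝ)) := by
  set T := |M| * |R| with hT
  have hT0 : 0 ≤ T := by positivity
  set b := 1 + Real.exp T with hb
  set V := 4 * Real.exp (5 * T) * (1 + Real.exp T) ^ 2 * (4 * (Real.log (1 + Real.exp T) + T)) +
    b ^ 2 with hV
  set S₂ := (2 / (1 : ℝ) ^ 2 + 2 * b ^ 2 / 1 ^ 4) * V with hS₂
  refine ⟨2 * (8 + |ε₀|) * (√S₂ + b / 1) + √(S₂ + 2 * (b / 1) ^ 2) * √2 + 1, by positivity, ?_⟩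
  intro d Y 𝒵 hM n hn lam hlam w hw
  have hscore : ∀ D ∈ feasibleDatasets n 𝒵, ∀ μ : Euc d, ‖μ‖ ≤ R → ∀ i,
      1 ≤ 1 + Real.exp (-inner ℝ (D i).x μ) ∧ 1 + Real.exp (-inner ℝ (D i).x μ) ≤ b := by
    intro D hD μ hμ i
    have h1 := abs_inner_le_mul_abs (hM _ (hD i)) hμ
    refine ⟨by linarith [Real.exp_pos (-inner ℝ (D i).x μ)], ?_⟩
    have : Real.exp (-inner ℝ (D i).x μ) ≤ Real.exp T :=
      Real.exp_le_exp.2 (by linarith [(abs_le.1 h1).1])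
    linarith
  refine privacyGuarantee_of_sum_sq_le hn (fun D hD => hD) (fun D hD i => ?_) (fun D hD i => ?_)
    (by positivity) (fun D hD D' hD' hnb => ?_) ?_ ?_
  · obtain ⟨μ, hμ, -, h⟩ := hw D hD
    rw [h]
    exact normalized_nonneg (fun i => zero_le_one.trans (hscore D hD μ hμ i).1) i
  · obtain ⟨μ, hμ, -, h⟩ := hw D hD
    rw [h]
    exact normalized_le one_pos (fun i => (hscore D hD μ hμ i).1)
      (fun i => (hscore D hD μ hμ i).2) i
  · obtain ⟨μ, hμ, hmin, h⟩ := hw D hD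
    obtain ⟨ν, hν, hmin', h'⟩ := hw D' hD'
    rw [h, h']
    refine (sum_sq_normalized_sub_le one_pos (fun i => (hscore D hD μ hμ i).1)
      (fun i => (hscore D' hD' ν hν i).1) (fun i => (hscore D' hD' ν hν i).2)).trans ?_
    refine mul_le_mul_of_nonneg_left ?_ (by positivity)
    have hsum := sum_sq_exp_neg_sub_le hlam (fun i => hM _ (hD i)) (fun i => hM _ (hD' i)) hnb
      hμ hν hmin hmin'
    obtain ⟨j, hj⟩ := hnb
    refine (sum_le_sum_add_of_ne _
      (fun i => (Real.exp (-inner ℝ (D i).x μ) - Real.exp (-inner ℝ (D i).x ν)) ^ 2) j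
      (fun i => sq_nonneg _) (fun i hi => ?_) (c := b ^ 2) ?_).trans ?_
    · rw [← hj i hi, add_sub_add_left_eq_sub]
    · have h1 := hscore D hD μ hμ j
      have h2 := hscore D' hD' ν hν j
      rw [← sq_abs]
      exact pow_le_pow_left₀ (abs_nonneg _)
        (abs_sub_le_iff.2 ⟨by linarith [h1.2, h2.1], by linarith [h1.1, h2.2]⟩) 2
    · linarith
  · have : 0 ≤ √(n : ℝ) / (1 + lam) := by positivity
    linarith
  · have : √(n : ℝ) / (1 + lam) ≤ √n := div_le_self (Real.sqrt_nonneg _) (by linarith)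
    linarith

/-! ### MMD as a Hilbert space norm, and strong convexity of the objective. -/

section MMD

variable {X Y : Type*} {H : Type*} [NormedAddCommGroup H] [InnerProductSpace ℝ H] [CompleteSpace H]
  [RKHS ℝ H X ℝ] {n : ℕ}

variable (H) in
/-- The kernel section `K(·, x)` as an element of the RKHS. -/
def kerVec (x : X) : H := RKHS.kerFun H x (1 : ℝ)

lemma inner_kerVec (x : X) (f : H) : inner ℝ (kerVec H x) f = f x := by
  rw [kerVec, RKHS.kerFun_inner]; simp

lemma norm_kerVec_le {x : X} {C : ℝ} (h : RKHS.kernel H x x 1 ≤ C) : ‖kerVec H x‖ ≤ √C := by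
  refine Real.le_sqrt_of_sq_le ?_
  rw [← real_inner_self_eq_norm_sq, inner_kerVec, kerVec, RKHS.kerFun_apply]
  exact h

variable (H) in
/-- The kernel embedding `∑ m_i K(·, x_i)` of a signed measure `∑ m_i δ_{x_i}`. -/
def kerEmb (x : Fin n → X) (m : Fin n → ℝ) : H := ∑ i, m i • kerVec H (x i)

lemma inner_kerEmb (x : Fin n → X) (m : Fin n → ℝ) (f : H) :
    inner ℝ (kerEmb H x m) f = ∑ i, m i * f (x i) := by
  simp only [kerEmb, sum_inner, real_inner_smul_left, inner_kerVec]

/-- By the reproducing property the discrepancy is the dual norm of the difference of the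
embeddings, attained at its normalization. -/
lemma mmd_eq_norm (x : Fin n → X) (u v : Fin n → ℝ) :
    mmd H x u v = ‖kerEmb H x u - kerEmb H x v‖ := by
  set φ := kerEmb H x u - kerEmb H x v with hφ
  have h1 : ∀ f : H, ∑ i, u i * f (x i) - ∑ i, v i * f (x i) = inner ℝ φ f := fun f => by
    rw [hφ, inner_sub_left, inner_kerEmb, inner_kerEmb]
  have h2 : ∀ f : {f : H // ‖f‖ ≤ 1}, |inner ℝ φ (f : H)| ≤ ‖φ‖ := fun f =>
    (abs_real_inner_le_norm _ _).trans (mul_le_of_le_one_right (norm_nonneg _) f.2)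
  have hne : Nonempty {f : H // ‖f‖ ≤ 1} := ⟨⟨0, by simp⟩⟩
  simp only [mmd, h1]
  refine le_antisymm (ciSup_le h2) ?_
  have hbdd : BddAbove (Set.range fun f : {f : H // ‖f‖ ≤ 1} => |inner ℝ φ (f : H)|) :=
    ⟨‖φ‖, by rintro _ ⟨f, rfl⟩; exact h2 f⟩
  rcases eq_or_ne φ 0 with h0 | h0
  · rw [h0, norm_zero]
    exact Real.iSup_nonneg fun _ => abs_nonneg _
  · have hpos : 0 < ‖φ‖ := norm_pos_iff.2 h0
    refine le_trans (le_of_eq ?_) (le_ciSup hbdd ⟨‖φ‖⁻¹ • φ, by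
      rw [norm_smul, norm_inv, norm_norm, inv_mul_cancel₀ hpos.ne']⟩)
    simp only
    rw [real_inner_smul_right, real_inner_self_eq_norm_sq, abs_of_nonneg (by positivity)]
    field_simp

lemma norm_kerEmb_le {x : Fin n → X} {s : ℝ} (hs : ∀ i, ‖kerVec H (x i)‖ ≤ s) (m : Fin n → ℝ) :
    ‖kerEmb H x m‖ ≤ s * ∑ i, |m i| := by
  rw [Finset.mul_sum]
  refine (norm_sum_le _ _).trans (Finset.sum_le_sum fun i _ => ?_)
  rw [norm_smul, Real.norm_eq_abs, mul_comm]
  exact mul_le_mul_of_nonneg_right (hs i) (abs_nonneg _)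

/-- Embeddings of measures on covariates that agree except at the index `j`. -/
lemma norm_kerEmb_sub_le {x x' : Fin n → X} {j : Fin n} (hx : ∀ i, i ≠ j → x i = x' i) {s : ℝ}
    (hs0 : 0 ≤ s) (hs : ∀ i, ‖kerVec H (x i)‖ ≤ s) (hs' : ∀ i, ‖kerVec H (x' i)‖ ≤ s)
    {m m' q : Fin n → ℝ} (hq : ∀ i, 0 ≤ q i) (hm : ∀ i, i ≠ j → |m i - m' i| ≤ q i) {t : ℝ}
    (ht : |m j| + |m' j| ≤ t) :
    ‖kerEmb H x m - kerEmb H x' m'‖ ≤ s * (∑ i, q i + t) := by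
  rw [kerEmb, kerEmb, ← Finset.sum_sub_distrib]
  refine (norm_sum_le _ _).trans ?_
  rw [mul_add, Finset.mul_sum]
  refine sum_le_sum_add_of_ne _ (fun i => s * q i) j (fun i => mul_nonneg hs0 (hq i))
    (fun i hi => ?_) ?_
  · rw [hx i hi, ← sub_smul, norm_smul, Real.norm_eq_abs, mul_comm]
    exact mul_le_mul (hs' i) (hm i hi) (abs_nonneg _) hs0
  · refine (norm_sub_le _ _).trans ?_
    rw [norm_smul, norm_smul, Real.norm_eq_abs, Real.norm_eq_abs]
    calc _ ≤ |m j| * s + |m' j| * s := by gcongr; exacts [hs j, hs' j]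
      _ = s * (|m j| + |m' j|) := by ring
      _ ≤ _ := mul_le_mul_of_nonneg_left ht hs0

lemma abs_norm_sq_sub_le {E : Type*} [NormedAddCommGroup E] {a b : E} {K δ : ℝ} (ha : ‖a‖ ≤ K)
    (hb : ‖b‖ ≤ K) (hab : ‖a - b‖ ≤ δ) : |‖a‖ ^ 2 - ‖b‖ ^ 2| ≤ 2 * K * δ := by
  have h1 : ‖a‖ ^ 2 - ‖b‖ ^ 2 = (‖a‖ + ‖b‖) * (‖a‖ - ‖b‖) := by ring
  have hK : 0 ≤ K := (norm_nonneg a).trans ha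
  rw [h1, abs_mul, abs_of_nonneg (by positivity)]
  exact mul_le_mul (by linarith) ((abs_norm_sub_norm_le a b).trans hab) (abs_nonneg _)
    (by positivity)

/-- The MMD terms are squared norms of affine functions of u, so their gaps are nonnegative; the
penalty contributes exactly κ/2 ‖u − v‖² by the parallelogram law. -/
lemma mmdObjective_midpoint {α κ : ℝ} (hα : 0 ≤ α) (hα1 : α ≤ 1) (D : Fin n → Record X Y)
    (u v : Fin n → ℝ) :
    κ / 2 * ∑ i, (u i - v i) ^ 2 ≤ mmdObjective H α κ D u + mmdObjective H α κ D v -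
      2 * mmdObjective H α κ D (fun i => (u i + v i) / 2) := by
  have hemb : ∀ a, kerEmb H (fun i => (D i).x) (groupMass D (fun i => (u i + v i) / 2) a) =
      (1 / 2 : ℝ) • (kerEmb H (fun i => (D i).x) (groupMass D u a) +
        kerEmb H (fun i => (D i).x) (groupMass D v a)) := by
    intro a
    rw [kerEmb, kerEmb, kerEmb, ← Finset.sum_add_distrib, Finset.smul_sum]
    refine Finset.sum_congr rfl fun i _ => ?_
    rw [← add_smul, smul_smul]
    congr 1
    simp only [groupMass]
    split_ifs <;> ring
  simp only [mmdObjective, mmd_eq_norm, hemb]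
  set x₀ := kerEmb H (fun i => (D i).x) (groupMass D u 0)
  set x₁ := kerEmb H (fun i => (D i).x) (groupMass D u 1)
  set y₀ := kerEmb H (fun i => (D i).x) (groupMass D v 0)
  set y₁ := kerEmb H (fun i => (D i).x) (groupMass D v 1)
  set z := kerEmb H (fun i => (D i).x) fun _ => 1 / (n : ℝ)
  have h0 := mul_le_mul_of_nonneg_left (norm_midpoint_sq_le (x₀ - z) (y₀ - z)) hα
  have h1 := mul_le_mul_of_nonneg_left (norm_midpoint_sq_le (x₁ - z) (y₁ - z)) hα
  have h2 := mul_le_mul_of_nonneg_left (norm_midpoint_sq_le (x₀ - x₁) (y₀ - y₁))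
    (sub_nonneg.2 hα1)
  rw [show (1 / 2 : ℝ) • (x₀ - z + (y₀ - z)) = (1 / 2 : ℝ) • (x₀ + y₀) - z by module] at h0
  rw [show (1 / 2 : ℝ) • (x₁ - z + (y₁ - z)) = (1 / 2 : ℝ) • (x₁ + y₁) - z by module] at h1
  rw [show (1 / 2 : ℝ) • (x₀ - x₁ + (y₀ - y₁)) =
    (1 / 2 : ℝ) • (x₀ + y₀) - (1 / 2 : ℝ) • (x₁ + y₁) by module] at h2
  have h3 : ∑ i, (u i - v i) ^ 2 =
      2 * ∑ i, u i ^ 2 + 2 * ∑ i, v i ^ 2 - 4 * ∑ i, ((u i + v i) / 2) ^ 2 := by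
    rw [Finset.mul_sum, Finset.mul_sum, Finset.mul_sum, ← Finset.sum_add_distrib,
      ← Finset.sum_sub_distrib]
    exact Finset.sum_congr rfl fun i _ => by ring
  rw [h3]
  linarith

end MMD

/-! ### Moving feasible points between neighbouring MMD problems. -/

section Transfer

variable {X Y : Type*} {n : ℕ}

/-- A feasible point for `D'` is close to a feasible point for the neighbouring dataset `D`. -/
lemma exists_mmdFeasible_near {R : ℝ} {D D' : Fin n → Record X Y} (hDD' : Neighbors D D')
    (hne : (mmdFeasible R D).Nonempty) {u' : Fin n → ℝ} (hu' : u' ∈ mmdFeasible R D') :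
    ∃ u ∈ mmdFeasible R D, ∑ i, |u i - u' i| ≤ 2 * R := by
  obtain ⟨j, hj⟩ := hDD'
  obtain ⟨u₀, hu₀, hsum₀⟩ := hne
  obtain ⟨hbd, hsum⟩ := hu'
  have hR : 0 ≤ R := (hbd j).1.trans (hbd j).2
  by_cases ha : (D j).a = (D' j).a
  · have ha' : ∀ i, (D i).a = (D' i).a := fun i => by
      by_cases hi : i = j
      · rw [hi, ha]
      · rw [hj i hi]
    exact ⟨u', ⟨hbd, fun a => by simp_rw [ha']; exact hsum a⟩, by simpa using hR⟩
  set b := (D' j).a with hb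
  set U := ∑ i, if (D i).a = b then u' i else 0 with hU
  set cap := ∑ i, if (D i).a = b then R else 0 with hcap
  have hUn : U + u' j = n := by
    have h1 : ∑ i, ((if (D' i).a = b then u' i else 0) - if (D i).a = b then u' i else 0) =
        u' j := by
      rw [Finset.sum_eq_single j (fun i _ hi => by rw [hj i hi, sub_self]) (by simp)]
      simp [ha, ← hb]
    rw [Finset.sum_sub_distrib, hsum b] at h1
    linarith
  -- Feasibility of the problem for `D` is used here: group b without the index j still has capacity
  -- n.
  have hcapn : (n : ℝ) ≤ cap := by
    rw [← hsum₀ b]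
    refine Finset.sum_le_sum fun i _ => ?_
    split_ifs
    exacts [(hu₀ i).2, le_rfl]
  -- The point j left group b, so its mass u'_j is spread over that group in proportion to the
  -- slacks R − u'_i, and j gets weight 0 in its new group. Removing and adding u'_j ≤ R each cost
  -- at most R in ℓ¹.
  set τ := u' j / (cap - U) with hτ
  have hslack : u' j ≤ cap - U := by linarith
  have hτ0 : 0 ≤ τ := div_nonneg (hbd j).1 ((hbd j).1.trans hslack)
  have hτ1 : τ ≤ 1 := div_le_one_of_le₀ hslack ((hbd j).1.trans hslack)
  have hτeq : τ * (cap - U) = u' j := by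
    -- Without slack there is no mass to move, and division by zero makes τ = 0.
    rcases eq_or_ne (cap - U) 0 with h0 | h0
    · rw [h0, mul_zero]; exact le_antisymm (hbd j).1 (h0 ▸ hslack)
    · exact div_mul_cancel₀ _ h0
  have hcapU : cap - U = ∑ i, if (D i).a = b then R - u' i else 0 := by
    rw [hcap, hU, ← Finset.sum_sub_distrib]
    exact Finset.sum_congr rfl fun i _ => by split_ifs <;> ring
  refine ⟨fun i => if i = j then 0 else if (D i).a = b then u' i + τ * (R - u' i) else u' i,
    ⟨fun i => ?_, fun a => ?_⟩, ?_⟩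
  · have h1 := hbd i
    have h2 : 0 ≤ R - u' i := by linarith [h1.2]
    have h3 : τ * (R - u' i) ≤ R - u' i := mul_le_of_le_one_left h2 hτ1
    have h4 : 0 ≤ τ * (R - u' i) := mul_nonneg hτ0 h2
    dsimp only
    split_ifs
    · exact ⟨le_rfl, hR⟩
    · exact ⟨by linarith [h1.1], by linarith⟩
    · exact h1
  · by_cases hab : a = b
    · subst hab
      have h1 : ∀ i, (if (D i).a = b then (if i = j then 0 else if (D i).a = b then
          u' i + τ * (R - u' i) else u' i) else 0) =
          (if (D i).a = b then u' i else 0) + τ * if (D i).a = b then R - u' i else 0 := by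
        intro i
        by_cases hi : (D i).a = b
        · have hij : i ≠ j := fun h => ha (h ▸ hi)
          simp [hi, hij]
        · simp [hi]
      simp_rw [h1]
      rw [Finset.sum_add_distrib, ← Finset.mul_sum, ← hcapU, hτeq, ← hU, hUn]
    · rw [← hsum a]
      refine Finset.sum_congr rfl fun i _ => ?_
      by_cases hi : i = j
      · subst hi
        simp [← hb, Ne.symm hab]
      · rw [hj i hi]
        simp only [hi, if_false]
        by_cases h2 : (D' i).a = a
        · simp [h2, hab, hj i hi]
        · simp [h2]
  · have h1 : ∀ i, |(if i = j then 0 else if (D i).a = b then u' i + τ * (R - u' i) else u' i) -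
        u' i| ≤ (if i = j then u' j else 0) + τ * if (D i).a = b then R - u' i else 0 := by
      intro i
      have h2 : 0 ≤ R - u' i := by linarith [(hbd i).2]
      have h3 := mul_nonneg hτ0 h2
      by_cases hi : i = j
      · subst hi
        simp [ha, abs_of_nonneg (hbd i).1]
      · by_cases h4 : (D i).a = b
        · simp [hi, h4, abs_of_nonneg h3]
        · simp [hi, h4]
    refine (Finset.sum_le_sum fun i _ => h1 i).trans ?_
    rw [Finset.sum_add_distrib, ← Finset.mul_sum, ← hcapU, hτeq]
    simp only [Finset.sum_ite_eq', Finset.mem_univ, if_true]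
    linarith [(hbd j).2]

end Transfer

/-! ### Stability of the MMD weights. -/

section MMDStability

variable {X Y : Type*} {H : Type*} [NormedAddCommGroup H] [InnerProductSpace ℝ H] [CompleteSpace H]
  [RKHS ℝ H X ℝ] {n : ℕ}

lemma groupMass_nonneg {D : Fin n → Record X Y} {u : Fin n → ℝ} (hu : ∀ i, 0 ≤ u i) (a : Fin 2)
    (i : Fin n) : 0 ≤ groupMass D u a i := by
  unfold groupMass
  split_ifs
  exacts [div_nonneg (hu i) (Nat.cast_nonneg n), le_rfl]

lemma sum_abs_groupMass {R : ℝ} {D : Fin n → Record X Y} {u : Fin n → ℝ} (hn : 1 ≤ n)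
    (hu : u ∈ mmdFeasible R D) (a : Fin 2) : ∑ i, |groupMass D u a i| = 1 := by
  have hn' : (n : ℝ) ≠ 0 := by positivity
  have h1 : ∀ i, |groupMass D u a i| = (if (D i).a = a then u i else 0) / n := fun i => by
    rw [abs_of_nonneg (groupMass_nonneg (fun i => (hu.1 i).1) a i), groupMass]
    split_ifs <;> simp
  simp_rw [h1]
  rw [← Finset.sum_div, hu.2 a, div_self hn']

/-- All embeddings have norm at most s and move by O(s/n), so each squared MMD changes by at most
4sδ with δ = s(8R + 2)/n. Their coefficients add up to 1 + α ≤ 2, within the factor 3 allowed. The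
penalty changes by at most κ · 2R · 2R. -/
lemma abs_mmdObjective_sub_le {R α κ s : ℝ} (hα : 0 ≤ α) (hα1 : α ≤ 1) (hκ : 0 ≤ κ)
    {D D' : Fin n → Record X Y} (hDD' : Neighbors D D') (hs0 : 0 ≤ s)
    (hs : ∀ i, ‖kerVec H (D i).x‖ ≤ s) (hs' : ∀ i, ‖kerVec H (D' i).x‖ ≤ s)
    {u u' : Fin n → ℝ} (hu : u ∈ mmdFeasible R D) (hu' : u' ∈ mmdFeasible R D')
    (huu' : ∑ i, |u i - u' i| ≤ 2 * R) :
    |mmdObjective H α κ D u - mmdObjective H α κ D' u'| ≤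
      12 * s ^ 2 * (8 * R + 2) / n + 4 * κ * R ^ 2 := by
  obtain ⟨j, hj⟩ := hDD'
  have hn : 1 ≤ n := Fin.pos j
  have hn' : (0 : ℝ) < n := by exact_mod_cast hn
  have hR : 0 ≤ R := (hu.1 j).1.trans (hu.1 j).2
  have hgm : ∀ {D : Fin n → Record X Y} {u : Fin n → ℝ}, u ∈ mmdFeasible R D → ∀ a,
      |groupMass D u a j| ≤ R / n := by
    intro D u hu a
    rw [abs_of_nonneg (groupMass_nonneg (fun i => (hu.1 i).1) a j), groupMass]
    split_ifs
    · have := (hu.1 j).2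
      gcongr
    · positivity
  have hx : ∀ i, i ≠ j → (D i).x = (D' i).x := fun i hi => by rw [hj i hi]
  have hδ : ∀ a, ‖kerEmb H (fun i => (D i).x) (groupMass D u a) -
      kerEmb H (fun i => (D' i).x) (groupMass D' u' a)‖ ≤ s * (4 * R / n) := by
    intro a
    refine (norm_kerEmb_sub_le hx hs0 hs hs' (q := fun i => |u i - u' i| / n)
      (fun i => by positivity) (fun i hi => ?_) (t := 2 * R / n) ?_).trans ?_
    · simp only [groupMass]
      rw [hj i hi]
      split_ifs
      · rw [← sub_div, abs_div, Nat.abs_cast]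
      · rw [sub_self, abs_zero]; positivity
    · have h1 := hgm hu a
      have h2 := hgm hu' a
      calc _ ≤ R / n + R / n := add_le_add h1 h2
        _ = _ := by ring
    · refine mul_le_mul_of_nonneg_left ?_ hs0
      rw [← Finset.sum_div, ← add_div]
      gcongr
      linarith
  have hδz : ‖kerEmb H (fun i => (D i).x) (fun _ => 1 / (n : ℝ)) -
      kerEmb H (fun i => (D' i).x) (fun _ => 1 / (n : ℝ))‖ ≤ s * (2 / n) := by
    refine (norm_kerEmb_sub_le hx hs0 hs hs' (q := fun _ => 0) (fun _ => le_rfl)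
      (fun i hi => by simp) (t := 2 / n) ?_).trans (by simp)
    rw [abs_of_nonneg (by positivity)]
    exact le_of_eq (by ring)
  have hz : ∀ {D : Fin n → Record X Y}, (∀ i, ‖kerVec H (D i).x‖ ≤ s) →
      ‖kerEmb H (fun i => (D i).x) (fun _ => 1 / (n : ℝ))‖ ≤ s := by
    intro D hs
    refine (norm_kerEmb_le hs _).trans (le_of_eq ?_)
    rw [Finset.sum_const, Finset.card_univ, Fintype.card_fin, nsmul_eq_mul,
      abs_of_nonneg (by positivity), mul_one_div_cancel hn'.ne', mul_one]
  have he : ∀ a, ‖kerEmb H (fun i => (D i).x) (groupMass D u a)‖ ≤ s := fun a =>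
    (norm_kerEmb_le hs _).trans (by rw [sum_abs_groupMass hn hu a, mul_one])
  have he' : ∀ a, ‖kerEmb H (fun i => (D' i).x) (groupMass D' u' a)‖ ≤ s := fun a =>
    (norm_kerEmb_le hs' _).trans (by rw [sum_abs_groupMass hn hu' a, mul_one])
  have hz₁ := hz hs
  have hz₂ := hz hs'
  have hδ₀ := hδ 0
  have hδ₁ := hδ 1
  have he₀ := he 0
  have he₁ := he 1
  have he₀' := he' 0
  have he₁' := he' 1
  simp only [mmdObjective, mmd_eq_norm]
  set x₀ := kerEmb H (fun i => (D i).x) (groupMass D u 0)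
  set x₁ := kerEmb H (fun i => (D i).x) (groupMass D u 1)
  set y₀ := kerEmb H (fun i => (D' i).x) (groupMass D' u' 0)
  set y₁ := kerEmb H (fun i => (D' i).x) (groupMass D' u' 1)
  set z := kerEmb H (fun i => (D i).x) fun _ => 1 / (n : ℝ)
  set z' := kerEmb H (fun i => (D' i).x) fun _ => 1 / (n : ℝ)
  set δ := s * ((8 * R + 2) / n) with hδdef
  have hpair : ∀ {p q p' q' : H}, ‖p‖ ≤ s → ‖q‖ ≤ s → ‖p'‖ ≤ s → ‖q'‖ ≤ s →
      ‖p - p'‖ + ‖q - q'‖ ≤ δ → |‖p - q‖ ^ 2 - ‖p' - q'‖ ^ 2| ≤ 4 * s * δ := by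
    intro p q p' q' hp hq hp' hq' h
    have h1 : ‖(p - q) - (p' - q')‖ ≤ δ := by
      rw [show (p - q) - (p' - q') = (p - p') - (q - q') by abel]
      exact (norm_sub_le _ _).trans h
    have h2 := abs_norm_sq_sub_le ((norm_sub_le p q).trans (add_le_add hp hq))
      ((norm_sub_le p' q').trans (add_le_add hp' hq')) h1
    linarith
  have hδ1 : s * (4 * R / n) + s * (2 / n) ≤ δ := by
    rw [hδdef, ← mul_add, ← add_div]
    exact mul_le_mul_of_nonneg_left (div_le_div_of_nonneg_right (by linarith) hn'.le) hs0
  have hδ2 : s * (4 * R / n) + s * (4 * R / n) ≤ δ := by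
    rw [hδdef, ← mul_add, ← add_div]
    exact mul_le_mul_of_nonneg_left (div_le_div_of_nonneg_right (by linarith) hn'.le) hs0
  have p1 := abs_le.1 (hpair he₀ hz₁ he₀' hz₂ (by linarith))
  have p2 := abs_le.1 (hpair he₁ hz₁ he₁' hz₂ (by linarith))
  have p3 := abs_le.1 (hpair he₀ he₁ he₀' he₁' (by linarith))
  have p4 : |∑ i, u i ^ 2 - ∑ i, u' i ^ 2| ≤ 4 * R ^ 2 := by
    rw [← Finset.sum_sub_distrib]
    refine (Finset.abs_sum_le_sum_abs _ _).trans ?_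
    calc ∑ i, |u i ^ 2 - u' i ^ 2| ≤ ∑ i, 2 * R * |u i - u' i| := by
          refine Finset.sum_le_sum fun i _ => ?_
          rw [sq_sub_sq, abs_mul]
          refine mul_le_mul_of_nonneg_right ?_ (abs_nonneg _)
          have h1 := hu.1 i
          have h2 := hu'.1 i
          rw [abs_of_nonneg (by linarith [h1.1, h2.1])]
          linarith [h1.2, h2.2]
      _ ≤ 2 * R * (2 * R) := by rw [← Finset.mul_sum]; gcongr
      _ = _ := by ring
  have hE : 0 ≤ 4 * s * δ := by positivity
  have hEeq : 12 * s ^ 2 * (8 * R + 2) / n = 3 * (4 * s * δ) := by rw [hδdef]; ring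
  have q1 := abs_le.1 p4
  have hα1' : 0 ≤ 1 - α := by linarith
  have m1 := mul_le_mul_of_nonneg_left p1.1 hα
  have m2 := mul_le_mul_of_nonneg_left p1.2 hα
  have m3 := mul_le_mul_of_nonneg_left p2.1 hα
  have m4 := mul_le_mul_of_nonneg_left p2.2 hα
  have m5 := mul_le_mul_of_nonneg_left p3.1 hα1'
  have m6 := mul_le_mul_of_nonneg_left p3.2 hα1'
  have m7 := mul_le_mul_of_nonneg_left q1.1 hκ
  have m8 := mul_le_mul_of_nonneg_left q1.2 hκ
  have m9 := mul_le_mul_of_nonneg_right hα1 hE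
  rw [hEeq, abs_le]
  constructor <;> linarith

/-- Stability of the minimizers of the MMD balancing objective. -/
lemma sum_sq_mmd_sub_le {R α κ s : ℝ} (hα : 0 ≤ α) (hα1 : α ≤ 1) (hκ : 0 < κ)
    {D D' : Fin n → Record X Y} (hDD' : Neighbors D D') (hs0 : 0 ≤ s)
    (hs : ∀ i, ‖kerVec H (D i).x‖ ≤ s) (hs' : ∀ i, ‖kerVec H (D' i).x‖ ≤ s)
    {u u' : Fin n → ℝ} (hu : u ∈ mmdFeasible R D) (hu' : u' ∈ mmdFeasible R D')
    (hmin : IsMinOn (mmdObjective H α κ D) (mmdFeasible R D) u)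
    (hmin' : IsMinOn (mmdObjective H α κ D') (mmdFeasible R D') u') :
    ∑ i, (u i - u' i) ^ 2 ≤ 96 * s ^ 2 * (8 * R + 2) / (n * κ) + 36 * R ^ 2 := by
  have hDD'' : Neighbors D' D := by
    obtain ⟨j, hj⟩ := hDD'
    exact ⟨j, fun i hi => (hj i hi).symm⟩
  obtain ⟨j, -⟩ := id hDD'
  have hn' : (0 : ℝ) < n := by exact_mod_cast Fin.pos j
  have hR : 0 ≤ R := (hu.1 j).1.trans (hu.1 j).2
  -- The feasible sets differ, so u is compared with a neighbour v of u' that is feasible for `D`,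
  -- and u' with a neighbour v' of u that is feasible for `D'`.
  obtain ⟨v, hv, hvu⟩ := exists_mmdFeasible_near hDD' ⟨u, hu⟩ hu'
  obtain ⟨v', hv', hvu'⟩ := exists_mmdFeasible_near hDD'' ⟨u', hu'⟩ hu
  have e1 := (abs_le.1 (abs_mmdObjective_sub_le hα hα1 hκ.le hDD' hs0 hs hs' hv hu' hvu)).2
  have e2 := (abs_le.1 (abs_mmdObjective_sub_le hα hα1 hκ.le hDD'' hs0 hs' hs hv' hu hvu')).2
  have e3 : mmdObjective H α κ D' u' ≤ mmdObjective H α κ D' v' := hmin' hv'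
  have hmid : (fun i => (u i + v i) / 2) ∈ mmdFeasible R D := by
    refine ⟨fun i => ⟨by linarith [(hu.1 i).1, (hv.1 i).1], by linarith [(hu.1 i).2, (hv.1 i).2]⟩,
      fun a => ?_⟩
    have h1 := hu.2 a
    have h2 := hv.2 a
    have h3 : ∀ i, (if (D i).a = a then (u i + v i) / 2 else 0) =
        ((if (D i).a = a then u i else 0) + if (D i).a = a then v i else 0) / 2 := fun i => by
      split_ifs <;> ring
    simp_rw [h3]
    rw [← Finset.sum_div, Finset.sum_add_distrib, h1, h2]
    ring
  have e4 : mmdObjective H α κ D u ≤ mmdObjective H α κ D fun i => (u i + v i) / 2 := hmin hmid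
  have e5 := mmdObjective_midpoint (H := H) (κ := κ) hα hα1 D u v
  have e6 : κ / 2 * ∑ i, (u i - v i) ^ 2 ≤
      2 * (12 * s ^ 2 * (8 * R + 2) / n + 4 * κ * R ^ 2) := by linarith
  have e7 : ∑ i, (u i - v i) ^ 2 ≤ 48 * s ^ 2 * (8 * R + 2) / (n * κ) + 16 * R ^ 2 := by
    refine le_of_mul_le_mul_left (e6.trans (le_of_eq ?_)) (half_pos hκ)
    field_simp
    ring
  have e8 : ∑ i, (v i - u' i) ^ 2 ≤ 2 * R ^ 2 := by
    calc ∑ i, (v i - u' i) ^ 2 ≤ ∑ i, R * |v i - u' i| := by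
          refine Finset.sum_le_sum fun i _ => ?_
          rw [← sq_abs, pow_two]
          refine mul_le_mul_of_nonneg_right (abs_sub_le_iff.2 ⟨?_, ?_⟩) (abs_nonneg _)
          · linarith [(hv.1 i).2, (hu'.1 i).1]
          · linarith [(hv.1 i).1, (hu'.1 i).2]
      _ ≤ R * (2 * R) := by rw [← Finset.mul_sum]; gcongr
      _ = _ := by ring
  calc ∑ i, (u i - u' i) ^ 2 ≤ ∑ i, (2 * (u i - v i) ^ 2 + 2 * (v i - u' i) ^ 2) := by
        refine Finset.sum_le_sum fun i _ => ?_
        nlinarith [sq_nonneg ((u i - v i) - (v i - u' i))]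
    _ = 2 * ∑ i, (u i - v i) ^ 2 + 2 * ∑ i, (v i - u' i) ^ 2 := by
        rw [Finset.sum_add_distrib, Finset.mul_sum, Finset.mul_sum]
    _ ≤ 2 * (48 * s ^ 2 * (8 * R + 2) / (n * κ) + 16 * R ^ 2) + 2 * (2 * R ^ 2) := by linarith
    _ = _ := by ring

end MMDStability

theorem exists_privacyGuarantee_mmd (ε₀ C R : ℝ) : ∃ c : ℝ, 0 < c ∧
    ∀ (X Y H : Type*) [NormedAddCommGroup H] [InnerProductSpace ℝ H] [CompleteSpace H]
      [RKHS ℝ H X ℝ] (𝒵 : Set (Record X Y)),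
      (∀ z ∈ 𝒵, ∀ z' ∈ 𝒵, RKHS.kernel H z.x z'.x 1 ≤ C) →
    ∀ α : ℝ, 0 ≤ α → α ≤ 1 → ∀ n : ℕ, 1 ≤ n → ∀ lamMMD : ℝ, 0 < lamMMD →
    ∀ κ : ℝ, (κ = lamMMD / n ^ 2 ∨ κ = lamMMD / 2) →
    ∀ w : (Fin n → Record X Y) → Fin n → ℝ,
      (∀ D ∈ mmdDatasets n 𝒵 R, IsMMDWeight H R α κ D (w D)) →
      PrivacyGuarantee ε₀ 𝒵 (mmdDatasets n 𝒵 R) w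
        (c * ((n : ℝ) ^ (3 / 2 : ℝ) / lamMMD + √(n : ℝ)))
        (c * ((n : ℝ) ^ (3 / 2 : ℝ) / lamMMD + √(n : ℝ))) := by
  set s := √C with hs
  set K := 48 * s ^ 2 * (8 * |R| + 2) + 9 * R ^ 2 with hK
  have hK0 : 0 ≤ K := by positivity
  refine ⟨2 * (8 + |ε₀|) * (√K + |R|) + √(K + 2 * |R| ^ 2) * √2 + 1, by positivity, ?_⟩
  intro X Y H _ _ _ _ 𝒵 hC α hα hα1 n hn lam hlam κ hκ w hw
  have hn1 : (1 : ℝ) ≤ n := by exact_mod_cast hn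
  have hn0 : (0 : ℝ) < n := by linarith
  -- Both rates equal √n ρ. The proof bounds ‖w − w'‖₂ by a constant times ρ.
  set ρ := n / lam + 1 with hρ
  have hρ1 : 1 ≤ ρ := by
    have : 0 ≤ n / lam := by positivity
    linarith
  have hr : (n : ℝ) ^ (3 / 2 : ℝ) / lam + √(n : ℝ) = √n * ρ := by
    have : (n : ℝ) ^ (3 / 2 : ℝ) = n * √n := by
      rw [Real.sqrt_eq_rpow, ← Real.rpow_one_add' hn0.le (by norm_num)]; norm_num
    rw [this, hρ]; ring
  have hκ0 : 0 < κ := by rcases hκ with rfl | rfl <;> positivity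
  -- The two normalizations meet here: 1/(nκ) is n/λ in the first case and 2/(nλ) ≤ 2n/λ in the
  -- second.
  have hκn : 1 / (n * κ) ≤ 2 * (n / lam) := by
    rcases hκ with rfl | rfl
    · have : 1 / (n * (lam / (n : ℝ) ^ 2)) = n / lam := by field_simp
      rw [this]
      have : 0 ≤ n / lam := by positivity
      linarith
    · rw [div_le_iff₀ (by positivity)]
      have : 2 * (n / lam) * (n * (lam / 2)) = n * n := by field_simp
      rw [this]
      nlinarith
  have h₂ : ∀ D ∈ mmdDatasets n 𝒵 R, ∀ D' ∈ mmdDatasets n 𝒵 R, Neighbors D D' →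
      ∑ i, (w D i - w D' i) ^ 2 ≤ K * ρ ^ 2 := by
    intro D hD D' hD' hnb
    obtain ⟨u, hu, hmin, hwD⟩ := hw D hD
    obtain ⟨u', hu', hmin', hwD'⟩ := hw D' hD'
    have hR : 0 ≤ R := (hu.1 ⟨0, hn⟩).1.trans (hu.1 ⟨0, hn⟩).2
    have hmain := sum_sq_mmd_sub_le hα hα1 hκ0 hnb (Real.sqrt_nonneg C)
      (fun i => norm_kerVec_le (hC _ (hD.1 i) _ (hD.1 i)))
      (fun i => norm_kerVec_le (hC _ (hD'.1 i) _ (hD'.1 i))) hu hu' hmin hmin'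
    have h1 : ∑ i, (w D i - w D' i) ^ 2 = (∑ i, (u i - u' i) ^ 2) / 4 := by
      rw [hwD, hwD', Finset.sum_div]
      exact Finset.sum_congr rfl fun i _ => by ring
    rw [h1, hK, abs_of_nonneg hR]
    rw [← hs, div_eq_mul_one_div _ (n * κ)] at hmain
    have h2 : 96 * s ^ 2 * (8 * R + 2) * (1 / (n * κ)) ≤
        96 * s ^ 2 * (8 * R + 2) * (2 * (n / lam)) := by gcongr
    have h3 : ρ ≤ ρ ^ 2 := by nlinarith
    have h4 : n / lam = ρ - 1 := by rw [hρ]; ring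
    rw [h4] at h2
    have h5 : 0 ≤ 48 * s ^ 2 * (8 * R + 2) := by positivity
    have h6 := mul_le_mul_of_nonneg_left h3 h5
    have h7 : 9 * R ^ 2 * 1 ≤ 9 * R ^ 2 * ρ ^ 2 := by
      gcongr
      linarith
    linarith
  rw [hr]
  have hsn : 1 ≤ √(n : ℝ) := Real.one_le_sqrt.2 hn1
  have hr1 : 1 ≤ √n * ρ := one_le_mul_of_one_le_of_one_le hsn hρ1
  refine privacyGuarantee_of_rates hn (fun D hD => hD.1) (fun D hD i => ?_) (fun D hD i => ?_)
    (fun D hD D' hD' h => ?_) h₂ (Real.sqrt_nonneg _) (abs_nonneg R) (by positivity) hr1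
    (by linarith) ?_
  · obtain ⟨u, hu, -, hwD⟩ := hw D hD
    rw [hwD]; exact div_nonneg (hu.1 i).1 two_pos.le
  · obtain ⟨u, hu, -, hwD⟩ := hw D hD
    rw [hwD]
    have := hu.1 i
    have := le_abs_self R
    change u i / 2 ≤ |R|
    linarith
  · refine (sum_abs_le_sqrt_mul_sqrt (fun i => w D i - w D' i) (h₂ D hD D' hD' h)).trans ?_
    rw [Real.sqrt_mul hK0, Real.sqrt_sq (by linarith)]
    exact le_of_eq (by ring)
  · have h1 : K * ρ ^ 2 + 2 * |R| ^ 2 ≤ (K + 2 * |R| ^ 2) * ρ ^ 2 := by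
      have : 2 * |R| ^ 2 * 1 ≤ 2 * |R| ^ 2 * ρ ^ 2 := by
        gcongr
        nlinarith
      linarith
    calc _ ≤ √((K + 2 * |R| ^ 2) * ρ ^ 2) * √(2 * n) := by gcongr
      _ = _ := by
        rw [Real.sqrt_mul (by positivity), Real.sqrt_sq (by linarith), Real.sqrt_mul two_pos.le]
        ring

/-! ### Hellinger distance and midpoint gaps of log-sums. -/

section Hellinger

variable {n : ℕ}

lemma normalized_const_mul {c : ℝ} (hc : c ≠ 0) (v : Fin n → ℝ) :
    normalized (fun i => c * v i) = normalized v := by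
  funext i
  rw [normalized, normalized, ← Finset.mul_sum]
  rcases eq_or_ne (∑ j, v j) 0 with h | h
  · simp [h]
  · field_simp

/-- The squared Hellinger distance of the normalized vectors controls the squared Euclidean
distance. -/
lemma sum_sq_normalized_sq_sub_le {x y : Fin n → ℝ} (hx : ∀ i, 0 < x i) (hy : ∀ i, 0 < y i)
    {Bw : ℝ} (hxB : ∀ i, normalized (fun i => x i ^ 2) i ≤ Bw)
    (hyB : ∀ i, normalized (fun i => y i ^ 2) i ≤ Bw) :
    ∑ i, (normalized (fun i => x i ^ 2) i - normalized (fun i => y i ^ 2) i) ^ 2 ≤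
      4 * Bw * n * (Real.log (∑ i, x i ^ 2) + Real.log (∑ i, y i ^ 2) -
        2 * Real.log (∑ i, x i * y i)) := by
  rcases Nat.eq_zero_or_pos n with rfl | hn
  · simp
  have hn' : (0 : ℝ) < n := by exact_mod_cast hn
  have hne : (Finset.univ : Finset (Fin n)).Nonempty := ⟨⟨0, hn⟩, Finset.mem_univ _⟩
  set S := ∑ i, x i ^ 2 with hS
  set S' := ∑ i, y i ^ 2 with hS'
  set U := ∑ i, x i * y i with hU
  have hS0 : 0 < S := Finset.sum_pos (fun i _ => pow_pos (hx i) 2) hne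
  have hS0' : 0 < S' := Finset.sum_pos (fun i _ => pow_pos (hy i) 2) hne
  have hU0 : 0 < U := Finset.sum_pos (fun i _ => mul_pos (hx i) (hy i)) hne
  set a := √S with ha
  set a' := √S' with ha'
  have ha0 : 0 < a := Real.sqrt_pos.2 hS0
  have ha0' : 0 < a' := Real.sqrt_pos.2 hS0'
  have hsq : a ^ 2 = S := Real.sq_sqrt hS0.le
  have hsq' : a' ^ 2 = S' := Real.sq_sqrt hS0'.le
  have hB0 : 0 ≤ Bw := (normalized_nonneg (fun i => sq_nonneg (x i)) ⟨0, hn⟩).trans (hxB _)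
  have hhell : ∑ i, (x i / a - y i / a') ^ 2 = 2 - 2 * (U / (a * a')) := by
    have h1 : ∀ i, (x i / a - y i / a') ^ 2 =
        x i ^ 2 / a ^ 2 + y i ^ 2 / a' ^ 2 - 2 * (x i * y i / (a * a')) := fun i => by
      field_simp; ring
    simp_rw [h1]
    rw [Finset.sum_sub_distrib, Finset.sum_add_distrib, ← Finset.mul_sum, ← Finset.sum_div,
      ← Finset.sum_div, ← Finset.sum_div, ← hS, ← hS', ← hU, hsq, hsq', div_self hS0.ne',
      div_self hS0'.ne']
    ring
  -- U/(a a') is the Bhattacharyya coefficient of the two normalized vectors and the right side is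
  -- −2 times its logarithm, so log z ≤ z − 1 suffices.
  have hlog : 2 - 2 * (U / (a * a')) ≤ Real.log S + Real.log S' - 2 * Real.log U := by
    have h1 := Real.log_le_sub_one_of_pos (x := U / (a * a')) (by positivity)
    rw [Real.log_div hU0.ne' (by positivity), Real.log_mul ha0.ne' ha0'.ne'] at h1
    rw [← hsq, ← hsq', Real.log_pow, Real.log_pow]
    push_cast
    linarith
  have hnx : ∀ i, normalized (fun i => x i ^ 2) i = n * (x i / a) ^ 2 := fun i => by
    rw [normalized, ← hS, div_pow, hsq, mul_div_assoc]
  have hny : ∀ i, normalized (fun i => y i ^ 2) i = n * (y i / a') ^ 2 := fun i => by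
    rw [normalized, ← hS', div_pow, hsq', mul_div_assoc]
  refine le_trans (Finset.sum_le_sum (g := fun i => 4 * Bw * n * (x i / a - y i / a') ^ 2)
    fun i _ => ?_) ?_
  · have h1 := hxB i
    have h2 := hyB i
    rw [hnx] at h1 ⊢
    rw [hny] at h2 ⊢
    set X := x i / a
    set W := y i / a'
    have h3 : n * (X + W) ^ 2 ≤ 4 * Bw := by nlinarith [sq_nonneg (X - W)]
    calc (n * X ^ 2 - n * W ^ 2) ^ 2 = n * (X + W) ^ 2 * (n * (X - W) ^ 2) := by ring
      _ ≤ 4 * Bw * (n * (X - W) ^ 2) := by gcongr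
      _ = _ := by ring
  · rw [← Finset.mul_sum, hhell]
    exact mul_le_mul_of_nonneg_left hlog (by positivity)

lemma abs_exp_sub_exp_le {T x y : ℝ} (hx : x ≤ T) (hy : y ≤ T) :
    |Real.exp x - Real.exp y| ≤ Real.exp T * |x - y| := by
  have key : ∀ {x y : ℝ}, x ≤ T → y ≤ x → Real.exp x - Real.exp y ≤ Real.exp T * (x - y) := by
    intro x y hx hxy
    have h1 := Real.add_one_le_exp (y - x)
    have h2 : Real.exp y = Real.exp x * Real.exp (y - x) := by rw [← Real.exp_add]; congr 1; ring
    rw [h2]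
    have h3 := mul_le_mul_of_nonneg_left h1 (Real.exp_pos x).le
    have h4 := mul_le_mul_of_nonneg_right (Real.exp_le_exp.2 hx) (sub_nonneg.2 hxy)
    linarith
  rcases le_total y x with h | h
  · rw [abs_of_nonneg (sub_nonneg.2 (Real.exp_le_exp.2 h)), abs_of_nonneg (sub_nonneg.2 h)]
    exact key hx h
  · rw [abs_sub_comm, abs_sub_comm x,
      abs_of_nonneg (sub_nonneg.2 (Real.exp_le_exp.2 h)), abs_of_nonneg (sub_nonneg.2 h)]
    exact key hy h

end Hellinger

/-! ### Treatment group sizes. -/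

section GroupSize

variable {n : ℕ} {X Y : Type*}

lemma groupSize_eq_sum (D : Fin n → Record X Y) (a : Fin 2) :
    (groupSize D a : ℝ) = ∑ i, if (D i).a = a then (1 : ℝ) else 0 := by
  simp [groupSize]

lemma abs_groupSize_sub_le {D D' : Fin n → Record X Y} (hDD' : Neighbors D D') (a : Fin 2) :
    |(groupSize D a : ℝ) - groupSize D' a| ≤ 1 := by
  obtain ⟨j, hj⟩ := hDD'
  rw [groupSize_eq_sum, groupSize_eq_sum, ← Finset.sum_sub_distrib,
    Finset.sum_eq_single j (fun i _ hi => by rw [hj i hi, sub_self]) (by simp)]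
  split_ifs <;> simp

lemma groupSize_le (D : Fin n → Record X Y) (a : Fin 2) : groupSize D a ≤ n := by
  simpa [groupSize] using
    Finset.card_filter_le (Finset.univ : Finset (Fin n)) (fun i => (D i).a = a)

/-- Each of the two groups contributes 1. Changing one treatment perturbs every exponent in a group
relatively by at most 1/n_a, and this identity makes the total effect bounded. -/
lemma sum_inv_groupSize {D : Fin n → Record X Y} (hD : ∀ a, 0 < groupSize D a) :
    ∑ i, (1 / groupSize D (D i).a : ℝ) = 2 := by
  have h1 : ∀ i, (1 / groupSize D (D i).a : ℝ) =
      ∑ a, if (D i).a = a then (1 / groupSize D a : ℝ) else 0 := fun i => by simp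
  simp_rw [h1]
  rw [Finset.sum_comm]
  have h2 : ∀ a : Fin 2, ∑ i, (if (D i).a = a then (1 / groupSize D a : ℝ) else 0) = 1 := by
    intro a
    have h3 : (groupSize D a : ℝ) ≠ 0 := by exact_mod_cast (hD a).ne'
    have h4 : ∀ i, (if (D i).a = a then (1 / groupSize D a : ℝ) else 0) =
        (if (D i).a = a then (1 : ℝ) else 0) * (1 / groupSize D a) := fun i => by
      split_ifs <;> simp
    simp_rw [h4]
    rw [← Finset.sum_mul, ← groupSize_eq_sum, mul_one_div_cancel h3]
  rw [Finset.sum_congr rfl fun a _ => h2 a]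
  simp

end GroupSize

/-! ### Entropy balancing: stability of the tilted weights. -/

section EBW

variable {n K : ℕ} {X Y : Type*} {𝒵 : Set (Record X Y)} {g : X → Euc (K + 1)} {B R T : ℝ}
  {q : Fin n → ℝ} {D D' : Fin n → Record X Y} {lam lam' : Fin 2 → Euc (K + 1)}

/-- The exponent of the entropy balancing tilt. -/
def ebwExponent (g : X → Euc (K + 1)) (D : Fin n → Record X Y) (lam : Fin 2 → Euc (K + 1))
    (i : Fin n) : ℝ :=
  (n : ℝ) / groupSize D (D i).a * inner ℝ (lam (D i).a) (g (D i).x)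

lemma norm_le_of_mem_ebwBox (h : lam ∈ ebwBox K R) (a : Fin 2) :
    ‖lam a‖ ≤ √(K + 1 : ℝ) * |R| := by
  rw [EuclideanSpace.norm_eq, ← Real.sqrt_sq (abs_nonneg R), ← Real.sqrt_mul (by positivity)]
  refine Real.sqrt_le_sqrt ?_
  calc ∑ i, ‖lam a i‖ ^ 2 ≤ ∑ _i : Fin (K + 1), |R| ^ 2 := by
        refine Finset.sum_le_sum fun i _ => pow_le_pow_left₀ (norm_nonneg _) ?_ 2
        exact (h a i).trans (le_abs_self R)
    _ = _ := by simp

lemma abs_ebwExponent_le (hD : D ∈ ebwDatasets n 𝒵 g B) (h : lam ∈ ebwBox K R) (i : Fin n) :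
    |ebwExponent g D lam i| ≤ √(K + 1 : ℝ) * |R| * |B| := by
  rw [ebwExponent, abs_mul, abs_of_nonneg (by positivity)]
  calc (n : ℝ) / groupSize D (D i).a * |inner ℝ (lam (D i).a) (g (D i).x)|
      ≤ (n : ℝ) / groupSize D (D i).a * (‖lam (D i).a‖ * ‖g (D i).x‖) := by
        gcongr; exact abs_real_inner_le_norm _ _
    _ = ‖lam (D i).a‖ * ((n : ℝ) / groupSize D (D i).a * ‖g (D i).x‖) := by ring
    _ ≤ _ := mul_le_mul (norm_le_of_mem_ebwBox h _) ((hD.2.2 i).trans (le_abs_self B))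
        (by positivity) (by positivity)

lemma norm_moment_le (hD : D ∈ ebwDatasets n 𝒵 g B) (i : Fin n) : ‖g (D i).x‖ ≤ |B| := by
  refine le_trans ?_ ((hD.2.2 i).trans (le_abs_self B))
  refine le_mul_of_one_le_left (norm_nonneg _) ?_
  rw [one_le_div (by exact_mod_cast hD.2.1 _)]
  exact_mod_cast groupSize_le D _

/-- The exponents are linear in the dual variables, so the tilt at a midpoint is a geometric mean.
This turns the midpoint gap of the log-partition function into a Bhattacharyya coefficient. -/
lemma ebwTilt_midpoint (hq : ∀ i, 0 < q i) (i : Fin n) :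
    ebwTilt g q D (fun a => (1 / 2 : ℝ) • (lam a + lam' a)) i =
      √(ebwTilt g q D lam i) * √(ebwTilt g q D lam' i) := by
  have h1 : ebwExponent g D (fun a => (1 / 2 : ℝ) • (lam a + lam' a)) i =
      ebwExponent g D lam i / 2 + ebwExponent g D lam' i / 2 := by
    simp only [ebwExponent, real_inner_smul_left, inner_add_left]; ring
  change q i * Real.exp (ebwExponent g D (fun a => (1 / 2 : ℝ) • (lam a + lam' a)) i) =
    √(q i * Real.exp (ebwExponent g D lam i)) * √(q i * Real.exp (ebwExponent g D lam' i))
  rw [h1, Real.exp_add, Real.sqrt_mul (hq i).le, Real.sqrt_mul (hq i).le, ← Real.exp_half,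
    ← Real.exp_half]
  calc _ = (√(q i) * √(q i)) * (Real.exp (ebwExponent g D lam i / 2) *
        Real.exp (ebwExponent g D lam' i / 2)) := by rw [Real.mul_self_sqrt (hq i).le]
    _ = _ := by ring

lemma ebwDual_midpoint {ρ : ℝ} (hρ : 0 ≤ ρ) (hq : ∀ i, 0 < q i) :
    Real.log (∑ i, ebwTilt g q D lam i) + Real.log (∑ i, ebwTilt g q D lam' i) -
        2 * Real.log (∑ i, √(ebwTilt g q D lam i) * √(ebwTilt g q D lam' i)) ≤
      ebwDual g q ρ D lam + ebwDual g q ρ D lam' -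
        2 * ebwDual g q ρ D (fun a => (1 / 2 : ℝ) • (lam a + lam' a)) := by
  have h0 := mul_le_mul_of_nonneg_left (norm_midpoint_sq_le (lam 0) (lam' 0))
    (by positivity : 0 ≤ ρ / 2)
  have h1 := mul_le_mul_of_nonneg_left (norm_midpoint_sq_le (lam 1) (lam' 1))
    (by positivity : 0 ≤ ρ / 2)
  simp only [ebwDual, ebwTilt_midpoint hq]
  set G := (1 / (n : ℝ)) • ∑ i, g (D i).x
  have h2 : inner ℝ ((1 / 2 : ℝ) • (lam 0 + lam' 0) + (1 / 2 : ℝ) • (lam 1 + lam' 1)) G =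
      (inner ℝ (lam 0 + lam 1) G + inner ℝ (lam' 0 + lam' 1) G) / 2 := by
    simp only [inner_add_left, real_inner_smul_left]; ring
  rw [h2]
  linarith

/-- The score vector `n t_i`, which has dimension-free bounds. -/
lemma ebwScore_bounds {r : ℝ} (hq : ∀ i, 0 < q i) (hq1 : ∑ i, q i = 1)
    (hqr : ∀ i j, q i ≤ r * q j) (hT : ∀ i, |ebwExponent g D lam i| ≤ T) (i : Fin n) :
    Real.exp (-T) / (|r| + 1) ≤ n * ebwTilt g q D lam i ∧
      n * ebwTilt g q D lam i ≤ (|r| + 1) * Real.exp T := by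
  have hr : 0 < |r| + 1 := by positivity
  have hqr' : ∀ i j, q i ≤ (|r| + 1) * q j := fun i j =>
    (hqr i j).trans (mul_le_mul_of_nonneg_right (by linarith [le_abs_self r]) (hq j).le)
  -- Summing q_i ≤ (|r| + 1) q_j over either index and using ∑ q = 1 shows that q_i is comparable to
  -- 1/n.
  have h1 : n * q i ≤ |r| + 1 := by
    have := Finset.sum_le_sum fun j (_ : j ∈ Finset.univ) => hqr' i j
    rw [← Finset.mul_sum, hq1] at this
    simpa using this
  have h2 : 1 / (|r| + 1) ≤ n * q i := by
    have := Finset.sum_le_sum fun j (_ : j ∈ Finset.univ) => hqr' j i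
    rw [hq1] at this
    rw [div_le_iff₀ hr]
    simp only [Finset.sum_const, Finset.card_univ, Fintype.card_fin, nsmul_eq_mul] at this
    linarith
  have h3 := abs_le.1 (hT i)
  have h4 : n * ebwTilt g q D lam i = n * q i * Real.exp (ebwExponent g D lam i) := by
    rw [ebwTilt, ebwExponent, mul_assoc]
  rw [h4]
  constructor
  · calc Real.exp (-T) / (|r| + 1) = 1 / (|r| + 1) * Real.exp (-T) := by ring
      _ ≤ _ := mul_le_mul h2 (Real.exp_le_exp.2 h3.1) (Real.exp_pos _).le
          (mul_nonneg (Nat.cast_nonneg n) (hq i).le)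
  · exact mul_le_mul h1 (Real.exp_le_exp.2 h3.2) (Real.exp_pos _).le hr.le

lemma abs_ebwExponent_sub_le (hD : ∀ a, 0 < groupSize D a) (hD' : ∀ a, 0 < groupSize D' a)
    (hDD' : Neighbors D D') {i : Fin n} (hi : D i = D' i) (hT : |ebwExponent g D lam i| ≤ T) :
    |ebwExponent g D lam i - ebwExponent g D' lam i| ≤ T * (1 / groupSize D' (D' i).a) := by
  have hm : (0 : ℝ) < groupSize D (D' i).a := by exact_mod_cast hD _
  have hm' : (0 : ℝ) < groupSize D' (D' i).a := by exact_mod_cast hD' _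
  have h1 : ebwExponent g D lam i - ebwExponent g D' lam i =
      ebwExponent g D lam i * (((groupSize D' (D' i).a : ℝ) - groupSize D (D' i).a) /
        groupSize D' (D' i).a) := by
    simp only [ebwExponent, hi]
    field_simp
  rw [h1, abs_mul, abs_div, abs_of_pos hm']
  have h2 := abs_groupSize_sub_le hDD' (D' i).a
  rw [abs_sub_comm] at h2
  exact mul_le_mul hT (by gcongr) (by positivity) ((abs_nonneg _).trans hT)

/-- Sensitivity of the scores `n t_i` to a change of one data point, at fixed dual variables. -/
lemma sum_abs_ebwScore_sub_le {r : ℝ} (hq : ∀ i, 0 < q i) (hq1 : ∑ i, q i = 1)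
    (hqr : ∀ i j, q i ≤ r * q j) (hD : ∀ a, 0 < groupSize D a) (hD' : ∀ a, 0 < groupSize D' a)
    (hDD' : Neighbors D D') (hT0 : 0 ≤ T) (hT : ∀ i, |ebwExponent g D lam i| ≤ T)
    (hT' : ∀ i, |ebwExponent g D' lam i| ≤ T) :
    ∑ i, |n * ebwTilt g q D lam i - n * ebwTilt g q D' lam i| ≤
      (|r| + 1) * Real.exp T * (2 * T + 1) := by
  obtain ⟨j, hj⟩ := id hDD'
  have hb : 0 ≤ (|r| + 1) * Real.exp T := by positivity
  refine (sum_le_sum_add_of_ne _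
    (fun i => (|r| + 1) * Real.exp T * (T * (1 / groupSize D' (D' i).a))) j
    (fun i => by positivity) (fun i hi => ?_) (c := (|r| + 1) * Real.exp T) ?_).trans
    (le_of_eq ?_)
  · have h1 : n * q i ≤ |r| + 1 := by
      -- With the zero moment map the tilt is q_i itself, so the score bound with T = 0 reads n q_i
      -- ≤ |r| + 1.
      have := (ebwScore_bounds (T := 0) (g := fun _ : X => (0 : Euc (K + 1))) (D := D)
        (lam := lam) hq hq1 hqr (fun i => by simp [ebwExponent]) i).2
      simpa [ebwTilt] using this
    have h2 : n * ebwTilt g q D lam i - n * ebwTilt g q D' lam i =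
        n * q i * (Real.exp (ebwExponent g D lam i) - Real.exp (ebwExponent g D' lam i)) := by
      simp only [ebwTilt, ebwExponent]; ring
    have h3 := abs_exp_sub_exp_le (abs_le.1 (hT i)).2 (abs_le.1 (hT' i)).2
    have h4 := abs_ebwExponent_sub_le hD hD' hDD' (hj i hi) (hT i)
    rw [h2, abs_mul, abs_of_nonneg (mul_nonneg (Nat.cast_nonneg n) (hq i).le)]
    calc _ ≤ (|r| + 1) * (Real.exp T * (T * (1 / groupSize D' (D' i).a))) :=
          mul_le_mul h1 (h3.trans (mul_le_mul_of_nonneg_left h4 (Real.exp_pos T).le))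
            (abs_nonneg _) (by positivity)
      _ = _ := by ring
  · have h1 := ebwScore_bounds hq hq1 hqr hT j
    have h2 := ebwScore_bounds hq hq1 hqr hT' j
    have h3 : 0 ≤ Real.exp (-T) / (|r| + 1) := by positivity
    exact abs_sub_le_iff.2 ⟨by linarith [h1.2, h2.1], by linarith [h1.1, h2.2]⟩
  · rw [← Finset.mul_sum, ← Finset.mul_sum, sum_inv_groupSize hD']; ring

lemma abs_log_sub_log_le {a x y : ℝ} (ha : 0 < a) (hx : a ≤ x) (hy : a ≤ y) :
    |Real.log x - Real.log y| ≤ |x - y| / a := by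
  have key : ∀ {x y : ℝ}, a ≤ x → a ≤ y → Real.log x - Real.log y ≤ |x - y| / a := by
    intro x y hx hy
    have hx0 := ha.trans_le hx
    have hy0 := ha.trans_le hy
    have h1 := Real.log_le_sub_one_of_pos (x := x / y) (by positivity)
    rw [Real.log_div hx0.ne' hy0.ne'] at h1
    calc _ ≤ x / y - 1 := h1
      _ = (x - y) / y := by field_simp
      _ ≤ |x - y| / y := by gcongr; exact le_abs_self _
      _ ≤ _ := by gcongr
  refine abs_le.2 ⟨?_, key hx hy⟩
  have := key hy hx
  rw [abs_sub_comm] at this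
  linarith

/-- Sensitivity of the dual objective to a change of one data point. -/
lemma abs_ebwDual_sub_le {r ρ P b : ℝ} (hq : ∀ i, 0 < q i) (hq1 : ∑ i, q i = 1)
    (hqr : ∀ i j, q i ≤ r * q j) (hD : ∀ a, 0 < groupSize D a) (hD' : ∀ a, 0 < groupSize D' a)
    (hDD' : Neighbors D D') (hT0 : 0 ≤ T) (hT : ∀ i, |ebwExponent g D lam i| ≤ T)
    (hT' : ∀ i, |ebwExponent g D' lam i| ≤ T) (hP : ∀ a, ‖lam a‖ ≤ P)
    (hb : ∀ i, ‖g (D i).x‖ ≤ b) (hb' : ∀ i, ‖g (D' i).x‖ ≤ b) :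
    |ebwDual g q ρ D lam - ebwDual g q ρ D' lam| ≤
      ((|r| + 1) * Real.exp T * (2 * T + 1) / (Real.exp (-T) / (|r| + 1)) + 4 * P * b) / n := by
  have hsum := sum_abs_ebwScore_sub_le hq hq1 hqr hD hD' hDD' hT0 hT hT'
  obtain ⟨j, hj⟩ := hDD'
  have hn' : (0 : ℝ) < n := by exact_mod_cast Fin.pos j
  set F := (|r| + 1) * Real.exp T * (2 * T + 1)
  set a := Real.exp (-T) / (|r| + 1) with ha
  have ha0 : 0 < a := by positivity
  have hS : ∀ {D : Fin n → Record X Y}, (∀ i, |ebwExponent g D lam i| ≤ T) →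
      a ≤ ∑ i, ebwTilt g q D lam i := by
    intro D hT
    have h := le_sum_of_le fun i => (ebwScore_bounds hq hq1 hqr hT i).1
    rw [← Finset.mul_sum] at h
    exact le_of_mul_le_mul_left h hn'
  have h1 : |Real.log (∑ i, ebwTilt g q D lam i) - Real.log (∑ i, ebwTilt g q D' lam i)| ≤
      F / a / n := by
    refine (abs_log_sub_log_le ha0 (hS hT) (hS hT')).trans ?_
    have h2 : n * |∑ i, ebwTilt g q D lam i - ∑ i, ebwTilt g q D' lam i| ≤ F := by
      refine le_trans ?_ hsum
      rw [← Finset.sum_sub_distrib]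
      calc _ ≤ n * ∑ i, |ebwTilt g q D lam i - ebwTilt g q D' lam i| := by
            gcongr; exact Finset.abs_sum_le_sum_abs _ _
        _ = _ := by
            rw [Finset.mul_sum]
            refine Finset.sum_congr rfl fun i _ => ?_
            rw [← mul_sub, abs_mul, abs_of_pos hn']
    rw [div_right_comm]
    gcongr
    rw [le_div_iff₀ hn', mul_comm]
    exact h2
  have h2 : |inner ℝ (lam 0 + lam 1) ((1 / (n : ℝ)) • ∑ i, g (D i).x) -
      inner ℝ (lam 0 + lam 1) ((1 / (n : ℝ)) • ∑ i, g (D' i).x)| ≤ 4 * P * b / n := by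
    have h3 : ∑ i, g (D i).x - ∑ i, g (D' i).x = g (D j).x - g (D' j).x := by
      rw [← Finset.sum_sub_distrib]
      exact Finset.sum_eq_single j (fun i _ hi => by rw [hj i hi, sub_self]) (by simp)
    rw [← inner_sub_right, ← smul_sub, h3, real_inner_smul_right, abs_mul,
      abs_of_nonneg (by positivity), one_div_mul_eq_div]
    gcongr
    have h4 : ‖lam 0 + lam 1‖ ≤ 2 * P := (norm_add_le _ _).trans (by linarith [hP 0, hP 1])
    have h5 : ‖g (D j).x - g (D' j).x‖ ≤ 2 * b :=
      (norm_sub_le _ _).trans (by linarith [hb j, hb' j])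
    calc _ ≤ ‖lam 0 + lam 1‖ * ‖g (D j).x - g (D' j).x‖ := abs_real_inner_le_norm _ _
      _ ≤ 2 * P * (2 * b) := mul_le_mul h4 h5 (norm_nonneg _) ((norm_nonneg _).trans h4)
      _ = _ := by ring
  rw [add_div]
  have h3 := abs_le.1 h1
  have h4 := abs_le.1 h2
  simp only [ebwDual]
  exact abs_le.2 ⟨by linarith [h3.1, h4.2], by linarith [h3.2, h4.1]⟩

/-- Stability of the entropy balancing weights. -/
lemma sum_sq_ebw_sub_le {r ρ P b : ℝ} (hρ : 0 ≤ ρ) (hq : ∀ i, 0 < q i) (hq1 : ∑ i, q i = 1)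
    (hqr : ∀ i j, q i ≤ r * q j) (hD : ∀ a, 0 < groupSize D a) (hD' : ∀ a, 0 < groupSize D' a)
    (hDD' : Neighbors D D') (hT0 : 0 ≤ T)
    (hT : ∀ lam ∈ ebwBox K R, ∀ i, |ebwExponent g D lam i| ≤ T)
    (hT' : ∀ lam ∈ ebwBox K R, ∀ i, |ebwExponent g D' lam i| ≤ T)
    (hP : ∀ lam ∈ ebwBox K R, ∀ a, ‖lam a‖ ≤ P)
    (hb : ∀ i, ‖g (D i).x‖ ≤ b) (hb' : ∀ i, ‖g (D' i).x‖ ≤ b)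
    (hlam : lam ∈ ebwBox K R) (hlam' : lam' ∈ ebwBox K R)
    (hmin : IsMinOn (ebwDual g q ρ D) (ebwBox K R) lam)
    (hmin' : IsMinOn (ebwDual g q ρ D') (ebwBox K R) lam')
    {A U : ℝ} (hA : A = Real.exp (-T) / (|r| + 1)) (hU : U = (|r| + 1) * Real.exp T) :
    ∑ i, (normalized (ebwTilt g q D lam) i - normalized (ebwTilt g q D' lam') i) ^ 2 ≤
      16 * (U / A) * (U * (2 * T + 1) / A + 4 * P * b) +
        2 * ((2 / A ^ 2 + 2 * U ^ 2 / A ^ 4) * (U * (U * (2 * T + 1)))) := by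
  obtain ⟨j, -⟩ := id hDD'
  have hn' : (0 : ℝ) < n := by exact_mod_cast Fin.pos j
  have hA0 : 0 < A := by rw [hA]; positivity
  have hU0 : 0 < U := by rw [hU]; positivity
  have hsc : ∀ {D : Fin n → Record X Y} {lam : Fin 2 → Euc (K + 1)},
      (∀ i, |ebwExponent g D lam i| ≤ T) → ∀ i, A ≤ n * ebwTilt g q D lam i ∧
        n * ebwTilt g q D lam i ≤ U := fun hT i => by
    rw [hA, hU]; exact ebwScore_bounds hq hq1 hqr hT i
  have hpos : ∀ (D : Fin n → Record X Y) (lam : Fin 2 → Euc (K + 1)) (i : Fin n),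
      0 < ebwTilt g q D lam i := fun D lam i => mul_pos (hq i) (Real.exp_pos _)
  have hsqrt : ∀ (D : Fin n → Record X Y) (lam : Fin 2 → Euc (K + 1)),
      (fun i => √(ebwTilt g q D lam i) ^ 2) = ebwTilt g q D lam := fun D lam =>
    funext fun i => Real.sq_sqrt (hpos D lam i).le
  have hbound : ∀ {lam : Fin 2 → Euc (K + 1)}, lam ∈ ebwBox K R → ∀ i,
      normalized (ebwTilt g q D lam) i ≤ U / A := fun {lam} hl i => by
    rw [← normalized_const_mul hn'.ne']
    exact normalized_le hA0 (fun i => (hsc (hT lam hl) i).1) (fun i => (hsc (hT lam hl) i).2) i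
  -- change of the dual variables at a fixed dataset
  have hmid : (fun a => (1 / 2 : ℝ) • (lam a + lam' a)) ∈ ebwBox K R := by
    intro a k
    have h1 := abs_le.1 (hlam a k)
    have h2 := abs_le.1 (hlam' a k)
    simp only [PiLp.smul_apply, PiLp.add_apply, smul_eq_mul]
    exact abs_le.2 ⟨by linarith [h1.1, h2.1], by linarith [h1.2, h2.2]⟩
  have e1 : ebwDual g q ρ D lam ≤ ebwDual g q ρ D fun a => (1 / 2 : ℝ) • (lam a + lam' a) :=
    hmin hmid
  have e2 : ebwDual g q ρ D' lam' ≤ ebwDual g q ρ D' lam := hmin' hlam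
  have e3 := ebwDual_midpoint (g := g) (D := D) (lam := lam) (lam' := lam') hρ hq
  have e4 := abs_le.1 (abs_ebwDual_sub_le (ρ := ρ) hq hq1 hqr hD hD' hDD' hT0 (hT lam hlam)
    (hT' lam hlam) (hP lam hlam) hb hb')
  have e5 := abs_le.1 (abs_ebwDual_sub_le (ρ := ρ) hq hq1 hqr hD hD' hDD' hT0 (hT lam' hlam')
    (hT' lam' hlam') (hP lam' hlam') hb hb')
  rw [← hA, ← hU] at e4 e5
  set F := U * (2 * T + 1) with hF
  set E := F / A + 4 * P * b with hE
  -- Optimality of `lam` on `D` at the midpoint and of `lam'` on `D'` leave two changes of dataset,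
  -- each at most E/n.
  have e6 : Real.log (∑ i, ebwTilt g q D lam i) + Real.log (∑ i, ebwTilt g q D lam' i) -
      2 * Real.log (∑ i, √(ebwTilt g q D lam i) * √(ebwTilt g q D lam' i)) ≤ 2 * (E / n) := by
    linarith [e4.1, e5.2]
  have e7 : ∑ i, (normalized (ebwTilt g q D lam) i - normalized (ebwTilt g q D lam') i) ^ 2 ≤
      8 * (U / A) * E := by
    have h := sum_sq_normalized_sq_sub_le (Bw := U / A)
      (fun i => Real.sqrt_pos.2 (hpos D lam i)) (fun i => Real.sqrt_pos.2 (hpos D lam' i))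
      (by rw [hsqrt]; exact hbound hlam) (by rw [hsqrt]; exact hbound hlam')
    simp only [Real.sq_sqrt (hpos D _ _).le] at h
    calc _ ≤ 4 * (U / A) * n * (2 * (E / n)) := h.trans (by gcongr)
      _ = _ := by field_simp; ring
  -- change of the dataset at fixed dual variables
  have e8 : ∑ i, (normalized (ebwTilt g q D lam') i - normalized (ebwTilt g q D' lam') i) ^ 2 ≤
      (2 / A ^ 2 + 2 * U ^ 2 / A ^ 4) * (U * F) := by
    have hs := hsc (hT lam' hlam')
    have hs' := hsc (hT' lam' hlam')
    rw [← normalized_const_mul hn'.ne' (ebwTilt g q D lam'),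
      ← normalized_const_mul hn'.ne' (ebwTilt g q D' lam')]
    refine (sum_sq_normalized_sub_le hA0 (fun i => (hs i).1) (fun i => (hs' i).1)
      fun i => (hs' i).2).trans (mul_le_mul_of_nonneg_left ?_ (by positivity))
    have h1 := sum_abs_ebwScore_sub_le hq hq1 hqr hD hD' hDD' hT0 (hT lam' hlam')
      (hT' lam' hlam')
    rw [← hU] at h1
    -- The scores lie in [A, U], so each squared difference is at most U times the absolute one, and
    -- the ℓ¹ sensitivity applies.
    calc _ ≤ ∑ i, U * |n * ebwTilt g q D lam' i - n * ebwTilt g q D' lam' i| := by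
          refine Finset.sum_le_sum fun i _ => ?_
          rw [← sq_abs, pow_two]
          refine mul_le_mul_of_nonneg_right (abs_sub_le_iff.2 ⟨?_, ?_⟩) (abs_nonneg _)
          · linarith [(hs i).2, (hs' i).1]
          · linarith [(hs i).1, (hs' i).2]
      _ ≤ _ := by rw [← Finset.mul_sum]; gcongr
  calc _ ≤ ∑ i, (2 * (normalized (ebwTilt g q D lam) i - normalized (ebwTilt g q D lam') i) ^ 2 +
        2 * (normalized (ebwTilt g q D lam') i - normalized (ebwTilt g q D' lam') i) ^ 2) := by
        refine Finset.sum_le_sum fun i _ => ?_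
        nlinarith [sq_nonneg ((normalized (ebwTilt g q D lam) i -
          normalized (ebwTilt g q D lam') i) - (normalized (ebwTilt g q D lam') i -
          normalized (ebwTilt g q D' lam') i))]
    _ ≤ _ := by
        rw [Finset.sum_add_distrib, ← Finset.mul_sum, ← Finset.mul_sum]
        linarith

end EBW

theorem exists_privacyGuarantee_ebw (ε₀ : ℝ) (K : ℕ) (B R r : ℝ) : ∃ c : ℝ, 0 < c ∧
    ∀ (X Y : Type*) (𝒵 : Set (Record X Y)) (g : X → Euc (K + 1)) (n : ℕ), 1 ≤ n →
    ∀ q : Fin n → ℝ, (∀ i, 0 < q i) → ∑ i, q i = 1 → (∀ i j, q i ≤ r * q j) →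
    ∀ lamEBW : ℝ, 0 ≤ lamEBW →
    ∀ w : (Fin n → Record X Y) → Fin n → ℝ,
      (∀ D ∈ ebwDatasets n 𝒵 g B, IsEBW g q R lamEBW D (w D)) →
      PrivacyGuarantee ε₀ 𝒵 (ebwDatasets n 𝒵 g B) w
        (c * (1 / (1 + lamEBW) + √(n : ℝ))) (c * √(n : ℝ)) := by
  set P := √(K + 1 : ℝ) * |R| with hP
  set T := P * |B| with hT
  have hT0 : 0 ≤ T := by positivity
  set A := Real.exp (-T) / (|r| + 1) with hA
  set U := (|r| + 1) * Real.exp T with hU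
  have hA0 : 0 < A := by positivity
  have hU0 : 0 < U := by positivity
  set S₂ := 16 * (U / A) * (U * (2 * T + 1) / A + 4 * P * |B|) +
    2 * ((2 / A ^ 2 + 2 * U ^ 2 / A ^ 4) * (U * (U * (2 * T + 1)))) with hS₂
  refine ⟨2 * (8 + |ε₀|) * (√S₂ + U / A) + √(S₂ + 2 * (U / A) ^ 2) * √2 + 1, by positivity, ?_⟩
  intro X Y 𝒵 g n hn q hq hq1 hqr lam hlam w hw
  have hn1 : (1 : ℝ) ≤ n := by exact_mod_cast hn
  have hn0 : (n : ℝ) ≠ 0 := by positivity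
  refine privacyGuarantee_of_sum_sq_le hn (fun D hD => hD.1) (fun D hD i => ?_) (fun D hD i => ?_)
    (by positivity) (fun D hD D' hD' hnb => ?_) ?_ ?_
  · obtain ⟨μ, hμ, -, h⟩ := hw D hD
    rw [h]
    exact normalized_nonneg (fun i => (mul_pos (hq i) (Real.exp_pos _)).le) i
  · obtain ⟨μ, hμ, -, h⟩ := hw D hD
    have hsc := ebwScore_bounds hq hq1 hqr (abs_ebwExponent_le hD hμ)
    rw [h, ← normalized_const_mul hn0]
    exact normalized_le hA0 (fun i => (hsc i).1) (fun i => (hsc i).2) i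
  · obtain ⟨μ, hμ, hmin, h⟩ := hw D hD
    obtain ⟨ν, hν, hmin', h'⟩ := hw D' hD'
    rw [h, h']
    exact sum_sq_ebw_sub_le hlam hq hq1 hqr hD.2.1 hD'.2.1 hnb hT0
      (fun _ hl => abs_ebwExponent_le hD hl) (fun _ hl => abs_ebwExponent_le hD' hl)
      (fun _ hl => norm_le_of_mem_ebwBox hl) (norm_moment_le hD) (norm_moment_le hD') hμ hν
      hmin hmin' hA hU
  · have : 0 ≤ 1 / (1 + lam) := by positivity
    linarith
  · have h1 : 1 / (1 + lam) ≤ 1 := div_le_one_of_le₀ (by linarith) (by linarith)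
    have h2 : 1 ≤ √(n : ℝ) := Real.one_le_sqrt.2 hn1
    linarith

end DP2ERM

end

/-! ### Assembly of the five schemes. -/

theorem mainTheorem7 (ε₀ : ℝ) :
    -- IPW in a randomized trial
    (∀ π : ℝ, 0 < π → π < 1 → ∃ c : ℝ, 0 < c ∧
      ∀ (X Y : Type*) (𝒵 : Set (DP2ERM.Record X Y)) (n : ℕ), 1 ≤ n →
        DP2ERM.PrivacyGuarantee ε₀ 𝒵 (DP2ERM.feasibleDatasets n 𝒵) (DP2ERM.ipwRandomized π)
          (c * 1) (c * √(n : ℝ))) ∧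
    -- IPW with known regression parameter
    (∀ M R : ℝ, ∃ c : ℝ, 0 < c ∧
      ∀ (d : ℕ) (Y : Type*) (𝒵 : Set (DP2ERM.Record (DP2ERM.Euc d) Y)), (∀ z ∈ 𝒵, ‖z.x‖ ≤ M) →
      ∀ μ : DP2ERM.Euc d, ‖μ‖ ≤ R → ∀ n : ℕ, 1 ≤ n →
        DP2ERM.PrivacyGuarantee ε₀ 𝒵 (DP2ERM.feasibleDatasets n 𝒵) (DP2ERM.ipwLogistic μ)
          (c * 1) (c * √(n : ℝ))) ∧
    -- IPW with estimated regression parameter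
    (∀ M R : ℝ, ∃ c : ℝ, 0 < c ∧
      ∀ (d : ℕ) (Y : Type*) (𝒵 : Set (DP2ERM.Record (DP2ERM.Euc d) Y)), (∀ z ∈ 𝒵, ‖z.x‖ ≤ M) →
      ∀ (n : ℕ), 1 ≤ n → ∀ lamIPW : ℝ, 0 ≤ lamIPW →
      ∀ w : (Fin n → DP2ERM.Record (DP2ERM.Euc d) Y) → Fin n → ℝ,
        (∀ D ∈ DP2ERM.feasibleDatasets n 𝒵, DP2ERM.IsEstimatedIPW R lamIPW D (w D)) →
        DP2ERM.PrivacyGuarantee ε₀ 𝒵 (DP2ERM.feasibleDatasets n 𝒵) w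
          (c * (√(n : ℝ) / (1 + lamIPW) + √(n : ℝ))) (c * √(n : ℝ))) ∧
    -- MMD weights, for both scalings of the quadratic regularization
    (∀ C R : ℝ, ∃ c : ℝ, 0 < c ∧
      ∀ (X Y H : Type*) [NormedAddCommGroup H] [InnerProductSpace ℝ H] [CompleteSpace H]
        [RKHS ℝ H X ℝ] (𝒵 : Set (DP2ERM.Record X Y)),
        (∀ z ∈ 𝒵, ∀ z' ∈ 𝒵, RKHS.kernel H z.x z'.x 1 ≤ C) →
      ∀ α : ℝ, 0 ≤ α → α ≤ 1 → ∀ n : ℕ, 1 ≤ n → ∀ lamMMD : ℝ, 0 < lamMMD →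
      ∀ κ : ℝ, (κ = lamMMD / n ^ 2 ∨ κ = lamMMD / 2) →
      ∀ w : (Fin n → DP2ERM.Record X Y) → Fin n → ℝ,
        (∀ D ∈ DP2ERM.mmdDatasets n 𝒵 R, DP2ERM.IsMMDWeight H R α κ D (w D)) →
        DP2ERM.PrivacyGuarantee ε₀ 𝒵 (DP2ERM.mmdDatasets n 𝒵 R) w
          (c * ((n : ℝ) ^ (3 / 2 : ℝ) / lamMMD + √(n : ℝ)))
          (c * ((n : ℝ) ^ (3 / 2 : ℝ) / lamMMD + √(n : ℝ)))) ∧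
    -- entropy balancing weights
    (∀ (K : ℕ) (B R r : ℝ), ∃ c : ℝ, 0 < c ∧
      ∀ (X Y : Type*) (𝒵 : Set (DP2ERM.Record X Y)) (g : X → DP2ERM.Euc (K + 1)) (n : ℕ), 1 ≤ n →
      ∀ q : Fin n → ℝ, (∀ i, 0 < q i) → ∑ i, q i = 1 → (∀ i j, q i ≤ r * q j) →
      ∀ lamEBW : ℝ, 0 ≤ lamEBW →
      ∀ w : (Fin n → DP2ERM.Record X Y) → Fin n → ℝ,
        (∀ D ∈ DP2ERM.ebwDatasets n 𝒵 g B, DP2ERM.IsEBW g q R lamEBW D (w D)) →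
        DP2ERM.PrivacyGuarantee ε₀ 𝒵 (DP2ERM.ebwDatasets n 𝒵 g B) w
          (c * (1 / (1 + lamEBW) + √(n : ℝ))) (c * √(n : ℝ))) := by
  refine ⟨?_, ?_, DP2ERM.exists_privacyGuarantee_estimatedIPW ε₀,
    DP2ERM.exists_privacyGuarantee_mmd ε₀, DP2ERM.exists_privacyGuarantee_ebw ε₀⟩
  · intro π h0 h1
    have h1' : 0 < 1 - π := sub_pos.2 h1
    have e0 : 1 ≤ 1 / π := (one_le_div h0).2 h1.le
    have e1 : 1 ≤ 1 / (1 - π) := (one_le_div h1').2 (by linarith)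
    obtain ⟨c, hc, h⟩ := DP2ERM.exists_privacyGuarantee_of_scores ε₀ one_pos
      (show (1 : ℝ) ≤ 1 / π + 1 / (1 - π) by linarith)
    refine ⟨c, hc, fun X Y 𝒵 n hn => h 𝒵 (fun z => 1 / (if z.a = 1 then π else 1 - π))
      (fun z _ => ?_) n hn⟩
    split_ifs <;> constructor <;> linarith
  · intro M R
    obtain ⟨c, hc, h⟩ := DP2ERM.exists_privacyGuarantee_of_scores ε₀ one_pos
      (show (1 : ℝ) ≤ 1 + Real.exp (|M| * |R|) by linarith [Real.exp_pos (|M| * |R|)])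
    refine ⟨c, hc, fun d Y 𝒵 hM μ hμ n hn => h 𝒵 (fun z => 1 + Real.exp (-inner ℝ z.x μ))
      (fun z hz => ⟨by linarith [Real.exp_pos (-inner ℝ z.x μ)], ?_⟩) n hn⟩
    have h2 := (abs_le.1 (DP2ERM.abs_inner_le_mul_abs (hM z hz) hμ)).1
    gcongr
    linarith
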